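/- **Setting.** Let $Q$ be a smooth (Hausdorff, second countable) $n$-manifold without boundary, $T^*Q$ its cotangent bundle with Darboux coordinates $(q^i,p_i)$, symplectic form $\omega=dq^\ell\wedge dp_\ell$ and symplectic volume $dq\,dp$. *Lie algebra.* For a function $h$ on $T^*Q$ let $X_h$ be given by $\iota_{X_h}\omega=dh$. The non-flat Hamiltonian vector fields $\mathfrak X_{\mathrm{Ham},0}(T^*Q)$ are the formal series $X_h=\sum_{k\ge 0}X_{h^k}$, where $h=\sum_k h^k$ is a formal power series in the momenta, $h^k=\mathbb X^{i_1\dots i_k}(q)p_{i_1}\cdots p_{i_k}$ with smooth coefficients; the bracket is the opposite of the Jacobi–Lie bracket. Let $\mathfrak s^c$ and $\mathfrak n^c$ be the subalgebras of the series whose terms have degree $k\le 1$, respectively $k\ge 2$. *Dual.* A 1-form $\Pi=\Pi_\ell\, dq^\ell+\Pi^\ell\, dp_\ell$ on $T^*Q$ (smooth, supported over a compact subset of $Q$, and rapidly decreasing in $p$ with all its derivatives, locally uniformly in $q$) is paired with $X=\sum_j X^j$ by $\langle\Pi,X\rangle=\sum_j\int_{T^*Q}\Pi(X^j)\,dq\,dp$.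 Put $\Pi^\sharp=\Pi^\ell\partial_{q^\ell}-\Pi_\ell\partial_{p_\ell}$; the $k$-th moment of $\Pi$ is $\int p_{i_1}\cdots p_{i_k}\,\mathrm{div}(\Pi^\sharp)\,dp$. The space $\mathfrak X^*_{\mathrm{Ham},0}$ consists of the $\Pi$ with only finitely many non-zero moments, two forms being identified if they have the same pairing with every non-flat Hamiltonian vector field. $(\mathfrak s^c)^*$ and $(\mathfrak n^c)^*$ are the parts with vanishing moments of order $\ge 2$, respectively of orders $0$ and $1$. Equations between elements of the dual, and time derivatives, are understood through the pairing with all non-flat Hamiltonian vector fields. The coadjoint action is $\langle \mathrm{ad}^*_X\Pi,Y\rangle=-\langle\Pi,[X,Y]\rangle$. With $\eta\triangleright\xi$ and $\eta\triangleleft\xi$ the $\mathfrak s^c$- and $\mathfrak n^c$-parts of $[\eta,\xi]$ ($\eta\in\mathfrak n^c$, $\xi\in\mathfrak s^c$), put $\langle\mu\overset{*}{\triangleleft}\eta,\xi\rangle=\langle \mathfrak b^*_\xi\mu,\eta\rangle=\langle\mu,\eta\triangleright\xi\rangle$ and $\langle\xi\overset{*}{\triangleright}\nu,\eta\rangle=\langle\mathfrak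 a^*_\eta\nu,\xi\rangle=\langle\nu,\eta\triangleleft\xi\rangle$. The operator $J_{LP}(\Pi)$ is $$J_{LP}(\Pi)=-\begin{pmatrix}\Pi_i\frac{\partial}{\partial q^j}+\frac{\partial\Pi_j}{\partial q^i}+\Pi_j\frac{\partial}{\partial q^i}&\Pi^i\frac{\partial}{\partial q^j}+\frac{\partial\Pi_j}{\partial p_i}+\Pi_j\frac{\partial}{\partial p_i}\\ \Pi_i\frac{\partial}{\partial p_j}+\frac{\partial\Pi^j}{\partial q^i}+\Pi^j\frac{\partial}{\partial q^i}&\Pi^i\frac{\partial}{\partial p_j}+\frac{\partial\Pi^j}{\partial p_i}+\Pi^j\frac{\partial}{\partial p_i}\end{pmatrix},$$ extended to formal series $X=\sum_k X^k$ by $J_{LP}(\Pi)(X)=\sum_kJ_{LP}(\Pi)(X^k)$ in the dual. **Statement.** (1) Every $\Pi\in\mathfrak X^*_{\mathrm{Ham},0}$ is a finite sum $\Pi=\sum_{k\ge0}\Pi^{(k)}$, where $\Pi^{(k)}$ has no non-zero moment of order other than $k$; the $\Pi^{(k)}$ are unique in the dual. With $\Pi^{\mathfrak s}=\Pi^{(0)}+\Pi^{(1)}\in(\mathfrak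 s^c)^*$ and $\Pi^{\mathfrak n}=\sum_{k\ge2}\Pi^{(k)}\in(\mathfrak n^c)^*$ this gives $\mathfrak X^*_{\mathrm{Ham},0}=(\mathfrak s^c)^*\oplus(\mathfrak n^c)^*$. (2) Let $\mathcal H$ be a functional and $\Pi(t)$, $t$ in an open set of times, a curve in $\mathfrak X^*_{\mathrm{Ham},0}$ along which $\mathcal H$ has a functional derivative $\frac{\partial\mathcal H}{\partial\Pi}=\sum_k X^k\in\mathfrak X_{\mathrm{Ham},0}$. Then $\frac{\partial\mathcal H}{\partial\Pi^{\mathfrak s}}=X^0+X^1$, $\frac{\partial\mathcal H}{\partial\Pi^{\mathfrak n}}=\sum_{k\ge2}X^k$ and $\frac{\partial\mathcal H}{\partial\Pi^{(k)}}=X^k$ are partial functional derivatives of $\mathcal H$ along $(\mathfrak s^c)^*$, $(\mathfrak n^c)^*$ and the forms with only a $k$-th moment. The Lie–Poisson equation $\frac{d\Pi}{dt}=-\mathrm{ad}^*_{\partial\mathcal H/\partial\Pi}\Pi$ is equivalent to the matched Lie–Poisson equations $$\frac{d\Pi^{\mathfrak s}}{dt}=-\mathrm{ad}^*_{\frac{\partial\mathcal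 H}{\partial\Pi^{\mathfrak s}}}\Pi^{\mathfrak s}+\Pi^{\mathfrak s}\overset{*}{\triangleleft}\tfrac{\partial\mathcal H}{\partial\Pi^{\mathfrak n}}+\mathfrak a^*_{\frac{\partial\mathcal H}{\partial\Pi^{\mathfrak n}}}\Pi^{\mathfrak n},\qquad \frac{d\Pi^{\mathfrak n}}{dt}=-\mathrm{ad}^*_{\frac{\partial\mathcal H}{\partial\Pi^{\mathfrak n}}}\Pi^{\mathfrak n}-\tfrac{\partial\mathcal H}{\partial\Pi^{\mathfrak s}}\overset{*}{\triangleright}\Pi^{\mathfrak n}-\mathfrak b^*_{\frac{\partial\mathcal H}{\partial\Pi^{\mathfrak s}}}\Pi^{\mathfrak s}$$ in $(\mathfrak s^c)^*$ and $(\mathfrak n^c)^*$, and also to the system $$\begin{aligned}\frac{d\Pi^{\mathfrak s}}{dt}&=-J_{LP}(\Pi^{(0)})\Big(\frac{\partial\mathcal H}{\partial\Pi^{\mathfrak s}}\Big)-J_{LP}(\Pi^{(1)})\Big(\frac{\partial\mathcal H}{\partial\Pi^{(1)}}\Big)-J_{LP}(\Pi^{\mathfrak s})\Big(\frac{\partial\mathcal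 H}{\partial\Pi^{\mathfrak n}}\Big)\\&\qquad-\sum_{k\ge2}J_{LP}(\Pi^{(k)})\Big(\frac{\partial\mathcal H}{\partial\Pi^{(k)}}\Big)-\sum_{k\ge2}J_{LP}(\Pi^{(k)})\Big(\frac{\partial\mathcal H}{\partial\Pi^{(k+1)}}\Big),\\ \frac{d\Pi^{\mathfrak n}}{dt}&=-\sum_{m\ge2}\sum_{k\ge2}J_{LP}(\Pi^{(m+k-1)})\Big(\frac{\partial\mathcal H}{\partial\Pi^{(k)}}\Big)-J_{LP}(\Pi^{\mathfrak n})\Big(\frac{\partial\mathcal H}{\partial\Pi^{\mathfrak s}}\Big)-J_{LP}(\Pi^{(1)})\Big(\frac{\partial\mathcal H}{\partial\Pi^{(0)}}\Big).\end{aligned}$$ (3) In particular, let $h=\varphi(q)+K(q,p)$ with $\varphi$ smooth and $K$ smooth and quadratic in $p$ (for instance $h=e\phi(q)+p^2/2m$). The functional $\mathcal H(\Pi)=\langle\Pi,-X_h\rangle$ has the functional derivative $-X_h$, and the momentum-Vlasov equation $\frac{d\Pi}{dt}=-\mathrm{ad}^*_{-X_h}\Pi$ is equivalent to $$\frac{d\Pi^{\mathfrak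 s}}{dt}=J_{LP}(\Pi^{(0)})(X_\varphi)+J_{LP}(\Pi^{\mathfrak s})(X_K)+J_{LP}(\Pi^{(2)})(X_K),$$ $$\frac{d\Pi^{\mathfrak n}}{dt}=\sum_{k\ge2}J_{LP}(\Pi^{(k+1)})(X_K)+J_{LP}(\Pi^{\mathfrak n})(X_\varphi)+J_{LP}(\Pi^{(1)})(X_\varphi).$$ -/

import Mathlib

set_option synthInstance.maxHeartbeats 200000

open Bundle MeasureTheory
open scoped Manifold ContDiff

noncomputable section

namespace MomentumVlasov

/-! ### The cotangent bundle, its Darboux charts and its symplectic volume -/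

/-- The model space of an `n`-manifold. -/
abbrev Base (n : ℕ) : Type := EuclideanSpace ℝ (Fin n)

/-- The space of values `(q, p)` of Darboux coordinates; a covector `p` has the components
`p_i = p (∂/∂q^i)`. -/
abbrev Phase (n : ℕ) : Type := Base n × (Base n →L[ℝ] ℝ)

instance (n : ℕ) : NormedAddCommGroup (Phase n →L[ℝ] ℝ) :=
  ContinuousLinearMap.toNormedAddCommGroup

instance (n : ℕ) : NormedSpace ℝ (Phase n →L[ℝ] ℝ) := ContinuousLinearMap.toNormedSpace

/-- The coordinate vector `∂/∂q^i`. -/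
abbrev dirQ {n : ℕ} (i : Fin n) : Base n := EuclideanSpace.single i (1 : ℝ)

/-- The coordinate covector `dq^i`, which is also the direction `∂/∂p_i` in phase space. -/
abbrev dirP {n : ℕ} (i : Fin n) : Base n →L[ℝ] ℝ := EuclideanSpace.proj i

/-- Lebesgue measure `dp = dp_1 ⋯ dp_n` on the space of covectors. -/
def momentumVolume (n : ℕ) : Measure (Base n →L[ℝ] ℝ) :=
  Measure.map (fun a : Base n => innerSL ℝ a) volume

section

variable (n : ℕ) (Q : Type*) [TopologicalSpace Q] [ChartedSpace (Base n) Q]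
  [IsManifold (𝓡 n) ∞ Q]

/-- The cotangent bundle `T*Q`. -/
abbrev Cotangent : Type _ :=
  TotalSpace (Base n →L[ℝ] ℝ)
    (fun q : Q => TangentSpace (𝓡 n) q →L[ℝ] Bundle.Trivial Q ℝ q)

/-- The model with corners of the manifold `T*Q`. -/
abbrev phaseModel : ModelWithCorners ℝ (Phase n) (ModelProd (Base n) (Base n →L[ℝ] ℝ)) :=
  (𝓡 n).prod 𝓘(ℝ, Base n →L[ℝ] ℝ)

instance : MeasurableSpace (Cotangent n Q) := borel _

instance : BorelSpace (Cotangent n Q) := ⟨rfl⟩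

/-- Differential 1-forms `Π` on `T*Q` (regularity is imposed separately). -/
abbrev OneForm : Type _ := (x : Cotangent n Q) → (TangentSpace (phaseModel n) x →L[ℝ] ℝ)

instance : AddCommGroup (OneForm n Q) :=
  @Pi.addCommGroup _ _ fun _ => ContinuousLinearMap.addCommGroup

instance : Module ℝ (OneForm n Q) :=
  @Pi.module _ _ _ _ _ fun _ => ContinuousLinearMap.module

/-- Vector fields on `T*Q` (regularity is imposed separately). -/
abbrev VField : Type _ := (x : Cotangent n Q) → TangentSpace (phaseModel n) x

instance : AddCommGroup (VField n Q) := Pi.addCommGroup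

/-- Formal series `∑ₖ X^k` of vector fields on `T*Q`. -/
abbrev FormalField : Type _ := ℕ → VField n Q

variable {n Q}

/-- The Darboux chart `(q^i, p_i)` of `T*Q` induced by the preferred chart of `Q` at `q₀`. It is
also the preferred chart of `T*Q` at each point of the fibre over `q₀`, so a tangent vector at a
point over `q₀` is the pair of its `q`- and `p`-components in this chart. -/
def darboux (q₀ : Q) : PartialEquiv (Cotangent n Q) (Phase n) :=
  extChartAt (phaseModel n) (⟨q₀, 0⟩ : Cotangent n Q)

variable (n Q) in
/-- The symplectic volume `dq dp` on `T*Q`: the smallest measure that dominates, for each of the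
Darboux charts, the Lebesgue measure `dq dp` of that chart. As these agree on overlaps, it is the
measure that they glue to. -/
def symplecticVolume : Measure (Cotangent n Q) :=
  ⨆ q₀ : Q, Measure.map (darboux (n := n) q₀).symm
    ((volume.prod (momentumVolume n)).restrict (darboux (n := n) q₀).target)

/-- A 1-form read in the Darboux chart over `q₀`. -/
def localForm (q₀ : Q) (Pi : OneForm n Q) (y : Phase n) : Phase n →L[ℝ] ℝ :=
  (Pi ((darboux (n := n) q₀).symm y)).comp
    (mfderiv 𝓘(ℝ, Phase n) (phaseModel n) (darboux (n := n) q₀).symm y)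

/-- A vector field read in the Darboux chart over `q₀`. -/
def localField (q₀ : Q) (X : VField n Q) (y : Phase n) : Phase n :=
  mfderiv (phaseModel n) 𝓘(ℝ, Phase n) (darboux (n := n) q₀) ((darboux (n := n) q₀).symm y)
    (X ((darboux (n := n) q₀).symm y))

/-- `∂F/∂q^i` -/
def partialQ (i : Fin n) (F : Phase n → ℝ) (y : Phase n) : ℝ := fderiv ℝ F y (dirQ i, 0)

/-- `∂F/∂p_i` -/
def partialP (i : Fin n) (F : Phase n → ℝ) (y : Phase n) : ℝ := fderiv ℝ F y (0, dirP i)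

/-- The component `Π_i` of `Π = Π_i dq^i + Π^i dp_i`. -/
def formQ (q₀ : Q) (Pi : OneForm n Q) (i : Fin n) (y : Phase n) : ℝ :=
  localForm q₀ Pi y (dirQ i, 0)

/-- The component `Π^i` of `Π = Π_i dq^i + Π^i dp_i`. -/
def formP (q₀ : Q) (Pi : OneForm n Q) (i : Fin n) (y : Phase n) : ℝ :=
  localForm q₀ Pi y (0, dirP i)

/-- The component `X^i` of `X = X^i ∂/∂q^i + X_i ∂/∂p_i`. -/
def fieldQ (q₀ : Q) (X : VField n Q) (i : Fin n) (y : Phase n) : ℝ := (localField q₀ X y).1 i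

/-- The component `X_i` of `X = X^i ∂/∂q^i + X_i ∂/∂p_i`. -/
def fieldP (q₀ : Q) (X : VField n Q) (i : Fin n) (y : Phase n) : ℝ :=
  (localField q₀ X y).2 (dirQ i)

/-! ### Non-flat Hamiltonian vector fields -/

/-- The symplectic form `dq^ℓ ∧ dp_ℓ`. -/
def symplecticForm (x : Cotangent n Q) (u v : TangentSpace (phaseModel n) x) : ℝ :=
  (v : Phase n).2 (u : Phase n).1 - (u : Phase n).2 (v : Phase n).1

/-- `X` is the Hamiltonian vector field `X_h`, that is, `ι_X ω = dh`. -/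
def IsHamiltonianField (h : Cotangent n Q → ℝ) (X : VField n Q) : Prop :=
  ∀ (x : Cotangent n Q) (v : TangentSpace (phaseModel n) x),
    symplecticForm x (X x) v = mfderiv (phaseModel n) 𝓘(ℝ, ℝ) h x v

/-- The smooth functions `𝕏^{i_1 … i_k}(q) p_{i_1} ⋯ p_{i_k}` on `T*Q`. -/
def homogeneousFunctions (n : ℕ) (Q : Type*) [TopologicalSpace Q] [ChartedSpace (Base n) Q]
    [IsManifold (𝓡 n) ∞ Q] (k : ℕ) : Set (Cotangent n Q → ℝ) :=
  {h | ContMDiff (phaseModel n) 𝓘(ℝ, ℝ) ∞ h ∧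
    ∀ q : Q, ∃ T : MultilinearMap ℝ (fun _ : Fin k => Base n →L[ℝ] ℝ) ℝ,
      ∀ p : Base n →L[ℝ] ℝ, h ⟨q, p⟩ = T fun _ => p}

/-- The Hamiltonian vector fields of the functions that are homogeneous of degree `k` in the
momenta. -/
def homogeneousFields (n : ℕ) (Q : Type*) [TopologicalSpace Q] [ChartedSpace (Base n) Q]
    [IsManifold (𝓡 n) ∞ Q] (k : ℕ) : Set (VField n Q) :=
  {X | ∃ h ∈ homogeneousFunctions n Q k, IsHamiltonianField h X}

/-- The non-flat Hamiltonian vector fields: the formal series `X_h = ∑ₖ X_{h^k}` where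
`h = ∑ₖ h^k` is a formal power series in the momenta. -/
def hamFields (n : ℕ) (Q : Type*) [TopologicalSpace Q] [ChartedSpace (Base n) Q]
    [IsManifold (𝓡 n) ∞ Q] : Set (FormalField n Q) :=
  {X | ∀ k, X k ∈ homogeneousFields n Q k}

/-- The part `∑_{k ≤ 1} X^k`. -/
def sPart (X : FormalField n Q) : FormalField n Q := fun k => if k ≤ 1 then X k else 0

/-- The part `∑_{k ≥ 2} X^k`. -/
def nPart (X : FormalField n Q) : FormalField n Q := fun k => if 2 ≤ k then X k else 0

/-- The part `X^k`. -/
def degPart (k : ℕ) (X : FormalField n Q) : FormalField n Q := fun j => if j = k then X j else 0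

/-- The subalgebra `𝔰ᶜ`. -/
def sFields (n : ℕ) (Q : Type*) [TopologicalSpace Q] [ChartedSpace (Base n) Q]
    [IsManifold (𝓡 n) ∞ Q] : Set (FormalField n Q) :=
  {X | X ∈ hamFields n Q ∧ ∀ k, 2 ≤ k → X k = 0}

/-- The subalgebra `𝔫ᶜ`. -/
def nFields (n : ℕ) (Q : Type*) [TopologicalSpace Q] [ChartedSpace (Base n) Q]
    [IsManifold (𝓡 n) ∞ Q] : Set (FormalField n Q) :=
  {X | X ∈ hamFields n Q ∧ ∀ k, k ≤ 1 → X k = 0}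

/-- The non-flat Hamiltonian vector fields that are homogeneous of degree `k`. -/
def degFields (n : ℕ) (Q : Type*) [TopologicalSpace Q] [ChartedSpace (Base n) Q]
    [IsManifold (𝓡 n) ∞ Q] (k : ℕ) : Set (FormalField n Q) :=
  {X | X ∈ hamFields n Q ∧ ∀ j, j ≠ k → X j = 0}

/-- The Lie bracket of formal series of vector fields: the opposite of the Jacobi-Lie bracket.
The Jacobi-Lie bracket of Hamiltonian vector fields of degrees `k` and `j` has degree
`k + j - 1` (and is zero for `k = j = 0`). -/
def bracket (X Y : FormalField n Q) : FormalField n Q := fun m x =>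
  -∑ kj ∈ Finset.HasAntidiagonal.antidiagonal (m + 1),
    VectorField.mlieBracket (phaseModel n) (X kj.1) (Y kj.2) x

/-! ### The dual space -/

/-- The pairing `⟨Π, X⟩ = ∑ⱼ ∫ Π(X^j) dq dp` of a 1-form with a formal series of vector fields. -/
def pairing (Pi : OneForm n Q) (X : FormalField n Q) : ℝ :=
  ∑ᶠ j : ℕ, ∫ x, Pi x (X j x) ∂symplecticVolume n Q

/-- The divergence of `Π^♯ = Π^ℓ ∂/∂q^ℓ - Π_ℓ ∂/∂p_ℓ`. -/
def divSharp (Pi : OneForm n Q) (x : Cotangent n Q) : ℝ :=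
  ∑ l : Fin n, (partialQ l (formP x.proj Pi l) (darboux x.proj x)
    - partialP l (formQ x.proj Pi l) (darboux x.proj x))

/-- The `k`-th moment `∫ p_{i_1} ⋯ p_{i_k} div(Π^♯) dp` vanishes, at each point of `Q`. -/
def MomentVanishes (k : ℕ) (Pi : OneForm n Q) : Prop :=
  ∀ (q : Q) (i : Fin k → Fin n),
    ∫ p : Base n →L[ℝ] ℝ, (∏ j, p (dirQ (i j))) * divSharp Pi ⟨q, p⟩ ∂momentumVolume n = 0

/-- The regularity of the 1-forms: smooth, supported over a compact subset of `Q`, and, with all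
derivatives, rapidly decreasing in the momenta, locally uniformly in the position. -/
def IsRegular (Pi : OneForm n Q) : Prop :=
  (∃ K : Set Q, IsCompact K ∧ ∀ x : Cotangent n Q, x.proj ∉ K → Pi x = 0) ∧
  ∀ q₀ : Q, ContDiffOn ℝ ∞ (localForm q₀ Pi) (darboux q₀).target ∧
    ∀ K : Set (Base n), IsCompact K → K ⊆ (extChartAt (𝓡 n) q₀).target → ∀ m N : ℕ,
      ∃ C : ℝ, ∀ a ∈ K, ∀ p : Base n →L[ℝ] ℝ,
        ‖p‖ ^ N * ‖iteratedFDeriv ℝ m (localForm q₀ Pi) (a, p)‖ ≤ C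

/-- The 1-forms that represent the elements of the dual space of the non-flat Hamiltonian vector
fields: those for which all but finitely many of the moments of `div(Π^♯)` vanish. -/
def dualForms (n : ℕ) (Q : Type*) [TopologicalSpace Q] [ChartedSpace (Base n) Q]
    [IsManifold (𝓡 n) ∞ Q] : Set (OneForm n Q) :=
  {Pi | IsRegular Pi ∧ ∃ N : ℕ, ∀ k, N ≤ k → MomentVanishes k Pi}

/-- The forms that represent the elements of `(𝔰ᶜ)*`. -/
def sDual (n : ℕ) (Q : Type*) [TopologicalSpace Q] [ChartedSpace (Base n) Q]
    [IsManifold (𝓡 n) ∞ Q] : Set (OneForm n Q) :=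
  {Pi | Pi ∈ dualForms n Q ∧ ∀ k, 2 ≤ k → MomentVanishes k Pi}

/-- The forms that represent the elements of `(𝔫ᶜ)*`. -/
def nDual (n : ℕ) (Q : Type*) [TopologicalSpace Q] [ChartedSpace (Base n) Q]
    [IsManifold (𝓡 n) ∞ Q] : Set (OneForm n Q) :=
  {Pi | Pi ∈ dualForms n Q ∧ ∀ k, k ≤ 1 → MomentVanishes k Pi}

/-- The forms of which only the `k`-th moment may be non-zero. -/
def degDual (n : ℕ) (Q : Type*) [TopologicalSpace Q] [ChartedSpace (Base n) Q]
    [IsManifold (𝓡 n) ∞ Q] (k : ℕ) : Set (OneForm n Q) :=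
  {Pi | Pi ∈ dualForms n Q ∧ ∀ j, j ≠ k → MomentVanishes j Pi}

/-- Two 1-forms are the same element of the dual space. -/
def DualEq (Pi Pi' : OneForm n Q) : Prop :=
  ∀ Y ∈ hamFields n Q, pairing Pi Y = pairing Pi' Y

/-- `Π = ∑ₖ Π^{(k)}` is the (finite) moment decomposition of `Π`. -/
def IsMomentDecomposition (Pi : OneForm n Q) (P : ℕ → OneForm n Q) : Prop :=
  (∀ k, P k ∈ degDual n Q k) ∧ (∃ N : ℕ, ∀ k, N ≤ k → P k = 0) ∧ DualEq Pi (∑ᶠ k : ℕ, P k)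

/-- `Π^𝔰 = Π^{(0)} + Π^{(1)}` -/
def sForm (P : ℕ → OneForm n Q) : OneForm n Q := P 0 + P 1

/-- `Π^𝔫 = ∑_{k ≥ 2} Π^{(k)}` -/
def nForm (P : ℕ → OneForm n Q) : OneForm n Q := ∑ᶠ (k : ℕ) (_ : 2 ≤ k), P k

/-! ### Coadjoint action, the operator `J_LP`, and the dual and cross actions

Elements of the dual space are given below by their values on the non-flat Hamiltonian vector
fields. -/

/-- The coadjoint action: `⟨ad*_X Π, Y⟩ = -⟨Π, [X, Y]⟩`. -/
def coad (X : FormalField n Q) (Pi : OneForm n Q) (Y : FormalField n Q) : ℝ :=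
  -pairing Pi (bracket X Y)

/-- The 1-form `J_LP(Π)(X)`, that is, the matrix operator
`-(Π_i ∂_{q^j} + ∂Π_j/∂q^i + Π_j ∂_{q^i},  Π^i ∂_{q^j} + ∂Π_j/∂p_i + Π_j ∂_{p_i})` (first row),
`-(Π_i ∂_{p_j} + ∂Π^j/∂q^i + Π^j ∂_{q^i},  Π^i ∂_{p_j} + ∂Π^j/∂p_i + Π^j ∂_{p_i})` (second row),
applied to the column `(X^i, X_i)` in Darboux coordinates. -/
def JLP (Pi : OneForm n Q) (X : VField n Q) : OneForm n Q := fun x =>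
  let y : Phase n := darboux x.proj x
  let A := formQ x.proj Pi
  let B := formP x.proj Pi
  let U := fieldQ x.proj X
  let V := fieldP x.proj X
  let rowQ : Fin n → ℝ := fun j => -∑ i : Fin n,
    (A i y * partialQ j (U i) y + partialQ i (A j) y * U i y + A j y * partialQ i (U i) y
      + (B i y * partialQ j (V i) y + partialP i (A j) y * V i y + A j y * partialP i (V i) y))
  let rowP : Fin n → ℝ := fun j => -∑ i : Fin n,
    (A i y * partialP j (U i) y + partialQ i (B j) y * U i y + B j y * partialQ i (U i) y
      + (B i y * partialP j (V i) y + partialP i (B j) y * V i y + B j y * partialP i (V i) y))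
  let form : Phase n →L[ℝ] ℝ := ∑ j : Fin n,
    (rowQ j • (dirP j).comp (ContinuousLinearMap.fst ℝ (Base n) (Base n →L[ℝ] ℝ))
      + rowP j • (ContinuousLinearMap.apply ℝ ℝ (dirQ j)).comp
          (ContinuousLinearMap.snd ℝ (Base n) (Base n →L[ℝ] ℝ)))
  form

/-- The element `J_LP(Π)(X) = ∑ₖ J_LP(Π)(X^k)` of the dual space, for a formal series `X`, evaluated
on `Y`. -/
def JLPdual (Pi : OneForm n Q) (X Y : FormalField n Q) : ℝ :=
  ∑ᶠ kj : ℕ × ℕ, ∫ x, JLP Pi (X kj.1) x (Y kj.2 x) ∂symplecticVolume n Q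

/-- `⟨Π ◁* η, ξ⟩ = ⟨Π, η ▷ ξ⟩`, where `η ▷ ξ` is the `𝔰ᶜ`-part of `[η, ξ]`. -/
def dualRightAction (Pi : OneForm n Q) (eta xi : FormalField n Q) : ℝ :=
  pairing Pi (sPart (bracket eta xi))

/-- `⟨ξ ▷* Π, η⟩ = ⟨Π, η ◁ ξ⟩`, where `η ◁ ξ` is the `𝔫ᶜ`-part of `[η, ξ]`. -/
def dualLeftAction (xi : FormalField n Q) (Pi : OneForm n Q) (eta : FormalField n Q) : ℝ :=
  pairing Pi (nPart (bracket eta xi))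

/-- `⟨𝔞*_η Π, ξ⟩ = ⟨Π, η ◁ ξ⟩` -/
def crossA (eta : FormalField n Q) (Pi : OneForm n Q) (xi : FormalField n Q) : ℝ :=
  pairing Pi (nPart (bracket eta xi))

/-- `⟨𝔟*_ξ Π, η⟩ = ⟨Π, η ▷ ξ⟩` -/
def crossB (xi : FormalField n Q) (Pi : OneForm n Q) (eta : FormalField n Q) : ℝ :=
  pairing Pi (sPart (bracket eta xi))

/-! ### Functional derivatives and the equations of motion -/

/-- `X ∈ V` is the (partial) functional derivative of `H` at `Π` along the directions in `W`:
`d/dε H(Π + ε Δ) = ⟨Δ, X⟩` at `ε = 0` for each `Δ ∈ W`. -/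
def IsFunctionalDeriv (H : OneForm n Q → ℝ) (W : Set (OneForm n Q)) (V : Set (FormalField n Q))
    (Pi : OneForm n Q) (X : FormalField n Q) : Prop :=
  X ∈ V ∧ ∀ D ∈ W, HasDerivAt (fun ε : ℝ => H (Pi + ε • D)) (pairing D X) 0

/-- The curve `Π` in the dual space satisfies `dΠ/dt = F` for the times in `I`, both sides being
compared on all elements of `V`. -/
def EvolvesBy (I : Set ℝ) (V : Set (FormalField n Q)) (Pi : ℝ → OneForm n Q)
    (F : ℝ → FormalField n Q → ℝ) : Prop :=
  ∀ t ∈ I, ∀ Y ∈ V, HasDerivAt (fun s => pairing (Pi s) Y) (F t Y) t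

/-- The Lie-Poisson equation `dΠ/dt = -ad*_X Π`, with `X = ∂H/∂Π`. -/
def LiePoisson (I : Set ℝ) (Pi : ℝ → OneForm n Q) (X : ℝ → FormalField n Q) : Prop :=
  EvolvesBy I (hamFields n Q) Pi fun t Y => -coad (X t) (Pi t) Y

/-- The matched Lie-Poisson equations on `(𝔰ᶜ)* ⊕ (𝔫ᶜ)*`, with `ξ = ∂H/∂Π^𝔰`, `η = ∂H/∂Π^𝔫`:
`dΠ^𝔰/dt = -ad*_ξ Π^𝔰 + Π^𝔰 ◁* η + 𝔞*_η Π^𝔫`,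
`dΠ^𝔫/dt = -ad*_η Π^𝔫 - ξ ▷* Π^𝔫 - 𝔟*_ξ Π^𝔰`. -/
def MatchedLiePoisson (I : Set ℝ) (P : ℝ → ℕ → OneForm n Q) (X : ℝ → FormalField n Q) : Prop :=
  EvolvesBy I (sFields n Q) (fun t => sForm (P t)) (fun t Y =>
    -coad (sPart (X t)) (sForm (P t)) Y + dualRightAction (sForm (P t)) (nPart (X t)) Y
      + crossA (nPart (X t)) (nForm (P t)) Y) ∧
  EvolvesBy I (nFields n Q) (fun t => nForm (P t)) (fun t Y =>
    -coad (nPart (X t)) (nForm (P t)) Y - dualLeftAction (sPart (X t)) (nForm (P t)) Y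
      - crossB (sPart (X t)) (sForm (P t)) Y)

/-- The matched Lie-Poisson equations in terms of `J_LP`, with `X^k = ∂H/∂Π^{(k)}`,
`X^𝔰 = ∂H/∂Π^𝔰`, `X^𝔫 = ∂H/∂Π^𝔫`:
`dΠ^𝔰/dt = -J(Π^{(0)})(X^𝔰) - J(Π^{(1)})(X^1) - J(Π^𝔰)(X^𝔫)
  - ∑_{k ≥ 2} J(Π^{(k)})(X^k) - ∑_{k ≥ 2} J(Π^{(k)})(X^{k+1})`,
`dΠ^𝔫/dt = -∑_{k, m ≥ 2} J(Π^{(m+k-1)})(X^k) - J(Π^𝔫)(X^𝔰) - J(Π^{(1)})(X^0)`. -/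
def MatchedJLP (I : Set ℝ) (P : ℝ → ℕ → OneForm n Q) (X : ℝ → FormalField n Q) : Prop :=
  EvolvesBy I (hamFields n Q) (fun t => sForm (P t)) (fun t Y =>
    -JLPdual (P t 0) (sPart (X t)) Y - JLPdual (P t 1) (degPart 1 (X t)) Y
      - JLPdual (sForm (P t)) (nPart (X t)) Y
      - (∑ᶠ (k : ℕ) (_ : 2 ≤ k), JLPdual (P t k) (degPart k (X t)) Y)
      - ∑ᶠ (k : ℕ) (_ : 2 ≤ k), JLPdual (P t k) (degPart (k + 1) (X t)) Y) ∧
  EvolvesBy I (hamFields n Q) (fun t => nForm (P t)) (fun t Y =>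
    -(∑ᶠ (m : ℕ) (_ : 2 ≤ m) (k : ℕ) (_ : 2 ≤ k),
        JLPdual (P t (m + k - 1)) (degPart k (X t)) Y)
      - JLPdual (nForm (P t)) (sPart (X t)) Y - JLPdual (P t 1) (degPart 0 (X t)) Y)

/-- The formal series with the single term `X` in degree `k`. -/
def ofDegree (k : ℕ) (X : VField n Q) : FormalField n Q := fun j => if j = k then X else 0

end

end MomentumVlasov

end

open MomentumVlasov

/-!
The proof reduces the equations of motion to bookkeeping with degrees. Two identities connect the
geometry to the degrees.

* For a function `h` on `T*Q`, `Π(X_h) = h div(Π^♯) - div((hΠ)^♯)` (`divSharp_smulForm`). The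
  symplectic volume is the Lebesgue measure `dq dp` in every Darboux chart, since the transition
  maps are symplectic (`symplecticVolume_restrict`), so the divergence theorem `integral_divSharp`
  removes the last term. If `h` is homogeneous of degree `k` in the momenta, what remains is, fibre
  by fibre, a combination of `k`-th moments. Hence a form whose `k`-th moment vanishes annihilates
  all Hamiltonian fields of degree `k` (`fieldPairing_eq_zero`).
* `J_LP(Π)(X)` is minus the Lie derivative of `Π` along `X`, as Hamiltonian fields are divergence
  free. By the Leibniz rule and the divergence theorem once more, its pairing with `Y` is the
  pairing of `Π` with the Jacobi-Lie bracket of `X` and `Y` (`fieldPairing_JLP`).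

For fields of degrees `k` and `j` this bracket is the Hamiltonian field of the Poisson bracket of
the Hamiltonians, so it has degree `k + j - 1`, and it vanishes for `k = j = 0` (`mlieBracket_mem`,
`mlieBracket_eq_zero`). Every right-hand side is therefore a finite double sum over pairs of degrees
`(k, j)` of the numbers `⟨Π, [X^k, Y^j]⟩`, each part of `Π`, `X` or `Y` amounting to a restriction
of `k + j - 1`, `k` or `j` (`JLPdual_eq_sum`). The Lie-Poisson equation splits into its values on
`𝔰ᶜ` and on `𝔫ᶜ` (`liePoisson_iff`), and each of the other systems has the same double sums on its
right-hand sides.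

For the decomposition of `Π` into moments: pulling `Π` back by the fibre dilation `p ↦ c p`
multiplies the moment of order `k` by `c ^ (-k)`, up to a factor independent of `k`. A Vandermonde
matrix in finitely many ratios `c` is invertible, so some linear combination of these pullbacks has
the `k`-th moment of `Π` and no other moment (`exists_moment_components`). Uniqueness follows from
the annihilation property above.
-/

open MomentumVlasov

noncomputable section

open Filter Topology Set

variable {n : ℕ}

-- Shortcuts for the instances on phase space: the searches for them are otherwise repeated many
-- times and slow.
local instance : SeminormedAddCommGroup (Base n →L[ℝ] ℝ) := inferInstance
local instance : AddCommGroup (Base n →L[ℝ] ℝ) := inferInstance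
local instance : NormedSpace ℝ (Phase n) := inferInstance
local instance : SeminormedAddCommGroup (Phase n) := inferInstance
local instance : AddCommGroup (Phase n) := inferInstance
local instance : Module ℝ (Phase n) := inferInstance
local instance : ContinuousSMul ℝ (Phase n) := inferInstance
local instance : ContinuousAdd (Phase n) := inferInstance
local instance : T2Space (Phase n) := inferInstance
local instance : SeminormedAddCommGroup (Phase n →L[ℝ] ℝ) := inferInstance
local instance : AddCommGroup (Phase n →L[ℝ] ℝ) := inferInstance
local instance : Module ℝ (Phase n →L[ℝ] ℝ) := inferInstance
local instance : ContinuousSMul ℝ (Phase n →L[ℝ] ℝ) := inferInstance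
local instance : ContinuousAdd (Phase n →L[ℝ] ℝ) := inferInstance

/-! ### Symplectic linear algebra on phase space -/

/-- The symplectic form `dq^ℓ ∧ dp_ℓ` on the space of Darboux coordinates. -/
def omega (u v : Phase n) : ℝ := v.2 u.1 - u.2 v.1

/-- The Poisson tensor: `poissonMap β` is the vector `w` with `omega w = β`. -/
def poissonMap (n : ℕ) : (Phase n →L[ℝ] ℝ) →L[ℝ] Phase n :=
  (∑ l : Fin n, (ContinuousLinearMap.apply ℝ ℝ ((0, dirP l) : Phase n)).smulRight
      ((dirQ l, 0) : Phase n))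
    - (ContinuousLinearMap.inr ℝ (Base n) (Base n →L[ℝ] ℝ)).comp
      ((ContinuousLinearMap.compL ℝ (Base n) (Phase n) ℝ).flip
        (ContinuousLinearMap.inl ℝ (Base n) (Base n →L[ℝ] ℝ)))

theorem base_eq_sum (a : Base n) : a = ∑ l : Fin n, a l • dirQ l := by
  ext i
  simp [Pi.single_apply]

theorem covector_eq_sum (p : Base n →L[ℝ] ℝ) : p = ∑ l : Fin n, p (dirQ l) • dirP l := by
  ext a
  conv_lhs => rw [base_eq_sum a]
  simp [map_sum, mul_comm]

theorem poissonMap_snd (β : Phase n →L[ℝ] ℝ) (a : Base n) :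
    (poissonMap n β).2 a = -β (a, 0) := by
  simp [poissonMap, Prod.snd_sum]

theorem poissonMap_fst (β : Phase n →L[ℝ] ℝ) :
    (poissonMap n β).1 = ∑ l : Fin n, β (0, dirP l) • dirQ l := by
  simp [poissonMap, Prod.fst_sum]

theorem poissonMap_fst_apply (β : Phase n →L[ℝ] ℝ) (i : Fin n) :
    (poissonMap n β).1 i = β (0, dirP i) := by
  rw [poissonMap_fst]
  simp [Pi.single_apply]

theorem omega_poissonMap (β : Phase n →L[ℝ] ℝ) (v : Phase n) : omega (poissonMap n β) v = β v := by
  have h1 : v.2 (poissonMap n β).1 = β (0, v.2) := by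
    conv_rhs => rw [covector_eq_sum v.2]
    have : ((0, ∑ l : Fin n, v.2 (dirQ l) • dirP l) : Phase n)
        = ∑ l : Fin n, v.2 (dirQ l) • ((0, dirP l) : Phase n) := by
      ext <;> simp [Prod.fst_sum, Prod.snd_sum]
    rw [this, poissonMap_fst, map_sum, map_sum]
    simp only [map_smul, smul_eq_mul, mul_comm]
  rw [omega, h1, poissonMap_snd, sub_neg_eq_add, ← map_add]
  simp

theorem omega_swap (u v : Phase n) : omega u v = -omega v u := by simp [omega]

theorem omega_left_injective {u u' : Phase n} (h : ∀ v, omega u v = omega u' v) : u = u' := by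
  have h2 : u.2 = u'.2 := by
    ext a
    have := h (a, 0)
    simpa [omega] using this
  have h1 : u.1 = u'.1 := by
    ext i
    have := h (0, dirP i)
    simpa [omega] using this
  exact Prod.ext h1 h2

theorem poissonMap_eq_iff (β : Phase n →L[ℝ] ℝ) (w : Phase n) :
    w = poissonMap n β ↔ ∀ v, omega w v = β v := by
  constructor
  · rintro rfl v
    exact omega_poissonMap β v
  · intro h
    exact omega_left_injective fun v => by rw [h, omega_poissonMap]

theorem phase_eq_sum (w : Phase n) :
    w = ∑ l : Fin n, (omega w (0, dirP l) • ((dirQ l, 0) : Phase n)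
      - omega w (dirQ l, 0) • ((0, dirP l) : Phase n)) := by
  refine Prod.ext ?_ ?_
  · conv_lhs => rw [base_eq_sum w.1]
    simp [omega, Prod.fst_sum]
  · conv_lhs => rw [covector_eq_sum w.2]
    simp only [omega, Prod.snd_sum, Prod.snd_sub, Prod.smul_snd]
    refine Finset.sum_congr rfl fun l _ => ?_
    simp

/-- `omega` as a bilinear form. -/
def omegaForm (n : ℕ) : LinearMap.BilinForm ℝ (Phase n) :=
  LinearMap.mk₂ ℝ omega (by intros; simp [omega]; ring) (by intros; simp [omega]; ring)
    (by intros; simp [omega]; ring) (by intros; simp [omega]; ring)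

/-- Linear symplectic maps have determinant `±1`: take determinants in `Lᵀ Ω L = Ω`. -/
theorem abs_det_of_omega_preserving (L : Phase n →L[ℝ] Phase n)
    (hL : ∀ u v, omega (L u) (L v) = omega u v) : |L.det| = 1 := by
  classical
  let b := Module.finBasis ℝ (Phase n)
  have hnd : (omegaForm n).Nondegenerate := by
    have hs : (omegaForm n).SeparatingLeft := by
      intro u hu
      exact omega_left_injective fun v => by
        have := hu v
        simpa [omegaForm, omega] using this
    refine ⟨hs, fun u hu => hs u fun v => ?_⟩
    have := hu v
    simp only [omegaForm, LinearMap.mk₂_apply] at this ⊢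
    rw [omega_swap, this, neg_zero]
  have hdet : (LinearMap.BilinForm.toMatrix b (omegaForm n)).det ≠ 0 :=
    (LinearMap.BilinForm.nondegenerate_iff_det_ne_zero b).1 hnd
  have hcomp : (omegaForm n).comp (L : Phase n →ₗ[ℝ] Phase n) (L : Phase n →ₗ[ℝ] Phase n)
      = omegaForm n := by
    ext u v <;> simp [omegaForm, hL]
  have hm := LinearMap.BilinForm.toMatrix_comp b b (omegaForm n)
    (L : Phase n →ₗ[ℝ] Phase n) (L : Phase n →ₗ[ℝ] Phase n)
  rw [hcomp] at hm
  have hd := congrArg Matrix.det hm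
  rw [Matrix.det_mul, Matrix.det_mul, Matrix.det_transpose, LinearMap.det_toMatrix] at hd
  have h2 : L.det * L.det = 1 := by
    have : (L.det * L.det - 1) * (LinearMap.BilinForm.toMatrix b (omegaForm n)).det = 0 := by
      have : L.det = LinearMap.det (L : Phase n →ₗ[ℝ] Phase n) := rfl
      rw [this]
      linear_combination -hd
    rcases mul_eq_zero.1 this with h | h
    · linarith
    · exact absurd h hdet
  have h3 : |L.det| * |L.det| = 1 := by rw [← abs_mul, h2, abs_one]
  nlinarith [abs_nonneg L.det]

theorem trace_eq_of_forall_eq_sum {E : Type*} [AddCommGroup E] [Module ℝ E] [Module.Finite ℝ E]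
    {ι : Type*} [Fintype ι] (S : E →ₗ[ℝ] E) (e f : ι → E) (a b : ι → E →ₗ[ℝ] ℝ)
    (h : ∀ w, S w = ∑ l, (a l w • e l - b l w • f l)) :
    LinearMap.trace ℝ E S = ∑ l, (a l (e l) - b l (f l)) := by
  have : S = ∑ l, ((a l).smulRight (e l) - (b l).smulRight (f l)) :=
    LinearMap.ext fun w => by simp [h]
  rw [this, map_sum]
  exact Finset.sum_congr rfl fun l _ => by
    rw [map_sub, LinearMap.trace_smulRight, LinearMap.trace_smulRight]

/-- The contraction of an alternating form with the Poisson tensor does not depend on the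
Darboux frame: it is half the trace of the endomorphism that represents the form by means of
`omega`. -/
theorem sum_darboux_frame_eq (β : Phase n →L[ℝ] Phase n →L[ℝ] ℝ) (hβ : ∀ u v, β u v = -β v u)
    (L M : Phase n →L[ℝ] Phase n) (hL : ∀ u v, omega (L u) (L v) = omega u v)
    (hLM : ∀ u, L (M u) = u) :
    ∑ l : Fin n, β (L (dirQ l, 0)) (L (0, dirP l)) = ∑ l : Fin n, β (dirQ l, 0) (0, dirP l) := by
  have key : ∀ (γ : Phase n →L[ℝ] Phase n →L[ℝ] ℝ), (∀ u v, γ u v = -γ v u) →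
      LinearMap.trace ℝ (Phase n) ((poissonMap n).comp γ : Phase n →L[ℝ] Phase n)
        = 2 * ∑ l : Fin n, γ (dirQ l, 0) (0, dirP l) := by
    intro γ hγ
    rw [trace_eq_of_forall_eq_sum _ (fun l : Fin n => ((dirQ l, 0) : Phase n))
      (fun l : Fin n => ((0, dirP l) : Phase n))
      (fun l => ((γ.flip (0, dirP l) : Phase n →L[ℝ] ℝ) : Phase n →ₗ[ℝ] ℝ))
      (fun l => ((γ.flip (dirQ l, 0) : Phase n →L[ℝ] ℝ) : Phase n →ₗ[ℝ] ℝ)) fun w => ?_]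
    · rw [Finset.mul_sum]
      refine Finset.sum_congr rfl fun l _ => ?_
      change γ (dirQ l, 0) (0, dirP l) - γ (0, dirP l) (dirQ l, 0) = _
      rw [hγ (0, dirP l)]
      ring
    · have := phase_eq_sum (poissonMap n (γ w))
      simp only [omega_poissonMap] at this
      exact this
  let γ : Phase n →L[ℝ] Phase n →L[ℝ] ℝ := β.bilinearComp L L
  have hγ : ∀ u v, γ u v = β (L u) (L v) := fun u v => rfl
  have h1 := key β hβ
  have h2 := key γ fun u v => by rw [hγ, hγ, hβ]
  have hconj : (poissonMap n).comp γ = M.comp (((poissonMap n).comp β).comp L) := by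
    refine ContinuousLinearMap.ext fun u => ?_
    symm
    change M (poissonMap n (β (L u))) = poissonMap n (γ u)
    rw [poissonMap_eq_iff]
    intro v
    rw [hγ, ← hL, hLM, omega_poissonMap]
  have h3 : LinearMap.trace ℝ (Phase n) ((poissonMap n).comp γ : Phase n →L[ℝ] Phase n)
      = LinearMap.trace ℝ (Phase n) ((poissonMap n).comp β : Phase n →L[ℝ] Phase n) := by
    rw [hconj]
    change LinearMap.trace ℝ (Phase n)
      ((M : Phase n →ₗ[ℝ] Phase n) ∘ₗ ((((poissonMap n).comp β : Phase n →L[ℝ] Phase n) :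
        Phase n →ₗ[ℝ] Phase n) ∘ₗ (L : Phase n →ₗ[ℝ] Phase n))) = _
    rw [LinearMap.trace_comp_comm', LinearMap.comp_assoc]
    have : (L : Phase n →ₗ[ℝ] Phase n) ∘ₗ (M : Phase n →ₗ[ℝ] Phase n) = LinearMap.id :=
      LinearMap.ext hLM
    rw [this, LinearMap.comp_id]
  rw [h1, h2] at h3
  simp only [hγ] at h3
  linarith

/-! ### Exterior derivatives in coordinates -/

/-- The divergence `∂Π^ℓ/∂q^ℓ - ∂Π_ℓ/∂p_ℓ` of `Π^♯` in Darboux coordinates. -/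
def divLocal (α : Phase n → Phase n →L[ℝ] ℝ) (y : Phase n) : ℝ :=
  ∑ l : Fin n, (fderiv ℝ α y (dirQ l, 0) (0, dirP l) - fderiv ℝ α y (0, dirP l) (dirQ l, 0))

theorem two_le_smooth : (2 : WithTop ℕ∞) ≤ ∞ := ENat.LEInfty.out

/-- The exterior derivative commutes with pullback. -/
theorem exteriorDeriv_pullback {E F : Type*} [NormedAddCommGroup E] [NormedSpace ℝ E]
    [NormedAddCommGroup F] [NormedSpace ℝ F] {α : E → E →L[ℝ] ℝ} {β : F → F →L[ℝ] ℝ} {φ : E → F}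
    {y : E} (hφ : ContDiffAt ℝ ∞ φ y) (hβ : DifferentiableAt ℝ β (φ y))
    (h : ∀ᶠ z in 𝓝 y, α z = (β (φ z)).comp (fderiv ℝ φ z)) (u v : E) :
    fderiv ℝ α y u v - fderiv ℝ α y v u
      = fderiv ℝ β (φ y) (fderiv ℝ φ y u) (fderiv ℝ φ y v)
        - fderiv ℝ β (φ y) (fderiv ℝ φ y v) (fderiv ℝ φ y u) := by
  have hφ1 : HasFDerivAt φ (fderiv ℝ φ y) y := (hφ.differentiableAt (by simp)).hasFDerivAt
  have hφ2 : HasFDerivAt (fderiv ℝ φ) (fderiv ℝ (fderiv ℝ φ) y) y :=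
    ((hφ.fderiv_right (m := 1) two_le_smooth).differentiableAt (by simp)).hasFDerivAt
  have hsymm : IsSymmSndFDerivAt ℝ φ y := hφ.isSymmSndFDerivAt (by simpa using two_le_smooth)
  have hα := ((hβ.hasFDerivAt.comp y hφ1).clm_comp hφ2).congr_of_eventuallyEq h
  rw [hα.fderiv]
  simp only [Function.comp_apply, _root_.add_apply, ContinuousLinearMap.comp_apply,
    ContinuousLinearMap.compL_apply, ContinuousLinearMap.flip_apply]
  rw [hsymm.eq v u]
  ring

/-- A map that preserves the canonical 1-form `p_ℓ dq^ℓ` is symplectic. -/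
theorem omega_fderiv_of_canonicalForm {φ : Phase n → Phase n} {y : Phase n}
    (hφ : ContDiffAt ℝ ∞ φ y)
    (h : ∀ᶠ z in 𝓝 y, ∀ w : Phase n, (φ z).2 (fderiv ℝ φ z w).1 = z.2 w.1) (u v : Phase n) :
    omega (fderiv ℝ φ y u) (fderiv ℝ φ y v) = omega u v := by
  let θ : Phase n →L[ℝ] (Phase n →L[ℝ] ℝ) :=
    ((ContinuousLinearMap.compL ℝ (Phase n) (Base n) ℝ).flip
      (ContinuousLinearMap.fst ℝ (Base n) (Base n →L[ℝ] ℝ))).comp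
        (ContinuousLinearMap.snd ℝ (Base n) (Base n →L[ℝ] ℝ))
  have hθ : ∀ z w, θ z w = z.2 w.1 := fun z w => rfl
  have := exteriorDeriv_pullback (α := θ) (β := θ) hφ θ.differentiableAt
    (h.mono fun z hz => by
      refine ContinuousLinearMap.ext fun w => ?_
      exact (hz w).symm) u v
  simp only [ContinuousLinearMap.fderiv, hθ] at this
  simp only [omega]
  linarith

/-- `div(Π^♯)` is invariant under symplectic changes of coordinates, because it is the contraction
of `dΠ` with the Poisson tensor. -/
theorem divLocal_pullback {α β : Phase n → Phase n →L[ℝ] ℝ} {φ : Phase n → Phase n} {y : Phase n}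
    (hφ : ContDiffAt ℝ ∞ φ y) (hβ : DifferentiableAt ℝ β (φ y))
    (h : ∀ᶠ z in 𝓝 y, α z = (β (φ z)).comp (fderiv ℝ φ z))
    (hω : ∀ u v, omega (fderiv ℝ φ y u) (fderiv ℝ φ y v) = omega u v)
    (M : Phase n →L[ℝ] Phase n) (hLM : ∀ u, fderiv ℝ φ y (M u) = u) :
    divLocal α y = divLocal β (φ y) := by
  simp only [divLocal, exteriorDeriv_pullback hφ hβ h]
  exact sum_darboux_frame_eq (fderiv ℝ β (φ y) - (fderiv ℝ β (φ y)).flip)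
    (fun u v => by simp) _ M hω hLM

/-- The Jacobi-Lie bracket of the Hamiltonian fields of `f` and `g` is the Hamiltonian field of
`dg(X_f)`. -/
theorem lieBracket_poissonMap {f g : Phase n → ℝ} {y : Phase n} (hf : ContDiffAt ℝ ∞ f y)
    (hg : ContDiffAt ℝ ∞ g y) :
    VectorField.lieBracket ℝ (fun z => poissonMap n (fderiv ℝ f z))
        (fun z => poissonMap n (fderiv ℝ g z)) y
      = poissonMap n (fderiv ℝ (fun z => fderiv ℝ g z (poissonMap n (fderiv ℝ f z))) y) := by
  have d2 : ∀ {k : Phase n → ℝ}, ContDiffAt ℝ ∞ k y →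
      HasFDerivAt (fderiv ℝ k) (fderiv ℝ (fderiv ℝ k) y) y := fun hk =>
    ((hk.fderiv_right (m := 1) two_le_smooth).differentiableAt (by simp)).hasFDerivAt
  have dJ : ∀ {k : Phase n → ℝ}, ContDiffAt ℝ ∞ k y →
      HasFDerivAt (fun z => poissonMap n (fderiv ℝ k z))
        ((poissonMap n).comp (fderiv ℝ (fderiv ℝ k) y)) y := fun hk =>
    (poissonMap n).hasFDerivAt.comp y (d2 hk)
  have sf : IsSymmSndFDerivAt ℝ f y := hf.isSymmSndFDerivAt (by simpa using two_le_smooth)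
  have sg : IsSymmSndFDerivAt ℝ g y := hg.isSymmSndFDerivAt (by simpa using two_le_smooth)
  rw [VectorField.lieBracket, (dJ hf).fderiv, (dJ hg).fderiv, ((d2 hg).clm_apply (dJ hf)).fderiv,
    poissonMap_eq_iff]
  intro v
  simp only [ContinuousLinearMap.comp_apply, _root_.add_apply,
    ContinuousLinearMap.flip_apply, ← map_sub, omega_poissonMap, _root_.sub_apply]
  have e : ∀ β γ : Phase n →L[ℝ] ℝ, β (poissonMap n γ) = -γ (poissonMap n β) := fun β γ => by
    rw [← omega_poissonMap β, ← omega_poissonMap γ, omega_swap]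
  rw [e (fderiv ℝ g y), sf.eq _ v, sg.eq _ v]
  ring

/-! ### Darboux charts and their transition maps -/

section Charts

variable {n : ℕ} {Q : Type*} [TopologicalSpace Q] [ChartedSpace (Base n) Q]
  [IsManifold (𝓡 n) ∞ Q]

theorem darboux_eq (a : Q) : darboux (n := n) a =
    (trivializationAt (Base n →L[ℝ] ℝ)
      (fun q : Q => TangentSpace (𝓡 n) q →L[ℝ] Bundle.Trivial Q ℝ q) a).toPartialEquiv ≫
        (extChartAt (𝓡 n) a).prod (PartialEquiv.refl (Base n →L[ℝ] ℝ)) :=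
  FiberBundle.extChartAt (⟨a, 0⟩ : Cotangent n Q)

theorem mem_darboux_source {a : Q} {x : Cotangent n Q} :
    x ∈ (darboux (n := n) a).source ↔ x.proj ∈ (chartAt (Base n) a).source := by
  rw [darboux, extChartAt_source, FiberBundle.chartedSpace_chartAt]
  simp only [mfld_simps, mem_preimage]
  constructor
  · rintro ⟨h, -⟩
    simpa using h
  · intro h
    refine ⟨by simpa using h, ?_⟩
    rw [Bundle.Trivialization.coe_fst]
    · exact h
    · simpa [Bundle.Trivialization.mem_source] using h

theorem darboux_target (a : Q) : (darboux (n := n) a).target =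
    (extChartAt (𝓡 n) a).target ×ˢ univ := by
  rw [darboux, FiberBundle.extChartAt_target]
  congr 1
  rw [inter_eq_left]
  intro y hy
  have := (extChartAt (𝓡 n) a).map_target hy
  rw [extChartAt_source] at this
  simpa using this

theorem isOpen_darboux_target (a : Q) : IsOpen (darboux (n := n) a).target :=
  isOpen_extChartAt_target _

theorem isOpen_darboux_source (a : Q) : IsOpen (darboux (n := n) a).source :=
  isOpen_extChartAt_source _

theorem darboux_apply_fst (a : Q) (x : Cotangent n Q) :
    (darboux (n := n) a x).1 = extChartAt (𝓡 n) a x.proj := by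
  rw [darboux_eq]
  rfl

theorem darboux_apply_snd {a : Q} {x : Cotangent n Q}
    (hx : x.proj ∈ (chartAt (Base n) a).source) (v : Base n) :
    (darboux (n := n) a x).2 v
      = (x.2 : Base n →L[ℝ] ℝ) (tangentCoordChange (𝓡 n) a x.proj x.proj v) := by
  rw [darboux_eq, tangentCoordChange, ← TangentBundle.symmL_trivializationAt_eq_core hx]
  change (trivializationAt (Base n →L[ℝ] ℝ)
    (fun q : Q => TangentSpace (𝓡 n) q →L[ℝ] Bundle.Trivial Q ℝ q) a x).2 v = _
  rw [hom_trivializationAt_apply]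
  simp [ContinuousLinearMap.inCoordinates]
  rfl

theorem darboux_symm_proj {a : Q} {y : Phase n} (hy : y ∈ (darboux (n := n) a).target) :
    ((darboux (n := n) a).symm y).proj = (extChartAt (𝓡 n) a).symm y.1 := by
  have h1 := (darboux (n := n) a).map_target hy
  rw [mem_darboux_source] at h1
  have h2 := darboux_apply_fst a ((darboux (n := n) a).symm y)
  rw [(darboux (n := n) a).right_inv hy] at h2
  rw [h2, (extChartAt (𝓡 n) a).left_inv (by rwa [extChartAt_source])]

theorem darboux_symm_proj_mem {a : Q} {y : Phase n} (hy : y ∈ (darboux (n := n) a).target) :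
    ((darboux (n := n) a).symm y).proj ∈ (chartAt (Base n) a).source :=
  mem_darboux_source.1 ((darboux (n := n) a).map_target hy)

/-- The derivative of a Darboux chart, in the frame of the preferred chart. -/
def chartDeriv (a : Q) (x : Cotangent n Q) : Phase n →L[ℝ] Phase n :=
  mfderiv (phaseModel n) 𝓘(ℝ, Phase n) (darboux (n := n) a) x

/-- The derivative of the inverse of a Darboux chart, in the frame of the preferred chart. -/
def chartDerivSymm (a : Q) (y : Phase n) : Phase n →L[ℝ] Phase n :=
  mfderiv 𝓘(ℝ, Phase n) (phaseModel n) (darboux (n := n) a).symm y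

theorem mfderivWithin_darboux_symm (a : Q) (y : Phase n) :
    mfderivWithin 𝓘(ℝ, Phase n) (phaseModel n) (darboux (n := n) a).symm
      (range (phaseModel n)) y = chartDerivSymm a y := by
  rw [(phaseModel n).range_eq_univ, mfderivWithin_univ]
  rfl

theorem chartDeriv_chartDerivSymm {a : Q} {y : Phase n} (hy : y ∈ (darboux (n := n) a).target)
    (v : Phase n) : chartDeriv a ((darboux (n := n) a).symm y) (chartDerivSymm a y v) = v := by
  have := mfderiv_extChartAt_comp_mfderivWithin_extChartAt_symm (I := phaseModel n)
    (x := (⟨a, 0⟩ : Cotangent n Q)) hy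
  have h2 := congrArg (fun L : Phase n →L[ℝ] Phase n => L v) this
  have h3 := mfderivWithin_darboux_symm (Q := Q) a y
  rw [← h3]
  exact h2

theorem chartDerivSymm_chartDeriv {a : Q} {y : Phase n} (hy : y ∈ (darboux (n := n) a).target)
    (v : Phase n) : chartDerivSymm a y (chartDeriv a ((darboux (n := n) a).symm y) v) = v := by
  have := mfderivWithin_extChartAt_symm_comp_mfderiv_extChartAt (I := phaseModel n)
    (x := (⟨a, 0⟩ : Cotangent n Q)) hy
  have h2 := congrArg (fun L : Phase n →L[ℝ] Phase n => L v) this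
  have h3 := mfderivWithin_darboux_symm (Q := Q) a y
  rw [← h3]
  exact h2

theorem chartDeriv_self (x : Cotangent n Q) : chartDeriv x.proj x = ContinuousLinearMap.id ℝ _ :=
  mfderiv_extChartAt_self (I := phaseModel n) (x := x)

theorem chartDerivSymm_self (x : Cotangent n Q) :
    chartDerivSymm x.proj (darboux (n := n) x.proj x) = ContinuousLinearMap.id ℝ _ := by
  refine ContinuousLinearMap.ext fun v => ?_
  have hx : x ∈ (darboux (n := n) x.proj).source := mem_darboux_source.2 (mem_chart_source _ _)
  have h := chartDerivSymm_chartDeriv ((darboux (n := n) x.proj).map_source hx) v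
  rw [(darboux (n := n) x.proj).left_inv hx, chartDeriv_self] at h
  exact h

theorem contMDiffOn_darboux (a : Q) : ContMDiffOn (phaseModel n) 𝓘(ℝ, Phase n) ∞
    (darboux (n := n) a) (darboux (n := n) a).source := by
  rw [darboux, extChartAt_source]
  exact contMDiffOn_extChartAt

theorem contMDiffOn_darboux_symm (a : Q) : ContMDiffOn 𝓘(ℝ, Phase n) (phaseModel n) ∞
    (darboux (n := n) a).symm (darboux (n := n) a).target :=
  contMDiffOn_extChartAt_symm _

theorem contMDiffAt_darboux {a : Q} {x : Cotangent n Q} (hx : x ∈ (darboux (n := n) a).source) :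
    ContMDiffAt (phaseModel n) 𝓘(ℝ, Phase n) ∞ (darboux (n := n) a) x :=
  (contMDiffOn_darboux a).contMDiffAt ((isOpen_darboux_source a).mem_nhds hx)

theorem contMDiffAt_darboux_symm {a : Q} {y : Phase n} (hy : y ∈ (darboux (n := n) a).target) :
    ContMDiffAt 𝓘(ℝ, Phase n) (phaseModel n) ∞ (darboux (n := n) a).symm y :=
  (contMDiffOn_darboux_symm a).contMDiffAt ((isOpen_darboux_target a).mem_nhds hy)

/-- The transition map between two Darboux charts. -/
def transition (a b : Q) (y : Phase n) : Phase n := darboux b ((darboux (n := n) a).symm y)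

variable (n) in
/-- The domain of the transition map between two Darboux charts. -/
def transitionDomain (a b : Q) : Set (Phase n) :=
  (darboux (n := n) a).target ∩ (darboux (n := n) a).symm ⁻¹' (darboux (n := n) b).source

theorem isOpen_transitionDomain (a b : Q) : IsOpen (transitionDomain n a b) :=
  (contMDiffOn_darboux_symm a).continuousOn.isOpen_inter_preimage (isOpen_darboux_target a)
    (isOpen_darboux_source b)

theorem contDiffAt_transition {a b : Q} {y : Phase n} (hy : y ∈ transitionDomain n a b) :
    ContDiffAt ℝ ∞ (transition a b) y := by
  rw [← contMDiffAt_iff_contDiffAt]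
  exact (contMDiffAt_darboux hy.2).comp y (contMDiffAt_darboux_symm hy.1)

theorem fderiv_transition {a b : Q} {y : Phase n} (hy : y ∈ transitionDomain n a b) :
    fderiv ℝ (transition a b) y
      = (chartDeriv b ((darboux (n := n) a).symm y)).comp (chartDerivSymm a y) := by
  rw [← mfderiv_eq_fderiv]
  exact mfderiv_comp y ((contMDiffAt_darboux hy.2).mdifferentiableAt (by simp))
    ((contMDiffAt_darboux_symm hy.1).mdifferentiableAt (by simp))

theorem darboux_symm_transition {a b : Q} {y : Phase n} (hy : y ∈ transitionDomain n a b) :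
    (darboux (n := n) b).symm (transition a b y) = (darboux (n := n) a).symm y :=
  (darboux (n := n) b).left_inv hy.2

theorem transition_mem_target {a b : Q} {y : Phase n} (hy : y ∈ transitionDomain n a b) :
    transition a b y ∈ (darboux (n := n) b).target :=
  (darboux (n := n) b).map_source hy.2

/-- The canonical 1-form `p_ℓ dq^ℓ` is preserved by the transition maps. -/
theorem canonicalForm_transition {a b : Q} {y : Phase n} (hy : y ∈ transitionDomain n a b)
    (w : Phase n) :
    (transition a b y).2 (fderiv ℝ (transition a b) y w).1 = y.2 w.1 := by
  set x := (darboux (n := n) a).symm y with hxdef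
  have hxa : x.proj ∈ (chartAt (Base n) a).source := darboux_symm_proj_mem hy.1
  have hxb : x.proj ∈ (chartAt (Base n) b).source := mem_darboux_source.1 hy.2
  have hy1 : y.1 = extChartAt (𝓡 n) a x.proj := by
    rw [← darboux_apply_fst, (darboux (n := n) a).right_inv hy.1]
  have hτ : HasFDerivAt (extChartAt (𝓡 n) b ∘ (extChartAt (𝓡 n) a).symm)
      (tangentCoordChange (𝓡 n) a b x.proj) y.1 := by
    have := hasFDerivWithinAt_tangentCoordChange (I := 𝓡 n) (x := a) (y := b) (z := x.proj)
      ⟨by rwa [extChartAt_source], by rwa [extChartAt_source]⟩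
    rw [(𝓡 n).range_eq_univ, hasFDerivWithinAt_univ, ← hy1] at this
    exact this
  have hfst : (fderiv ℝ (transition a b) y w).1 = tangentCoordChange (𝓡 n) a b x.proj w.1 := by
    have h1 : HasFDerivAt (fun z => (transition a b z).1)
        ((ContinuousLinearMap.fst ℝ (Base n) (Base n →L[ℝ] ℝ)).comp
          (fderiv ℝ (transition a b) y)) y :=
      (ContinuousLinearMap.fst ℝ (Base n) (Base n →L[ℝ] ℝ)).hasFDerivAt.comp y
        ((contDiffAt_transition hy).differentiableAt (by simp)).hasFDerivAt
    have h2 : HasFDerivAt (fun z : Phase n => (extChartAt (𝓡 n) b ∘ (extChartAt (𝓡 n) a).symm) z.1)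
        ((tangentCoordChange (𝓡 n) a b x.proj : Base n →L[ℝ] Base n).comp
          (ContinuousLinearMap.fst ℝ (Base n) (Base n →L[ℝ] ℝ))) y :=
      HasFDerivAt.comp y hτ (ContinuousLinearMap.fst ℝ (Base n) (Base n →L[ℝ] ℝ)).hasFDerivAt
    have h3 : (fun z => (transition a b z).1) =ᶠ[𝓝 y]
        fun z : Phase n => (extChartAt (𝓡 n) b ∘ (extChartAt (𝓡 n) a).symm) z.1 := by
      filter_upwards [(isOpen_transitionDomain a b).mem_nhds hy] with z hz
      rw [transition, darboux_apply_fst, darboux_symm_proj hz.1]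
      rfl
    have h4 := h1.unique (h2.congr_of_eventuallyEq h3)
    exact congrArg (fun L : Phase n →L[ℝ] Base n => L w) h4
  have hya : y.2 w.1 = (darboux (n := n) a x).2 w.1 := by
    rw [hxdef, (darboux (n := n) a).right_inv hy.1]
  rw [hfst, hya, darboux_apply_snd hxa]
  change (darboux (n := n) b x).2 _ = _
  rw [darboux_apply_snd hxb, tangentCoordChange_comp]
  simp only [extChartAt_source]
  exact ⟨⟨hxa, hxb⟩, mem_chart_source _ _⟩

/-- The transition maps between Darboux charts are symplectic. -/
theorem omega_fderiv_transition {a b : Q} {y : Phase n} (hy : y ∈ transitionDomain n a b)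
    (u v : Phase n) :
    omega (fderiv ℝ (transition a b) y u) (fderiv ℝ (transition a b) y v) = omega u v := by
  refine omega_fderiv_of_canonicalForm (contDiffAt_transition hy) ?_ u v
  filter_upwards [(isOpen_transitionDomain a b).mem_nhds hy] with z hz
  exact canonicalForm_transition hz

theorem mem_transitionDomain {a : Q} {x : Cotangent n Q} (hx : x ∈ (darboux (n := n) a).source)
    {b : Q} (hb : x ∈ (darboux (n := n) b).source) :
    darboux (n := n) a x ∈ transitionDomain n a b :=
  ⟨(darboux (n := n) a).map_source hx, by
    rw [mem_preimage, (darboux (n := n) a).left_inv hx]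
    exact hb⟩

theorem mem_darboux_proj_source (x : Cotangent n Q) : x ∈ (darboux (n := n) x.proj).source :=
  mem_darboux_source.2 (mem_chart_source _ _)

theorem fderiv_transition_self {a : Q} {x : Cotangent n Q}
    (hx : x ∈ (darboux (n := n) a).source) :
    fderiv ℝ (transition x.proj a) (darboux (n := n) x.proj x) = chartDeriv a x := by
  rw [fderiv_transition (mem_transitionDomain (mem_darboux_proj_source x) hx),
    chartDerivSymm_self, (darboux (n := n) x.proj).left_inv (mem_darboux_proj_source x)]
  exact ContinuousLinearMap.comp_id _

theorem omega_chartDeriv {a : Q} {x : Cotangent n Q} (hx : x ∈ (darboux (n := n) a).source)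
    (u v : Phase n) : omega (chartDeriv a x u) (chartDeriv a x v) = omega u v := by
  rw [← fderiv_transition_self hx]
  exact omega_fderiv_transition (mem_transitionDomain (mem_darboux_proj_source x) hx) u v

end Charts

/-! ### Functions, forms and fields in Darboux charts -/

-- Shortcuts for the operations on 1-forms and on vector fields; the search through the dependent
-- product of the cotangent or tangent spaces is slow.
local instance {n : ℕ} {Q : Type*} [TopologicalSpace Q] [ChartedSpace (Base n) Q]
    [IsManifold (𝓡 n) ∞ Q] : Add (OneForm n Q) := inferInstance
local instance {n : ℕ} {Q : Type*} [TopologicalSpace Q] [ChartedSpace (Base n) Q]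
    [IsManifold (𝓡 n) ∞ Q] : SMul ℝ (OneForm n Q) := inferInstance
local instance {n : ℕ} {Q : Type*} [TopologicalSpace Q] [ChartedSpace (Base n) Q]
    [IsManifold (𝓡 n) ∞ Q] : Zero (OneForm n Q) := inferInstance
local instance {n : ℕ} {Q : Type*} [TopologicalSpace Q] [ChartedSpace (Base n) Q]
    [IsManifold (𝓡 n) ∞ Q] : Add (VField n Q) := inferInstance
local instance {n : ℕ} {Q : Type*} [TopologicalSpace Q] [ChartedSpace (Base n) Q]
    [IsManifold (𝓡 n) ∞ Q] : Neg (VField n Q) := inferInstance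
local instance {n : ℕ} {Q : Type*} [TopologicalSpace Q] [ChartedSpace (Base n) Q]
    [IsManifold (𝓡 n) ∞ Q] : Zero (VField n Q) := inferInstance

section Local

variable {n : ℕ} {Q : Type*} [TopologicalSpace Q] [ChartedSpace (Base n) Q]
  [IsManifold (𝓡 n) ∞ Q]

/-- The value of a vector field, as a vector of the model space of the preferred chart. -/
def vecAt (X : VField n Q) (x : Cotangent n Q) : Phase n := X x

/-- The value of a 1-form, as a covector of the model space of the preferred chart. -/
def covAt (Pi : OneForm n Q) (x : Cotangent n Q) : Phase n →L[ℝ] ℝ := Pi x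

/-- The differential of a function, as a covector of the model space of the preferred chart. -/
def diffAt (h : Cotangent n Q → ℝ) (x : Cotangent n Q) : Phase n →L[ℝ] ℝ :=
  mfderiv (phaseModel n) 𝓘(ℝ, ℝ) h x

theorem isHamiltonianField_iff {h : Cotangent n Q → ℝ} {X : VField n Q} :
    IsHamiltonianField h X ↔ ∀ (x : Cotangent n Q) (v : Phase n),
      omega (vecAt X x) v = diffAt h x v := Iff.rfl

/-- A function read in the Darboux chart over `a`. -/
def localFun (a : Q) (h : Cotangent n Q → ℝ) (y : Phase n) : ℝ := h ((darboux (n := n) a).symm y)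

theorem localForm_apply (a : Q) (Pi : OneForm n Q) (y v : Phase n) :
    localForm a Pi y v
      = covAt Pi ((darboux (n := n) a).symm y) (chartDerivSymm a y v) := rfl

theorem localField_apply (a : Q) (X : VField n Q) (y : Phase n) :
    localField a X y = chartDeriv a ((darboux (n := n) a).symm y)
      (vecAt X ((darboux (n := n) a).symm y)) := rfl

theorem localForm_localField {a : Q} {y : Phase n} (hy : y ∈ (darboux (n := n) a).target)
    (Pi : OneForm n Q) (X : VField n Q) :
    localForm a Pi y (localField a X y)
      = covAt Pi ((darboux (n := n) a).symm y) (vecAt X ((darboux (n := n) a).symm y)) := by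
  rw [localForm_apply, localField_apply, chartDerivSymm_chartDeriv hy]

/-- The change of the coordinate expression of a 1-form between Darboux charts. -/
theorem localForm_transition {a b : Q} {y : Phase n} (hy : y ∈ transitionDomain n a b)
    (Pi : OneForm n Q) :
    localForm a Pi y
      = (localForm b Pi (transition a b y)).comp (fderiv ℝ (transition a b) y) := by
  refine ContinuousLinearMap.ext fun v => ?_
  have e1 : localForm b Pi (transition a b y) (fderiv ℝ (transition a b) y v)
      = covAt Pi ((darboux (n := n) b).symm (transition a b y))
        (chartDerivSymm b (transition a b y) (fderiv ℝ (transition a b) y v)) := rfl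
  have e2 := chartDerivSymm_chartDeriv (transition_mem_target hy) (chartDerivSymm a y v)
  rw [darboux_symm_transition hy] at e1 e2
  rw [ContinuousLinearMap.comp_apply, e1, fderiv_transition hy, ContinuousLinearMap.comp_apply, e2,
    localForm_apply]

theorem localFun_darboux {a : Q} {x : Cotangent n Q} (hx : x ∈ (darboux (n := n) a).source)
    (h : Cotangent n Q → ℝ) : localFun a h (darboux (n := n) a x) = h x := by
  rw [localFun, (darboux (n := n) a).left_inv hx]

theorem contDiffOn_localFun {h : Cotangent n Q → ℝ} (hh : ContMDiff (phaseModel n) 𝓘(ℝ, ℝ) ∞ h)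
    (a : Q) : ContDiffOn ℝ ∞ (localFun a h) (darboux (n := n) a).target := by
  rw [← contMDiffOn_iff_contDiffOn]
  exact hh.comp_contMDiffOn (contMDiffOn_darboux_symm a)

theorem contDiffAt_localFun {h : Cotangent n Q → ℝ} (hh : ContMDiff (phaseModel n) 𝓘(ℝ, ℝ) ∞ h)
    {a : Q} {y : Phase n} (hy : y ∈ (darboux (n := n) a).target) :
    ContDiffAt ℝ ∞ (localFun a h) y :=
  (contDiffOn_localFun hh a).contDiffAt ((isOpen_darboux_target a).mem_nhds hy)

theorem eventuallyEq_localFun {a : Q} {x : Cotangent n Q} (hx : x ∈ (darboux (n := n) a).source)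
    (h : Cotangent n Q → ℝ) : h =ᶠ[𝓝 x] localFun a h ∘ darboux (n := n) a := by
  filter_upwards [(isOpen_darboux_source a).mem_nhds hx] with z hz
  exact (localFun_darboux hz h).symm

theorem contMDiff_of_localFun {h : Cotangent n Q → ℝ}
    (hh : ∀ a : Q, ContDiffOn ℝ ∞ (localFun a h) (darboux (n := n) a).target) :
    ContMDiff (phaseModel n) 𝓘(ℝ, ℝ) ∞ h := by
  intro x
  have hx := mem_darboux_proj_source x
  have h1 : ContDiffAt ℝ ∞ (localFun x.proj h) (darboux (n := n) x.proj x) :=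
    (hh x.proj).contDiffAt ((isOpen_darboux_target _).mem_nhds ((darboux _).map_source hx))
  exact (h1.contMDiffAt.comp x (contMDiffAt_darboux hx)).congr_of_eventuallyEq
    (eventuallyEq_localFun hx h)

theorem diffAt_eq {h : Cotangent n Q → ℝ}
    (hh : ContMDiff (phaseModel n) 𝓘(ℝ, ℝ) ∞ h) {a : Q} {x : Cotangent n Q}
    (hx : x ∈ (darboux (n := n) a).source) :
    diffAt h x
      = (fderiv ℝ (localFun a h) (darboux (n := n) a x)).comp (chartDeriv a x) := by
  have h1 := (contDiffAt_localFun hh ((darboux a).map_source hx)).contMDiffAt.mdifferentiableAt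
    (by simp)
  have h2 := mfderiv_comp x h1 ((contMDiffAt_darboux hx).mdifferentiableAt (by simp))
  rw [← (eventuallyEq_localFun hx h).mfderiv_eq] at h2
  rw [mfderiv_eq_fderiv] at h2
  exact h2

/-- In each Darboux chart, a Hamiltonian vector field is `∂h/∂p_i ∂/∂q^i - ∂h/∂q^i ∂/∂p_i`. -/
theorem localField_eq_poissonMap {h : Cotangent n Q → ℝ}
    (hh : ContMDiff (phaseModel n) 𝓘(ℝ, ℝ) ∞ h) {X : VField n Q} (hX : IsHamiltonianField h X)
    {a : Q} {y : Phase n} (hy : y ∈ (darboux (n := n) a).target) :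
    localField a X y = poissonMap n (fderiv ℝ (localFun a h) y) := by
  rw [poissonMap_eq_iff]
  intro v
  set x := (darboux (n := n) a).symm y with hxdef
  have hx : x ∈ (darboux (n := n) a).source := (darboux a).map_target hy
  have hyx : darboux (n := n) a x = y := (darboux a).right_inv hy
  have h1 := isHamiltonianField_iff.1 hX x (chartDerivSymm a y v)
  have h2 := congrArg (fun L : Phase n →L[ℝ] ℝ => L (chartDerivSymm a y v))
    (diffAt_eq hh hx)
  have h3 : chartDeriv a x (chartDerivSymm a y v) = v := chartDeriv_chartDerivSymm hy v
  simp only [ContinuousLinearMap.comp_apply] at h2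
  rw [h3, hyx] at h2
  rw [localField_apply, ← h2, ← hxdef]
  conv_lhs => rw [← h3]
  rw [omega_chartDeriv hx]
  exact h1

theorem isHamiltonianField_of_eq {h : Cotangent n Q → ℝ}
    (hh : ContMDiff (phaseModel n) 𝓘(ℝ, ℝ) ∞ h) {X : VField n Q}
    (hX : ∀ x : Cotangent n Q, vecAt X x
      = poissonMap n (fderiv ℝ (localFun x.proj h) (darboux (n := n) x.proj x))) :
    IsHamiltonianField h X := by
  refine isHamiltonianField_iff.2 fun x v => ?_
  have h2 := congrArg (fun L : Phase n →L[ℝ] ℝ => L v)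
    (diffAt_eq hh (mem_darboux_proj_source x))
  rw [chartDeriv_self] at h2
  rw [hX x, omega_poissonMap]
  exact h2.symm

theorem localField_self (X : VField n Q) (x : Cotangent n Q) :
    localField x.proj X (darboux (n := n) x.proj x) = vecAt X x := by
  rw [localField_apply, (darboux (n := n) x.proj).left_inv (mem_darboux_proj_source x),
    chartDeriv_self]
  rfl

theorem localForm_self (Pi : OneForm n Q) (x : Cotangent n Q) :
    localForm x.proj Pi (darboux (n := n) x.proj x) = covAt Pi x := by
  refine ContinuousLinearMap.ext fun v => ?_
  rw [localForm_apply, (darboux (n := n) x.proj).left_inv (mem_darboux_proj_source x),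
    chartDerivSymm_self]
  rfl

/-- Smoothness of a 1-form on `T*Q`. -/
def IsSmoothForm (Pi : OneForm n Q) : Prop :=
  ∀ a : Q, ContDiffOn ℝ ∞ (localForm a Pi) (darboux (n := n) a).target

theorem IsSmoothForm.contDiffAt {Pi : OneForm n Q} (h : IsSmoothForm Pi) {a : Q} {y : Phase n}
    (hy : y ∈ (darboux (n := n) a).target) : ContDiffAt ℝ ∞ (localForm a Pi) y :=
  (h a).contDiffAt ((isOpen_darboux_target a).mem_nhds hy)

theorem IsSmoothForm.differentiableAt {Pi : OneForm n Q} (h : IsSmoothForm Pi) {a : Q} {y : Phase n}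
    (hy : y ∈ (darboux (n := n) a).target) : DifferentiableAt ℝ (localForm a Pi) y :=
  (h.contDiffAt hy).differentiableAt (by simp)

theorem fderiv_apply_const {α : Phase n → Phase n →L[ℝ] ℝ} {y : Phase n}
    (hα : DifferentiableAt ℝ α y) (u v : Phase n) :
    fderiv ℝ (fun z => α z v) y u = fderiv ℝ α y u v := by
  have := (ContinuousLinearMap.apply ℝ ℝ v).hasFDerivAt.comp y hα.hasFDerivAt
  have h2 : fderiv ℝ (fun z => α z v) y = _ := this.fderiv
  rw [h2]
  rfl

/-- The divergence of `Π^♯` can be computed in every Darboux chart. -/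
theorem divSharp_eq {Pi : OneForm n Q} (h : IsSmoothForm Pi) {a : Q} {x : Cotangent n Q}
    (hx : x ∈ (darboux (n := n) a).source) :
    divSharp Pi x = divLocal (localForm a Pi) (darboux (n := n) a x) := by
  have hs := mem_darboux_proj_source x
  have ht := (darboux (n := n) x.proj).map_source hs
  have h1 : divSharp Pi x = divLocal (localForm x.proj Pi) (darboux (n := n) x.proj x) := by
    rw [divSharp, divLocal]
    refine Finset.sum_congr rfl fun l _ => ?_
    rw [← fderiv_apply_const (h.differentiableAt ht), ← fderiv_apply_const (h.differentiableAt ht)]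
    rfl
  have hd := mem_transitionDomain hs hx
  have hφ : transition x.proj a (darboux (n := n) x.proj x) = darboux a x := by
    rw [transition, (darboux (n := n) x.proj).left_inv hs]
  have hxt := (darboux (n := n) a).map_source hx
  rw [h1, divLocal_pullback (β := localForm a Pi) (contDiffAt_transition hd)
    (by rw [hφ]; exact h.differentiableAt hxt)
    (by
      filter_upwards [(isOpen_transitionDomain _ _).mem_nhds hd] with z hz
      exact localForm_transition hz Pi) (omega_fderiv_transition hd)
      (chartDerivSymm a (darboux (n := n) a x)) ?_, hφ]
  intro u
  have := chartDeriv_chartDerivSymm hxt u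
  rw [(darboux (n := n) a).left_inv hx] at this
  rw [fderiv_transition_self hx, this]

/-- The derivative of `g` along `X`. -/
def fieldDeriv (X : VField n Q) (g : Cotangent n Q → ℝ) (x : Cotangent n Q) : ℝ :=
  diffAt g x (vecAt X x)

theorem localFun_fieldDeriv {f g : Cotangent n Q → ℝ}
    (hf : ContMDiff (phaseModel n) 𝓘(ℝ, ℝ) ∞ f) (hg : ContMDiff (phaseModel n) 𝓘(ℝ, ℝ) ∞ g)
    {X : VField n Q} (hX : IsHamiltonianField f X) {a : Q} {y : Phase n}
    (hy : y ∈ (darboux (n := n) a).target) :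
    localFun a (fieldDeriv X g) y
      = fderiv ℝ (localFun a g) y (poissonMap n (fderiv ℝ (localFun a f) y)) := by
  rw [localFun, fieldDeriv, diffAt_eq hg ((darboux a).map_target hy),
    (darboux (n := n) a).right_inv hy, ContinuousLinearMap.comp_apply, ← localField_apply,
    localField_eq_poissonMap hf hX hy]

theorem contDiffOn_fderiv {E F : Type*} [NormedAddCommGroup E] [NormedSpace ℝ E]
    [NormedAddCommGroup F] [NormedSpace ℝ F] {f : E → F} {s : Set E} (hs : IsOpen s)
    (hf : ContDiffOn ℝ ∞ f s) : ContDiffOn ℝ ∞ (fderiv ℝ f) s :=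
  hf.fderiv_of_isOpen hs (by simp)

theorem contMDiff_fieldDeriv {f g : Cotangent n Q → ℝ}
    (hf : ContMDiff (phaseModel n) 𝓘(ℝ, ℝ) ∞ f) (hg : ContMDiff (phaseModel n) 𝓘(ℝ, ℝ) ∞ g)
    {X : VField n Q} (hX : IsHamiltonianField f X) :
    ContMDiff (phaseModel n) 𝓘(ℝ, ℝ) ∞ (fieldDeriv X g) := by
  refine contMDiff_of_localFun fun a => ?_
  refine ContDiffOn.congr ?_ fun y hy => localFun_fieldDeriv hf hg hX hy
  exact (contDiffOn_fderiv (isOpen_darboux_target a) (contDiffOn_localFun hg a)).clm_apply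
    ((poissonMap n).contDiff.comp_contDiffOn
      (contDiffOn_fderiv (isOpen_darboux_target a) (contDiffOn_localFun hf a)))

/-- The Jacobi-Lie bracket, computed in the Darboux chart over the base point. -/
theorem mlieBracket_eq (X Y : VField n Q) (x : Cotangent n Q) :
    vecAt (VectorField.mlieBracket (phaseModel n) X Y) x
      = VectorField.lieBracket ℝ (localField x.proj X) (localField x.proj Y)
          (darboux (n := n) x.proj x) := by
  have hinv : ∀ Z : VField n Q, ∀ y ∈ (darboux (n := n) x.proj).target,
      (VectorField.mpullbackWithin 𝓘(ℝ, Phase n) (phaseModel n) (darboux (n := n) x.proj).symm Z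
        (range (phaseModel n)) y : Phase n) = localField x.proj Z y := by
    intro Z y hy
    have h1 : (chartDerivSymm x.proj y).inverse
        = chartDeriv x.proj ((darboux (n := n) x.proj).symm y) :=
      ContinuousLinearMap.inverse_eq
        (ContinuousLinearMap.ext fun v => chartDerivSymm_chartDeriv hy v)
        (ContinuousLinearMap.ext fun v => chartDeriv_chartDerivSymm hy v)
    rw [localField_apply, ← h1, ← mfderivWithin_darboux_symm]
    rfl
  have hset : (darboux (n := n) x.proj).symm ⁻¹' univ ∩ range (phaseModel n) = univ := by
    rw [(phaseModel n).range_eq_univ, preimage_univ, univ_inter]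
  have hx := (darboux (n := n) x.proj).map_source (mem_darboux_proj_source x)
  obtain ⟨B, hB⟩ : ∃ B : VField n Q → Phase n → Phase n,
      B = fun Z => VectorField.mpullbackWithin 𝓘(ℝ, Phase n) (phaseModel n)
        (darboux (n := n) x.proj).symm Z (range (phaseModel n)) := ⟨_, rfl⟩
  have h1 : ∀ Z : VField n Q, B Z =ᶠ[𝓝 (darboux (n := n) x.proj x)] localField x.proj Z :=
    fun Z => by
      filter_upwards [(isOpen_darboux_target _).mem_nhds hx] with z hz
      rw [hB]
      exact hinv Z z hz
  have h0 : vecAt (VectorField.mlieBracket (phaseModel n) X Y) x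
      = (chartDeriv x.proj x).inverse (VectorField.lieBracketWithin ℝ (B X) (B Y)
          ((darboux (n := n) x.proj).symm ⁻¹' univ ∩ range (phaseModel n))
          (darboux (n := n) x.proj x)) := by
    rw [hB]
    rfl
  rw [hset, VectorField.lieBracketWithin_univ,
    (h1 X).lieBracket_vectorField_eq (𝕜 := ℝ) (h1 Y)] at h0
  rw [h0, chartDeriv_self, ContinuousLinearMap.inverse_id]
  rfl

theorem localField_eventuallyEq {f : Cotangent n Q → ℝ}
    (hf : ContMDiff (phaseModel n) 𝓘(ℝ, ℝ) ∞ f) {X : VField n Q} (hX : IsHamiltonianField f X)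
    {a : Q} {y : Phase n} (hy : y ∈ (darboux (n := n) a).target) :
    localField a X =ᶠ[𝓝 y] fun z => poissonMap n (fderiv ℝ (localFun a f) z) := by
  filter_upwards [(isOpen_darboux_target a).mem_nhds hy] with z hz
    using localField_eq_poissonMap hf hX hz

/-- The Jacobi-Lie bracket of `X_f` and `X_g` is the Hamiltonian field of `dg(X_f)`. -/
theorem isHamiltonianField_mlieBracket {f g : Cotangent n Q → ℝ}
    (hf : ContMDiff (phaseModel n) 𝓘(ℝ, ℝ) ∞ f) (hg : ContMDiff (phaseModel n) 𝓘(ℝ, ℝ) ∞ g)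
    {X Y : VField n Q} (hX : IsHamiltonianField f X) (hY : IsHamiltonianField g Y) :
    IsHamiltonianField (fieldDeriv X g) (VectorField.mlieBracket (phaseModel n) X Y) := by
  refine isHamiltonianField_of_eq (contMDiff_fieldDeriv hf hg hX) fun x => ?_
  have hx := (darboux (n := n) x.proj).map_source (mem_darboux_proj_source x)
  rw [mlieBracket_eq, (localField_eventuallyEq hf hX hx).lieBracket_vectorField_eq
    (localField_eventuallyEq hg hY hx), lieBracket_poissonMap (contDiffAt_localFun hf hx)
    (contDiffAt_localFun hg hx)]
  congr 1
  apply Filter.EventuallyEq.fderiv_eq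
  filter_upwards [(isOpen_darboux_target _).mem_nhds hx] with z hz
  exact (localFun_fieldDeriv hf hg hX hz).symm

end Local

/-! ### The divergence of products and the operator `J_LP` -/

section Products

variable {n : ℕ}

theorem covector_apply_eq_sum (β : Phase n →L[ℝ] ℝ) (w : Phase n) :
    β w = ∑ i : Fin n, (w.1 i * β (dirQ i, 0) + w.2 (dirQ i) * β (0, dirP i)) := by
  conv_lhs => rw [phase_eq_sum w]
  rw [map_sum]
  refine Finset.sum_congr rfl fun i _ => ?_
  rw [map_sub, map_smul, map_smul]
  simp [omega]

theorem apply_poissonMap (β γ : Phase n →L[ℝ] ℝ) :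
    γ (poissonMap n β)
      = ∑ l : Fin n, (β (0, dirP l) * γ (dirQ l, 0) - β (dirQ l, 0) * γ (0, dirP l)) := by
  rw [covector_apply_eq_sum]
  refine Finset.sum_congr rfl fun l _ => ?_
  rw [poissonMap_fst_apply, poissonMap_snd]
  ring

theorem divLocal_smul {F : Phase n → ℝ} {α : Phase n → Phase n →L[ℝ] ℝ} {y : Phase n}
    (hF : DifferentiableAt ℝ F y) (hα : DifferentiableAt ℝ α y) :
    divLocal (fun z => F z • α z) y
      = F y * divLocal α y - α y (poissonMap n (fderiv ℝ F y)) := by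
  have hd : fderiv ℝ (fun z => F z • α z) y = _ := (hF.hasFDerivAt.smul hα.hasFDerivAt).fderiv
  rw [divLocal, divLocal, apply_poissonMap, hd, Finset.mul_sum, ← Finset.sum_sub_distrib]
  refine Finset.sum_congr rfl fun l _ => ?_
  simp only [_root_.add_apply, _root_.smul_apply, ContinuousLinearMap.smulRight_apply, smul_eq_mul]
  ring

theorem divLocal_fderiv {h : Phase n → ℝ} {y : Phase n} (hh : ContDiffAt ℝ ∞ h y) :
    divLocal (fderiv ℝ h) y = 0 := by
  have hs : IsSymmSndFDerivAt ℝ h y := hh.isSymmSndFDerivAt (by simpa using two_le_smooth)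
  rw [divLocal]
  exact Finset.sum_eq_zero fun l _ => by rw [hs.eq, sub_self]

theorem divLocal_congr {α β : Phase n → Phase n →L[ℝ] ℝ} {y : Phase n} (h : α =ᶠ[𝓝 y] β) :
    divLocal α y = divLocal β y := by
  rw [divLocal, divLocal, h.fderiv_eq]

theorem differentiableAt_fderiv {h : Phase n → ℝ} {y : Phase n} (hh : ContDiffAt ℝ ∞ h y) :
    DifferentiableAt ℝ (fderiv ℝ h) y :=
  (hh.fderiv_right (m := 1) two_le_smooth).differentiableAt (by simp)

theorem divLocal_smul_fderiv {F h : Phase n → ℝ} {y : Phase n} (hF : DifferentiableAt ℝ F y)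
    (hh : ContDiffAt ℝ ∞ h y) :
    divLocal (fun z => F z • fderiv ℝ h z) y = fderiv ℝ F y (poissonMap n (fderiv ℝ h y)) := by
  rw [divLocal_smul hF (differentiableAt_fderiv hh), divLocal_fderiv hh, mul_zero, zero_sub,
    ← omega_poissonMap (fderiv ℝ h y), omega_swap, neg_neg, omega_poissonMap]

theorem fderiv_fst_apply {U : Phase n → Phase n} {y : Phase n} (hU : DifferentiableAt ℝ U y)
    (i : Fin n) (e : Phase n) : fderiv ℝ (fun z => (U z).1 i) y e = (fderiv ℝ U y e).1 i := by
  have := ((EuclideanSpace.proj i : Base n →L[ℝ] ℝ).comp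
    (ContinuousLinearMap.fst ℝ (Base n) (Base n →L[ℝ] ℝ))).hasFDerivAt.comp y hU.hasFDerivAt
  have h2 : fderiv ℝ (fun z => (U z).1 i) y = _ := this.fderiv
  rw [h2]
  rfl

theorem fderiv_snd_apply {U : Phase n → Phase n} {y : Phase n} (hU : DifferentiableAt ℝ U y)
    (a : Base n) (e : Phase n) : fderiv ℝ (fun z => (U z).2 a) y e = (fderiv ℝ U y e).2 a := by
  have := ((ContinuousLinearMap.apply ℝ ℝ a).comp
    (ContinuousLinearMap.snd ℝ (Base n) (Base n →L[ℝ] ℝ))).hasFDerivAt.comp y hU.hasFDerivAt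
  have h2 : fderiv ℝ (fun z => (U z).2 a) y = _ := this.fderiv
  rw [h2]
  rfl

end Products

section Global

variable {n : ℕ} {Q : Type*} [TopologicalSpace Q] [ChartedSpace (Base n) Q]
  [IsManifold (𝓡 n) ∞ Q]

/-- The product of a function and a 1-form. -/
def smulForm (F : Cotangent n Q → ℝ) (Pi : OneForm n Q) : OneForm n Q :=
  fun x => F x • covAt Pi x

/-- The differential of a function as a 1-form. -/
def diffForm (h : Cotangent n Q → ℝ) : OneForm n Q := fun x => diffAt h x

theorem localForm_smulForm (F : Cotangent n Q → ℝ) (Pi : OneForm n Q) (a : Q) (y : Phase n) :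
    localForm a (smulForm F Pi) y = localFun a F y • localForm a Pi y := rfl

theorem localForm_diffForm {h : Cotangent n Q → ℝ} (hh : ContMDiff (phaseModel n) 𝓘(ℝ, ℝ) ∞ h)
    {a : Q} {y : Phase n} (hy : y ∈ (darboux (n := n) a).target) :
    localForm a (diffForm h) y = fderiv ℝ (localFun a h) y := by
  refine ContinuousLinearMap.ext fun v => ?_
  have h1 := diffAt_eq hh ((darboux (n := n) a).map_target hy)
  rw [localForm_apply]
  change diffAt h ((darboux (n := n) a).symm y) _ = _
  rw [h1, ContinuousLinearMap.comp_apply, chartDeriv_chartDerivSymm hy,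
    (darboux (n := n) a).right_inv hy]

theorem isSmoothForm_smulForm {F : Cotangent n Q → ℝ} {Pi : OneForm n Q}
    (hF : ContMDiff (phaseModel n) 𝓘(ℝ, ℝ) ∞ F) (hPi : IsSmoothForm Pi) :
    IsSmoothForm (smulForm F Pi) := fun a =>
  ((contDiffOn_localFun hF a).smul (hPi a)).congr fun y _ => localForm_smulForm F Pi a y

theorem isSmoothForm_diffForm {h : Cotangent n Q → ℝ}
    (hh : ContMDiff (phaseModel n) 𝓘(ℝ, ℝ) ∞ h) : IsSmoothForm (diffForm h) := fun a =>
  (contDiffOn_fderiv (isOpen_darboux_target a) (contDiffOn_localFun hh a)).congr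
    fun _ hy => localForm_diffForm hh hy

/-- `div((hΠ)^♯) = h div(Π^♯) - Π(X_h)` -/
theorem divSharp_smulForm {h : Cotangent n Q → ℝ} (hh : ContMDiff (phaseModel n) 𝓘(ℝ, ℝ) ∞ h)
    {X : VField n Q} (hX : IsHamiltonianField h X) {Pi : OneForm n Q} (hPi : IsSmoothForm Pi)
    (x : Cotangent n Q) :
    divSharp (smulForm h Pi) x = h x * divSharp Pi x - covAt Pi x (vecAt X x) := by
  have hs := mem_darboux_proj_source x
  have ht := (darboux (n := n) x.proj).map_source hs
  rw [divSharp_eq (isSmoothForm_smulForm hh hPi) hs, divSharp_eq hPi hs,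
    show localForm x.proj (smulForm h Pi)
      = fun z => localFun x.proj h z • localForm x.proj Pi z from rfl,
    divLocal_smul ((contDiffAt_localFun hh ht).differentiableAt (by simp))
      (hPi.differentiableAt ht), ← localField_eq_poissonMap hh hX ht, localFun_darboux hs,
    localForm_localField ht, (darboux (n := n) x.proj).left_inv hs]

/-- `div((F dh)^♯) = dF(X_h)` -/
theorem divSharp_smulForm_diffForm {F h : Cotangent n Q → ℝ}
    (hF : ContMDiff (phaseModel n) 𝓘(ℝ, ℝ) ∞ F) (hh : ContMDiff (phaseModel n) 𝓘(ℝ, ℝ) ∞ h)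
    (x : Cotangent n Q) :
    divSharp (smulForm F (diffForm h)) x
      = fderiv ℝ (localFun x.proj F) (darboux (n := n) x.proj x)
        (poissonMap n (fderiv ℝ (localFun x.proj h) (darboux (n := n) x.proj x))) := by
  have hs := mem_darboux_proj_source x
  have ht := (darboux (n := n) x.proj).map_source hs
  rw [divSharp_eq (isSmoothForm_smulForm hF (isSmoothForm_diffForm hh)) hs,
    ← divLocal_smul_fderiv ((contDiffAt_localFun hF ht).differentiableAt (by simp))
      (contDiffAt_localFun hh ht)]
  refine divLocal_congr ?_
  filter_upwards [(isOpen_darboux_target _).mem_nhds ht] with z hz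
  rw [localForm_smulForm, localForm_diffForm hh hz]

/-- The operator `J_LP(Π)` is minus the Lie derivative of `Π` along divergence free fields. -/
theorem JLP_apply {h : Cotangent n Q → ℝ} (hh : ContMDiff (phaseModel n) 𝓘(ℝ, ℝ) ∞ h)
    {X : VField n Q} (hX : IsHamiltonianField h X) {Pi : OneForm n Q} (hPi : IsSmoothForm Pi)
    (x : Cotangent n Q) (w : Phase n) :
    covAt (JLP Pi X) x w
      = -(localForm x.proj Pi (darboux (n := n) x.proj x)
            (fderiv ℝ (localField x.proj X) (darboux (n := n) x.proj x) w)
          + fderiv ℝ (localForm x.proj Pi) (darboux (n := n) x.proj x)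
            (localField x.proj X (darboux (n := n) x.proj x)) w) := by
  have hs := mem_darboux_proj_source x
  have ht := (darboux (n := n) x.proj).map_source hs
  set y := darboux (n := n) x.proj x with hy
  set α := localForm x.proj Pi with hα
  set U := localField x.proj X with hU
  have hαd : DifferentiableAt ℝ α y := hPi.differentiableAt ht
  have hUe : U =ᶠ[𝓝 y] fun z => poissonMap n (fderiv ℝ (localFun x.proj h) z) :=
    localField_eventuallyEq hh hX ht
  have hUd' : HasFDerivAt U
      ((poissonMap n).comp (fderiv ℝ (fderiv ℝ (localFun x.proj h)) y)) y :=
    ((poissonMap n).hasFDerivAt.comp y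
      (differentiableAt_fderiv (contDiffAt_localFun hh ht)).hasFDerivAt).congr_of_eventuallyEq hUe
  have hUd : DifferentiableAt ℝ U y := hUd'.differentiableAt
  have hsym : IsSymmSndFDerivAt ℝ (localFun x.proj h) y :=
    (contDiffAt_localFun hh ht).isSymmSndFDerivAt (by simpa using two_le_smooth)
  -- the Hamiltonian field has no divergence
  have htr : ∀ i : Fin n, (fderiv ℝ U y (dirQ i, 0)).1 i
      + (fderiv ℝ U y (0, dirP i)).2 (dirQ i) = 0 := by
    intro i
    rw [hUd'.fderiv]
    simp only [ContinuousLinearMap.comp_apply]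
    rw [poissonMap_fst_apply, poissonMap_snd, hsym.eq, add_neg_cancel]
  have hrow : ∀ e : Phase n, -∑ i : Fin n,
      (α y (dirQ i, 0) * fderiv ℝ (fun z => (U z).1 i) y e
        + fderiv ℝ (fun z => α z e) y (dirQ i, 0) * (U y).1 i
        + α y e * fderiv ℝ (fun z => (U z).1 i) y (dirQ i, 0)
        + (α y (0, dirP i) * fderiv ℝ (fun z => (U z).2 (dirQ i)) y e
          + fderiv ℝ (fun z => α z e) y (0, dirP i) * (U y).2 (dirQ i)
          + α y e * fderiv ℝ (fun z => (U z).2 (dirQ i)) y (0, dirP i)))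
      = -(α y (fderiv ℝ U y e) + fderiv ℝ α y (U y) e) := by
    intro e
    have h2 : fderiv ℝ α y (U y) e = (fderiv ℝ α y).flip e (U y) := rfl
    rw [h2, covector_apply_eq_sum (α y) (fderiv ℝ U y e),
      covector_apply_eq_sum ((fderiv ℝ α y).flip e),
      ← Finset.sum_add_distrib]
    congr 1
    refine Finset.sum_congr rfl fun i _ => ?_
    rw [fderiv_fst_apply hUd, fderiv_fst_apply hUd, fderiv_snd_apply hUd, fderiv_snd_apply hUd,
      fderiv_apply_const hαd, fderiv_apply_const hαd]
    simp only [ContinuousLinearMap.flip_apply]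
    linear_combination (α y e) * htr i
  have hform : covAt (JLP Pi X) x w = ∑ j : Fin n,
      (w.1 j * -(α y (fderiv ℝ U y (dirQ j, 0)) + fderiv ℝ α y (U y) (dirQ j, 0))
        + w.2 (dirQ j) * -(α y (fderiv ℝ U y (0, dirP j)) + fderiv ℝ α y (U y) (0, dirP j))) := by
    simp only [← hrow]
    have : covAt (JLP Pi X) x = ∑ j : Fin n,
      ((-∑ i : Fin n,
        (α y (dirQ i, 0) * fderiv ℝ (fun z => (U z).1 i) y (dirQ j, 0)
          + fderiv ℝ (fun z => α z (dirQ j, 0)) y (dirQ i, 0) * (U y).1 i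
          + α y (dirQ j, 0) * fderiv ℝ (fun z => (U z).1 i) y (dirQ i, 0)
          + (α y (0, dirP i) * fderiv ℝ (fun z => (U z).2 (dirQ i)) y (dirQ j, 0)
            + fderiv ℝ (fun z => α z (dirQ j, 0)) y (0, dirP i) * (U y).2 (dirQ i)
            + α y (dirQ j, 0) * fderiv ℝ (fun z => (U z).2 (dirQ i)) y (0, dirP i)))) •
          (dirP j).comp (ContinuousLinearMap.fst ℝ (Base n) (Base n →L[ℝ] ℝ))
      + (-∑ i : Fin n,
        (α y (dirQ i, 0) * fderiv ℝ (fun z => (U z).1 i) y (0, dirP j)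
          + fderiv ℝ (fun z => α z (0, dirP j)) y (dirQ i, 0) * (U y).1 i
          + α y (0, dirP j) * fderiv ℝ (fun z => (U z).1 i) y (dirQ i, 0)
          + (α y (0, dirP i) * fderiv ℝ (fun z => (U z).2 (dirQ i)) y (0, dirP j)
            + fderiv ℝ (fun z => α z (0, dirP j)) y (0, dirP i) * (U y).2 (dirQ i)
            + α y (0, dirP j) * fderiv ℝ (fun z => (U z).2 (dirQ i)) y (0, dirP i)))) •
          (ContinuousLinearMap.apply ℝ ℝ (dirQ j)).comp
            (ContinuousLinearMap.snd ℝ (Base n) (Base n →L[ℝ] ℝ))) := rfl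
    rw [this, _root_.sum_apply]
    refine Finset.sum_congr rfl fun j _ => ?_
    rw [_root_.add_apply, _root_.smul_apply, _root_.smul_apply, smul_eq_mul, smul_eq_mul,
      mul_comm, mul_comm (-_)]
    rfl
  rw [hform]
  have h3 := covector_apply_eq_sum (-((α y).comp (fderiv ℝ U y) + fderiv ℝ α y (U y))) w
  exact h3.symm

/-- The contraction of a 1-form and a vector field. -/
def contraction (Pi : OneForm n Q) (Y : VField n Q) (x : Cotangent n Q) : ℝ :=
  covAt Pi x (vecAt Y x)

theorem localFun_contraction (Pi : OneForm n Q) (Y : VField n Q) {a : Q} {y : Phase n}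
    (hy : y ∈ (darboux (n := n) a).target) :
    localFun a (contraction Pi Y) y = localForm a Pi y (localField a Y y) :=
  (localForm_localField hy Pi Y).symm

theorem contDiffOn_localField {h : Cotangent n Q → ℝ}
    (hh : ContMDiff (phaseModel n) 𝓘(ℝ, ℝ) ∞ h) {X : VField n Q} (hX : IsHamiltonianField h X)
    (a : Q) : ContDiffOn ℝ ∞ (localField a X) (darboux (n := n) a).target :=
  ((poissonMap n).contDiff.comp_contDiffOn
    (contDiffOn_fderiv (isOpen_darboux_target a) (contDiffOn_localFun hh a))).congr
      fun _ hy => localField_eq_poissonMap hh hX hy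

theorem contMDiff_contraction {g : Cotangent n Q → ℝ} (hg : ContMDiff (phaseModel n) 𝓘(ℝ, ℝ) ∞ g)
    {Y : VField n Q} (hY : IsHamiltonianField g Y) {Pi : OneForm n Q} (hPi : IsSmoothForm Pi) :
    ContMDiff (phaseModel n) 𝓘(ℝ, ℝ) ∞ (contraction Pi Y) :=
  contMDiff_of_localFun fun a =>
    ((hPi a).clm_apply (contDiffOn_localField hg hY a)).congr
      fun _ hy => localFun_contraction Pi Y hy

/-- `J_LP(Π)(X_h)(Y)` differs from `Π([X_h, Y])` (Jacobi-Lie bracket) by a divergence. -/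
theorem JLP_apply_field {h g : Cotangent n Q → ℝ} (hh : ContMDiff (phaseModel n) 𝓘(ℝ, ℝ) ∞ h)
    (hg : ContMDiff (phaseModel n) 𝓘(ℝ, ℝ) ∞ g) {X Y : VField n Q} (hX : IsHamiltonianField h X)
    (hY : IsHamiltonianField g Y) {Pi : OneForm n Q} (hPi : IsSmoothForm Pi)
    (x : Cotangent n Q) :
    contraction (JLP Pi X) Y x
      = contraction Pi (VectorField.mlieBracket (phaseModel n) X Y) x
        - divSharp (smulForm (contraction Pi Y) (diffForm h)) x := by
  have hs := mem_darboux_proj_source x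
  have ht := (darboux (n := n) x.proj).map_source hs
  rw [divSharp_smulForm_diffForm (contMDiff_contraction hg hY hPi) hh,
    ← localField_eq_poissonMap hh hX ht, contraction, contraction, JLP_apply hh hX hPi,
    mlieBracket_eq, VectorField.lieBracket, ← localForm_self, ← localField_self Y]
  have hYd : DifferentiableAt ℝ (localField x.proj Y) (darboux (n := n) x.proj x) :=
    ((contDiffOn_localField hg hY _).contDiffAt
      ((isOpen_darboux_target _).mem_nhds ht)).differentiableAt (by simp)
  have hF : localFun x.proj (contraction Pi Y) =ᶠ[𝓝 (darboux (n := n) x.proj x)]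
      fun z => localForm x.proj Pi z (localField x.proj Y z) := by
    filter_upwards [(isOpen_darboux_target _).mem_nhds ht] with z hz
    exact localFun_contraction Pi Y hz
  rw [hF.fderiv_eq, ((hPi.differentiableAt ht).hasFDerivAt.clm_apply hYd.hasFDerivAt).fderiv]
  simp only [_root_.add_apply, ContinuousLinearMap.comp_apply, ContinuousLinearMap.flip_apply,
    map_sub]
  ring

end Global

/-! ### Rapidly decreasing functions and functions of polynomial growth -/

section Growth

theorem isOpen_prod_univ {X Y : Type*} [TopologicalSpace X] [TopologicalSpace Y] {V : Set X}
    (hV : IsOpen V) : IsOpen (V ×ˢ (univ : Set Y)) := hV.prod isOpen_univ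

theorem mem_prod_univ {X Y : Type*} {V : Set X} {a : X} (ha : a ∈ V) (p : Y) :
    (a, p) ∈ V ×ˢ (univ : Set Y) := ⟨ha, mem_univ _⟩

variable {E₁ E₂ F G H : Type*} [NormedAddCommGroup E₁] [NormedSpace ℝ E₁] [NormedAddCommGroup E₂]
  [NormedSpace ℝ E₂] [NormedAddCommGroup F] [NormedSpace ℝ F] [NormedAddCommGroup G]
  [NormedSpace ℝ G] [NormedAddCommGroup H] [NormedSpace ℝ H]

/-- `f` is smooth on `V × E₂` and rapidly decreasing in the second variable with all its
derivatives, locally uniformly in the first variable. -/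
def RapidOn (V : Set E₁) (f : E₁ × E₂ → F) : Prop :=
  ContDiffOn ℝ ∞ f (V ×ˢ univ) ∧ ∀ K : Set E₁, IsCompact K → K ⊆ V → ∀ m N : ℕ,
    ∃ C : ℝ, ∀ a ∈ K, ∀ p : E₂, ‖p‖ ^ N * ‖iteratedFDeriv ℝ m f (a, p)‖ ≤ C

/-- `f` is smooth on `V × E₂` and each of its derivatives grows at most polynomially in the second
variable, locally uniformly in the first variable. -/
def TemperedOn (V : Set E₁) (f : E₁ × E₂ → F) : Prop :=
  ContDiffOn ℝ ∞ f (V ×ˢ univ) ∧ ∀ K : Set E₁, IsCompact K → K ⊆ V → ∀ m : ℕ,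
    ∃ (C : ℝ) (N : ℕ), ∀ a ∈ K, ∀ p : E₂, ‖iteratedFDeriv ℝ m f (a, p)‖ ≤ C * (1 + ‖p‖) ^ N

variable {V : Set E₁} {f f' : E₁ × E₂ → F}

theorem RapidOn.exists_weighted_bound (hf : RapidOn V f) {K : Set E₁} (hK : IsCompact K)
    (hKV : K ⊆ V) (m N : ℕ) :
    ∃ C : ℝ, 0 ≤ C ∧ ∀ a ∈ K, ∀ p : E₂, (1 + ‖p‖) ^ N * ‖iteratedFDeriv ℝ m f (a, p)‖ ≤ C := by
  obtain ⟨C₀, h₀⟩ := hf.2 K hK hKV m 0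
  obtain ⟨C₁, h₁⟩ := hf.2 K hK hKV m N
  refine ⟨2 ^ (N - 1) * (|C₀| + |C₁|), by positivity, fun a ha p => ?_⟩
  have h2 := add_pow_le (zero_le_one (α := ℝ)) (norm_nonneg p) N
  rw [one_pow] at h2
  have h3 := (h₀ a ha p).trans (le_abs_self _)
  have h4 := (h₁ a ha p).trans (le_abs_self _)
  rw [pow_zero, one_mul] at h3
  calc (1 + ‖p‖) ^ N * ‖iteratedFDeriv ℝ m f (a, p)‖
      ≤ (2 ^ (N - 1) * (1 + ‖p‖ ^ N)) * ‖iteratedFDeriv ℝ m f (a, p)‖ := by gcongr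
    _ = 2 ^ (N - 1) * (‖iteratedFDeriv ℝ m f (a, p)‖
          + ‖p‖ ^ N * ‖iteratedFDeriv ℝ m f (a, p)‖) := by ring
    _ ≤ _ := by gcongr

theorem rapidOn_of_weighted_bound (hf : ContDiffOn ℝ ∞ f (V ×ˢ univ))
    (h : ∀ K : Set E₁, IsCompact K → K ⊆ V → ∀ m N : ℕ,
      ∃ C : ℝ, ∀ a ∈ K, ∀ p : E₂, (1 + ‖p‖) ^ N * ‖iteratedFDeriv ℝ m f (a, p)‖ ≤ C) :
    RapidOn V f := by
  refine ⟨hf, fun K hK hKV m N => ?_⟩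
  obtain ⟨C, hC⟩ := h K hK hKV m N
  refine ⟨C, fun a ha p => le_trans ?_ (hC a ha p)⟩
  gcongr
  linarith

theorem RapidOn.congr (hV : IsOpen V) (hf : RapidOn V f) (h : ∀ z ∈ V ×ˢ univ, f' z = f z) :
    RapidOn V f' := by
  refine ⟨hf.1.congr h, fun K hK hKV m N => ?_⟩
  obtain ⟨C, hC⟩ := hf.2 K hK hKV m N
  refine ⟨C, fun a ha p => ?_⟩
  have : f' =ᶠ[𝓝 (a, p)] f := by
    filter_upwards [(isOpen_prod_univ hV).mem_nhds (mem_prod_univ (hKV ha) p)] with z hz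
      using h z hz
  rw [(this.iteratedFDeriv ℝ m).self_of_nhds]
  exact hC a ha p

theorem RapidOn.add (hV : IsOpen V) (hf : RapidOn V f) (hf' : RapidOn V f') :
    RapidOn V (f + f') := by
  refine ⟨hf.1.add hf'.1, fun K hK hKV m N => ?_⟩
  obtain ⟨C, hC⟩ := hf.2 K hK hKV m N
  obtain ⟨C', hC'⟩ := hf'.2 K hK hKV m N
  refine ⟨C + C', fun a ha p => ?_⟩
  have hmem := (isOpen_prod_univ hV).mem_nhds (mem_prod_univ (hKV ha) p)
  have hm : ((m : ℕ∞) : WithTop ℕ∞) ≤ ∞ := by exact_mod_cast le_top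
  rw [iteratedFDeriv_add_apply ((hf.1.contDiffAt hmem).of_le hm)
    ((hf'.1.contDiffAt hmem).of_le hm)]
  calc _ ≤ ‖p‖ ^ N * (‖iteratedFDeriv ℝ m f (a, p)‖ + ‖iteratedFDeriv ℝ m f' (a, p)‖) := by
        gcongr
        exact norm_add_le _ _
    _ ≤ _ := by
        rw [mul_add]
        exact add_le_add (hC a ha p) (hC' a ha p)

theorem RapidOn.fderiv (hV : IsOpen V) (hf : RapidOn V f) : RapidOn V (fderiv ℝ f) := by
  refine ⟨contDiffOn_fderiv (isOpen_prod_univ hV) hf.1, fun K hK hKV m N => ?_⟩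
  obtain ⟨C, hC⟩ := hf.2 K hK hKV (m + 1) N
  exact ⟨C, fun a ha p => by rw [norm_iteratedFDeriv_fderiv]; exact hC a ha p⟩

theorem TemperedOn.fderiv (hV : IsOpen V) (hf : TemperedOn V f) : TemperedOn V (fderiv ℝ f) := by
  refine ⟨contDiffOn_fderiv (isOpen_prod_univ hV) hf.1, fun K hK hKV m => ?_⟩
  obtain ⟨C, N, hC⟩ := hf.2 K hK hKV (m + 1)
  exact ⟨C, N, fun a ha p => by rw [norm_iteratedFDeriv_fderiv]; exact hC a ha p⟩

theorem temperedOn_const (c : F) : TemperedOn V (fun _ : E₁ × E₂ => c) := by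
  refine ⟨contDiffOn_const, fun K _ _ m => ⟨‖c‖, 0, fun a _ p => ?_⟩⟩
  rcases Nat.eq_zero_or_pos m with rfl | hm
  · simp
  · rw [iteratedFDeriv_const_of_ne hm.ne']
    simp

theorem norm_iteratedFDeriv_bilinear_le (B : F →L[ℝ] G →L[ℝ] H) (hV : IsOpen V)
    {g : E₁ × E₂ → G} (hf : ContDiffOn ℝ ∞ f (V ×ˢ univ)) (hg : ContDiffOn ℝ ∞ g (V ×ˢ univ))
    {a : E₁} (ha : a ∈ V) (p : E₂) (m : ℕ) :
    ‖iteratedFDeriv ℝ m (fun z => B (f z) (g z)) (a, p)‖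
      ≤ ‖B‖ * ∑ i ∈ Finset.range (m + 1), (m.choose i : ℝ) * ‖iteratedFDeriv ℝ i f (a, p)‖
          * ‖iteratedFDeriv ℝ (m - i) g (a, p)‖ := by
  have hs := isOpen_prod_univ (Y := E₂) hV
  have hm : ((m : ℕ∞) : WithTop ℕ∞) ≤ ∞ := by exact_mod_cast le_top
  have := B.norm_iteratedFDerivWithin_le_of_bilinear hf hg hs.uniqueDiffOn (mem_prod_univ ha p)
    (n := m) hm
  simp only [iteratedFDerivWithin_of_isOpen _ hs (mem_prod_univ ha p)] at this
  exact this

/-- The product of a rapidly decreasing function and one of polynomial growth is rapidly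
decreasing. -/
theorem RapidOn.bilinear (B : F →L[ℝ] G →L[ℝ] H) (hV : IsOpen V) {g : E₁ × E₂ → G}
    (hf : RapidOn V f) (hg : TemperedOn V g) : RapidOn V (fun z => B (f z) (g z)) := by
  refine rapidOn_of_weighted_bound
    ((B.isBoundedBilinearMap.contDiff).comp_contDiffOn (hf.1.prodMk hg.1)) fun K hK hKV m N => ?_
  choose Cg Ng hg' using fun i => hg.2 K hK hKV i
  choose Cf hf0 hf' using fun i M => hf.exists_weighted_bound hK hKV i M
  refine ⟨‖B‖ * ∑ i ∈ Finset.range (m + 1),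
    (m.choose i : ℝ) * Cf i (N + Ng (m - i)) * |Cg (m - i)|, fun a ha p => ?_⟩
  calc (1 + ‖p‖) ^ N * ‖iteratedFDeriv ℝ m (fun z => B (f z) (g z)) (a, p)‖
      ≤ (1 + ‖p‖) ^ N * (‖B‖ * ∑ i ∈ Finset.range (m + 1), (m.choose i : ℝ)
          * ‖iteratedFDeriv ℝ i f (a, p)‖ * ‖iteratedFDeriv ℝ (m - i) g (a, p)‖) := by
        gcongr
        exact norm_iteratedFDeriv_bilinear_le B hV hf.1 hg.1 (hKV ha) p m
    _ = ‖B‖ * ∑ i ∈ Finset.range (m + 1), (m.choose i : ℝ)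
          * ((1 + ‖p‖) ^ N * ‖iteratedFDeriv ℝ i f (a, p)‖)
          * ‖iteratedFDeriv ℝ (m - i) g (a, p)‖ := by
        rw [mul_left_comm, Finset.mul_sum]
        congr 1
        exact Finset.sum_congr rfl fun i _ => by ring
    _ ≤ _ := by
        refine mul_le_mul_of_nonneg_left (Finset.sum_le_sum fun i _ => ?_) (norm_nonneg B)
        have h1 : ‖iteratedFDeriv ℝ (m - i) g (a, p)‖ ≤ |Cg (m - i)| * (1 + ‖p‖) ^ Ng (m - i) :=
          (hg' _ a ha p).trans (by gcongr; exact le_abs_self _)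
        calc (m.choose i : ℝ) * ((1 + ‖p‖) ^ N * ‖iteratedFDeriv ℝ i f (a, p)‖)
              * ‖iteratedFDeriv ℝ (m - i) g (a, p)‖
            ≤ (m.choose i : ℝ) * ((1 + ‖p‖) ^ N * ‖iteratedFDeriv ℝ i f (a, p)‖)
              * (|Cg (m - i)| * (1 + ‖p‖) ^ Ng (m - i)) := by gcongr
          _ = (m.choose i : ℝ) * ((1 + ‖p‖) ^ (N + Ng (m - i)) * ‖iteratedFDeriv ℝ i f (a, p)‖)
              * |Cg (m - i)| := by rw [pow_add]; ring
          _ ≤ (m.choose i : ℝ) * Cf i (N + Ng (m - i)) * |Cg (m - i)| :=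
            mul_le_mul_of_nonneg_right
              (mul_le_mul_of_nonneg_left (hf' i _ a ha p) (Nat.cast_nonneg _)) (abs_nonneg _)

theorem RapidOn.clm_comp (L : F →L[ℝ] G) (hV : IsOpen V) (hf : RapidOn V f) :
    RapidOn V (fun z => L (f z)) :=
  hf.bilinear (ContinuousLinearMap.apply ℝ G) hV (temperedOn_const L)

theorem TemperedOn.clm_comp (L : F →L[ℝ] G) (hV : IsOpen V) (hf : TemperedOn V f) :
    TemperedOn V (fun z => L (f z)) := by
  refine ⟨L.contDiff.comp_contDiffOn hf.1, fun K hK hKV m => ?_⟩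
  obtain ⟨C, N, hC⟩ := hf.2 K hK hKV m
  refine ⟨‖L‖ * C, N, fun a ha p => ?_⟩
  have hm : ((m : ℕ∞) : WithTop ℕ∞) ≤ ∞ := by exact_mod_cast le_top
  have hfa := hf.1.contDiffAt ((isOpen_prod_univ hV).mem_nhds (mem_prod_univ (hKV ha) p))
  change ‖iteratedFDeriv ℝ m (L ∘ f) (a, p)‖ ≤ _
  rw [L.iteratedFDeriv_comp_left hfa hm, mul_assoc]
  exact (L.norm_compContinuousMultilinearMap_le _).trans (by gcongr; exact hC a ha p)

/-- The dilation `(a, p) ↦ (a, c p)`. -/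
def dilation (E₁ E₂ : Type*) [NormedAddCommGroup E₁] [NormedSpace ℝ E₁] [NormedAddCommGroup E₂]
    [NormedSpace ℝ E₂] (c : ℝ) : (E₁ × E₂) →L[ℝ] (E₁ × E₂) :=
  (ContinuousLinearMap.id ℝ E₁).prodMap (c • ContinuousLinearMap.id ℝ E₂)

theorem dilation_apply (c : ℝ) (z : E₁ × E₂) : dilation E₁ E₂ c z = (z.1, c • z.2) := rfl

theorem norm_dilation_le (c : ℝ) : ‖dilation E₁ E₂ c‖ ≤ max 1 |c| := by
  refine ContinuousLinearMap.opNorm_le_bound _ (by positivity) fun z => ?_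
  rw [dilation_apply, Prod.norm_def]
  refine max_le ?_ ?_
  · calc ‖z.1‖ ≤ 1 * ‖z‖ := by rw [one_mul]; exact norm_fst_le z
      _ ≤ _ := by gcongr; exact le_max_left _ _
  · rw [norm_smul, Real.norm_eq_abs]
    have := norm_snd_le z
    gcongr
    exact le_max_right _ _

theorem preimage_dilation (c : ℝ) :
    dilation E₁ E₂ c ⁻¹' (V ×ˢ univ) = V ×ˢ univ := by
  ext z
  simp [dilation_apply]

theorem norm_iteratedFDeriv_comp_dilation_le (hV : IsOpen V) (hf : ContDiffOn ℝ ∞ f (V ×ˢ univ))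
    (c : ℝ) {a : E₁} (ha : a ∈ V) (p : E₂) (m : ℕ) :
    ‖iteratedFDeriv ℝ m (fun z => f (dilation E₁ E₂ c z)) (a, p)‖
      ≤ ‖iteratedFDeriv ℝ m f (a, c • p)‖ * max 1 |c| ^ m := by
  have hs := isOpen_prod_univ (Y := E₂) hV
  have hm : ((m : ℕ∞) : WithTop ℕ∞) ≤ ∞ := by exact_mod_cast le_top
  have h := (dilation E₁ E₂ c).iteratedFDerivWithin_comp_right hf hs.uniqueDiffOn
    (by rw [preimage_dilation]; exact hs.uniqueDiffOn) (x := (a, p))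
    (mem_prod_univ ha (c • p)) hm
  have h2 : dilation E₁ E₂ c (a, p) = (a, c • p) := rfl
  rw [preimage_dilation, h2, iteratedFDerivWithin_of_isOpen _ hs (mem_prod_univ ha p),
    iteratedFDerivWithin_of_isOpen _ hs (mem_prod_univ ha (c • p))] at h
  change ‖iteratedFDeriv ℝ m (f ∘ dilation E₁ E₂ c) (a, p)‖ ≤ _
  rw [h]
  refine (ContinuousMultilinearMap.norm_compContinuousLinearMap_le _ _).trans ?_
  rw [Finset.prod_const, Finset.card_univ, Fintype.card_fin]
  have := norm_dilation_le (E₁ := E₁) (E₂ := E₂) c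
  gcongr

theorem contDiffOn_comp_dilation (hf : ContDiffOn ℝ ∞ f (V ×ˢ univ)) (c : ℝ) :
    ContDiffOn ℝ ∞ (fun z => f (dilation E₁ E₂ c z)) (V ×ˢ univ) :=
  hf.comp (dilation E₁ E₂ c).contDiff.contDiffOn fun _ hz => ⟨hz.1, mem_univ _⟩

theorem RapidOn.comp_dilation (hV : IsOpen V) (hf : RapidOn V f) {c : ℝ} (hc : c ≠ 0) :
    RapidOn V (fun z => f (dilation E₁ E₂ c z)) := by
  refine ⟨contDiffOn_comp_dilation hf.1 c, fun K hK hKV m N => ?_⟩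
  obtain ⟨C, hC⟩ := hf.2 K hK hKV m N
  refine ⟨(|c| ^ N)⁻¹ * C * max 1 |c| ^ m, fun a ha p => ?_⟩
  have h1 := norm_iteratedFDeriv_comp_dilation_le hV hf.1 c (hKV ha) p m
  have h2 := hC a ha (c • p)
  have hc' : 0 < |c| := abs_pos.2 hc
  rw [norm_smul, Real.norm_eq_abs, mul_pow] at h2
  calc ‖p‖ ^ N * ‖iteratedFDeriv ℝ m (fun z => f (dilation E₁ E₂ c z)) (a, p)‖
      ≤ ‖p‖ ^ N * (‖iteratedFDeriv ℝ m f (a, c • p)‖ * max 1 |c| ^ m) := by gcongr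
    _ = (|c| ^ N)⁻¹ * (|c| ^ N * ‖p‖ ^ N * ‖iteratedFDeriv ℝ m f (a, c • p)‖) * max 1 |c| ^ m := by
        field_simp
    _ ≤ _ := by gcongr

/-- Smooth functions that are homogeneous in the second variable have polynomial growth. -/
theorem temperedOn_of_homogeneous [FiniteDimensional ℝ E₂] (hV : IsOpen V)
    (hf : ContDiffOn ℝ ∞ f (V ×ˢ univ)) (k : ℕ)
    (hk : ∀ a ∈ V, ∀ (c : ℝ) (p : E₂), f (a, c • p) = c ^ k • f (a, p)) : TemperedOn V f := by
  have := FiniteDimensional.proper ℝ E₂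
  refine ⟨hf, fun K hK hKV m => ?_⟩
  have hs := isOpen_prod_univ (Y := E₂) hV
  have hm : ((m : ℕ∞) : WithTop ℕ∞) ≤ ∞ := by exact_mod_cast le_top
  have hcont : ContinuousOn (fun z => ‖iteratedFDeriv ℝ m f z‖) (K ×ˢ Metric.closedBall 0 1) := by
    refine ((hf.continuousOn_iteratedFDerivWithin hm hs.uniqueDiffOn).congr fun z hz =>
      (iteratedFDerivWithin_of_isOpen _ hs hz).symm).norm.mono ?_
    exact prod_mono hKV (subset_univ _)
  obtain ⟨C, hC⟩ := (hK.prod (isCompact_closedBall (0 : E₂) 1)).bddAbove_image hcont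
  have hC' : ∀ a ∈ K, ∀ u : E₂, ‖u‖ ≤ 1 → ‖iteratedFDeriv ℝ m f (a, u)‖ ≤ C := fun a ha u hu =>
    hC (mem_image_of_mem _ ⟨ha, by simpa using hu⟩)
  refine ⟨|C|, k, fun a ha p => ?_⟩
  rcases le_total ‖p‖ 1 with hp | hp
  · calc _ ≤ |C| * 1 := by rw [mul_one]; exact (hC' a ha p hp).trans (le_abs_self C)
      _ ≤ _ := by
        gcongr
        exact one_le_pow₀ (by linarith [norm_nonneg p])
  · have hp0 : 0 < ‖p‖ := by linarith
    have heq : f =ᶠ[𝓝 (a, p)] ‖p‖ ^ k • fun z => f (dilation E₁ E₂ ‖p‖⁻¹ z) := by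
      filter_upwards [hs.mem_nhds (mem_prod_univ (hKV ha) p)] with z hz
      rw [Pi.smul_apply, dilation_apply, hk _ hz.1, smul_smul, ← mul_pow, mul_inv_cancel₀ hp0.ne',
        one_pow, one_smul]
    have hd : ContDiffAt ℝ m (fun z => f (dilation E₁ E₂ ‖p‖⁻¹ z)) (a, p) :=
      ((contDiffOn_comp_dilation hf _).contDiffAt
        (hs.mem_nhds (mem_prod_univ (hKV ha) p))).of_le hm
    rw [(heq.iteratedFDeriv ℝ m).self_of_nhds, iteratedFDeriv_const_smul_apply hd, norm_smul,
      norm_pow, norm_norm]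
    have h1 := norm_iteratedFDeriv_comp_dilation_le hV hf ‖p‖⁻¹ (hKV ha) p m
    have h2 : max 1 |‖p‖⁻¹| = 1 := by
      rw [abs_of_pos (inv_pos.2 hp0)]
      exact max_eq_left (inv_le_one_of_one_le₀ hp)
    rw [h2, one_pow, mul_one] at h1
    have h3 := hC' a ha (‖p‖⁻¹ • p) (by
      rw [norm_smul, norm_inv, norm_norm, inv_mul_cancel₀ hp0.ne'])
    calc ‖p‖ ^ k * ‖iteratedFDeriv ℝ m (fun z => f (dilation E₁ E₂ ‖p‖⁻¹ z)) (a, p)‖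
        ≤ (1 + ‖p‖) ^ k * |C| := by
          gcongr
          · linarith
          · exact h1.trans (h3.trans (le_abs_self C))
      _ = _ := mul_comm _ _

end Growth

section Integrals

variable {E₁ E₂ F : Type*} [NormedAddCommGroup E₁] [NormedSpace ℝ E₁] [NormedAddCommGroup E₂]
  [NormedSpace ℝ E₂] [NormedAddCommGroup F] [NormedSpace ℝ F]
  [FiniteDimensional ℝ E₂] [MeasurableSpace E₂] [BorelSpace E₂] [FiniteDimensional ℝ F]
  {ν : Measure E₂} [ν.IsAddHaarMeasure]
  {V : Set E₁} {f : E₁ × E₂ → F}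

theorem RapidOn.integrable_fiber (hf : RapidOn V f) {a : E₁} (ha : a ∈ V) :
    Integrable (fun p => f (a, p)) ν := by
  have := FiniteDimensional.proper ℝ E₂
  have := FiniteDimensional.proper ℝ F
  obtain ⟨C, hC0, hC⟩ := hf.exists_weighted_bound isCompact_singleton
    (singleton_subset_iff.2 ha) 0 (Module.finrank ℝ E₂ + 1)
  have h1 : Integrable (fun p : E₂ => (1 + ‖p‖) ^ (-((Module.finrank ℝ E₂ + 1 : ℕ) : ℝ))) ν :=
    integrable_one_add_norm (by push_cast; linarith)
  refine (h1.const_mul C).mono' ?_ (Eventually.of_forall fun p => ?_)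
  · refine Continuous.aestronglyMeasurable ?_
    exact hf.1.continuousOn.comp_continuous (by fun_prop) fun p => ⟨ha, mem_univ _⟩
  · have h4 := hC a rfl p
    rw [norm_iteratedFDeriv_zero] at h4
    have h5 : 0 < 1 + ‖p‖ := by linarith [norm_nonneg p]
    rw [Real.rpow_neg h5.le, Real.rpow_natCast, ← div_eq_mul_inv, le_div_iff₀ (by positivity),
      mul_comm]
    exact h4

theorem RapidOn.integrableOn [FiniteDimensional ℝ E₁] [MeasurableSpace E₁] [BorelSpace E₁]
    {μ : Measure E₁} [μ.IsAddHaarMeasure] (hf : RapidOn V f) {K : Set E₁}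
    (hK : IsCompact K) (hKV : K ⊆ V) :
    IntegrableOn f (K ×ˢ univ) (μ.prod ν) := by
  have := FiniteDimensional.proper ℝ E₁
  have := FiniteDimensional.proper ℝ E₂
  have := FiniteDimensional.proper ℝ F
  obtain ⟨C, hC0, hC⟩ := hf.exists_weighted_bound hK hKV 0 (Module.finrank ℝ E₂ + 1)
  have h1 : Integrable (fun p : E₂ => (1 + ‖p‖) ^ (-((Module.finrank ℝ E₂ + 1 : ℕ) : ℝ))) ν :=
    integrable_one_add_norm (by push_cast; linarith)
  have h2 : Integrable (fun _ : E₁ => C) (μ.restrict K) := by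
    rw [integrable_const_iff]
    right
    rw [isFiniteMeasure_restrict]
    exact hK.measure_lt_top.ne
  have h3 : Integrable (fun z : E₁ × E₂ => C * (1 + ‖z.2‖) ^
      (-((Module.finrank ℝ E₂ + 1 : ℕ) : ℝ))) ((μ.prod ν).restrict (K ×ˢ univ)) := by
    rw [← Measure.prod_restrict, Measure.restrict_univ]
    exact h2.mul_prod h1
  have hmeas : MeasurableSet (K ×ˢ (univ : Set E₂)) := hK.isClosed.measurableSet.prod .univ
  refine h3.mono' ?_ ?_
  · exact (hf.1.continuousOn.mono (prod_mono hKV subset_rfl)).aestronglyMeasurable hmeas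
  · filter_upwards [ae_restrict_mem hmeas] with z hz
    have h4 := hC z.1 hz.1 z.2
    rw [norm_iteratedFDeriv_zero] at h4
    have h5 : 0 < 1 + ‖z.2‖ := by linarith [norm_nonneg z.2]
    rw [Real.rpow_neg h5.le, Real.rpow_natCast, ← div_eq_mul_inv, le_div_iff₀ (by positivity),
      mul_comm]
    exact h4

end Integrals

/-! ### The symplectic volume in a Darboux chart -/

section Volume

variable {n : ℕ} {Q : Type*} [TopologicalSpace Q] [ChartedSpace (Base n) Q]
  [IsManifold (𝓡 n) ∞ Q]

instance isAddHaarMeasure_momentumVolume (n : ℕ) : (momentumVolume n).IsAddHaarMeasure :=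
  (InnerProductSpace.toDual ℝ (Base n)).toContinuousLinearEquiv.isAddHaarMeasure_map volume

/-- The Lebesgue measure `dq dp` on the space of Darboux coordinates. -/
def phaseVolume (n : ℕ) : Measure (Phase n) := volume.prod (momentumVolume n)

instance isAddHaarMeasure_phaseVolume (n : ℕ) : (phaseVolume n).IsAddHaarMeasure :=
  Measure.prod.instIsAddHaarMeasure _ _

/-- The measure on `T*Q` given by `dq dp` in the Darboux chart over `a`. -/
def chartMeasure (a : Q) : Measure (Cotangent n Q) :=
  Measure.map (darboux (n := n) a).symm ((phaseVolume n).restrict (darboux (n := n) a).target)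

theorem measurableSet_darboux_target (a : Q) : MeasurableSet (darboux (n := n) a).target :=
  (isOpen_darboux_target a).measurableSet

theorem measurableSet_darboux_source (a : Q) : MeasurableSet (darboux (n := n) a).source :=
  (isOpen_darboux_source a).measurableSet

theorem continuousOn_darboux_symm (a : Q) :
    ContinuousOn (darboux (n := n) a).symm (darboux (n := n) a).target :=
  (contMDiffOn_darboux_symm a).continuousOn

theorem aemeasurable_darboux_symm (a : Q) : AEMeasurable (darboux (n := n) a).symm
    ((phaseVolume n).restrict (darboux (n := n) a).target) :=
  (continuousOn_darboux_symm a).aemeasurable (measurableSet_darboux_target a)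

theorem chartMeasure_apply (a : Q) {s : Set (Cotangent n Q)} (hs : MeasurableSet s) :
    chartMeasure a s
      = phaseVolume n ((darboux (n := n) a).target ∩ (darboux (n := n) a).symm ⁻¹' s) := by
  rw [chartMeasure, Measure.map_apply_of_aemeasurable (aemeasurable_darboux_symm a) hs,
    Measure.restrict_apply' (measurableSet_darboux_target a), inter_comm]

theorem measurableSet_target_inter_preimage (a : Q) {s : Set (Cotangent n Q)}
    (hs : MeasurableSet s) :
    MeasurableSet ((darboux (n := n) a).target ∩ (darboux (n := n) a).symm ⁻¹' s) := by
  have h1 : Measurable fun y : (darboux (n := n) a).target => (darboux (n := n) a).symm y :=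
    (continuousOn_darboux_symm a).domRestrict.measurable
  have h2 := (MeasurableEmbedding.subtype_coe (measurableSet_darboux_target a)).measurableSet_image'
    (h1 hs)
  convert h2 using 1
  ext y
  exact ⟨fun h => ⟨⟨y, h.1⟩, h.2, rfl⟩, by rintro ⟨z, hz, rfl⟩; exact ⟨z.2, hz⟩⟩

/-- The transition maps preserve the Lebesgue measure, because symplectic maps have
determinant `±1`. -/
theorem phaseVolume_image_transition (a b : Q) {D : Set (Phase n)} (hD : MeasurableSet D)
    (hDt : D ⊆ transitionDomain n a b) :
    phaseVolume n (transition a b '' D) = phaseVolume n D := by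
  have hinj : InjOn (transition (n := n) a b) D := by
    intro y hy z hz hyz
    have h := congrArg (darboux (n := n) b).symm hyz
    rw [darboux_symm_transition (hDt hy), darboux_symm_transition (hDt hz)] at h
    exact (darboux (n := n) a).symm.injOn (hDt hy).1 (hDt hz).1 h
  have h := lintegral_image_eq_lintegral_abs_det_fderiv_mul (phaseVolume n) hD
    (fun y hy => ((contDiffAt_transition (hDt hy)).differentiableAt
      (by simp)).hasFDerivAt.hasFDerivWithinAt) hinj (fun _ => 1)
  rw [setLIntegral_one] at h
  rw [h, ← setLIntegral_one]
  refine setLIntegral_congr_fun hD fun y hy => ?_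
  rw [abs_det_of_omega_preserving _ (omega_fderiv_transition (hDt hy))]
  simp

theorem chartMeasure_restrict_le (a b : Q) :
    (chartMeasure b).restrict (darboux (n := n) a).source ≤ chartMeasure a := by
  refine Measure.le_iff.2 fun s hs => ?_
  have hs' := hs.inter (measurableSet_darboux_source (n := n) a)
  have hD := measurableSet_target_inter_preimage b hs'
  have hDt : (darboux (n := n) b).target ∩ (darboux (n := n) b).symm ⁻¹'
      (s ∩ (darboux (n := n) a).source) ⊆ transitionDomain n b a := fun y hy => ⟨hy.1, hy.2.2⟩
  rw [Measure.restrict_apply hs, chartMeasure_apply b hs', chartMeasure_apply a hs,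
    ← phaseVolume_image_transition b a hD hDt]
  refine measure_mono ?_
  rintro _ ⟨y, hy, rfl⟩
  refine ⟨transition_mem_target (hDt hy), ?_⟩
  rw [mem_preimage, darboux_symm_transition (hDt hy)]
  exact hy.2.1

theorem symplecticVolume_eq_iSup :
    symplecticVolume n Q = ⨆ a : Q, chartMeasure (n := n) a := rfl

/-- In a Darboux chart, the symplectic volume is the Lebesgue measure. -/
theorem symplecticVolume_restrict (a : Q) :
    (symplecticVolume n Q).restrict (darboux (n := n) a).source = chartMeasure a := by
  have hm := measurableSet_darboux_source (n := n) a
  apply le_antisymm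
  · -- a measure that is infinite off the chart dominates all chart measures
    have h1 : symplecticVolume n Q
        ≤ chartMeasure a + (⊤ : Measure (Cotangent n Q)).restrict (darboux (n := n) a).sourceᶜ := by
      rw [symplecticVolume_eq_iSup]
      refine iSup_le fun b => ?_
      rw [← Measure.restrict_add_restrict_compl (μ := chartMeasure b) hm]
      exact add_le_add (chartMeasure_restrict_le a b) (Measure.restrict_mono_measure le_top _)
    calc (symplecticVolume n Q).restrict (darboux (n := n) a).source
        ≤ (chartMeasure a + (⊤ : Measure (Cotangent n Q)).restrict
            (darboux (n := n) a).sourceᶜ).restrict (darboux (n := n) a).source :=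
          Measure.restrict_mono_measure h1 _
      _ = (chartMeasure a).restrict (darboux (n := n) a).source := by
          rw [Measure.restrict_add, Measure.restrict_restrict hm, inter_compl_self,
            Measure.restrict_empty, add_zero]
      _ ≤ chartMeasure a := Measure.restrict_le_self
  · have h2 : (chartMeasure a).restrict (darboux (n := n) a).source = chartMeasure a := by
      refine Measure.restrict_eq_self_of_ae_mem ?_
      rw [ae_iff]
      change chartMeasure a (darboux (n := n) a).sourceᶜ = 0
      rw [chartMeasure_apply a hm.compl]
      convert measure_empty (μ := phaseVolume n)
      exact eq_empty_of_forall_notMem fun y hy => hy.2 ((darboux (n := n) a).map_target hy.1)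
    rw [← h2]
    refine Measure.restrict_mono_measure ?_ _
    rw [symplecticVolume_eq_iSup]
    exact le_iSup (fun b : Q => chartMeasure (n := n) b) a

section

variable {F : Cotangent n Q → ℝ} {a : Q}

theorem continuousOn_of_localFun
    (hc : ContinuousOn (localFun a F) (darboux (n := n) a).target) :
    ContinuousOn F (darboux (n := n) a).source :=
  (hc.comp (contMDiffOn_darboux a).continuousOn (darboux (n := n) a).mapsTo).congr
    fun _ hx => (localFun_darboux hx F).symm

theorem aestronglyMeasurable_chartMeasure
    (hc : ContinuousOn (localFun a F) (darboux (n := n) a).target) :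
    AEStronglyMeasurable F (chartMeasure a) := by
  rw [← symplecticVolume_restrict]
  exact (continuousOn_of_localFun hc).aestronglyMeasurable (measurableSet_darboux_source a)

theorem integral_eq_chart_integral
    (hc : ContinuousOn (localFun a F) (darboux (n := n) a).target)
    (hF : ∀ x : Cotangent n Q, x ∉ (darboux (n := n) a).source → F x = 0) :
    ∫ x, F x ∂symplecticVolume n Q
      = ∫ y in (darboux (n := n) a).target, localFun a F y ∂phaseVolume n := by
  rw [← setIntegral_eq_integral_of_forall_compl_eq_zero hF, symplecticVolume_restrict,
    chartMeasure, integral_map (aemeasurable_darboux_symm a)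
      (aestronglyMeasurable_chartMeasure hc)]
  rfl

theorem integrable_of_chart
    (hc : ContinuousOn (localFun a F) (darboux (n := n) a).target)
    (hF : ∀ x : Cotangent n Q, x ∉ (darboux (n := n) a).source → F x = 0)
    (hi : IntegrableOn (localFun a F) (darboux (n := n) a).target (phaseVolume n)) :
    Integrable F (symplecticVolume n Q) := by
  rw [← integrableOn_iff_integrable_of_support_subset (s := (darboux (n := n) a).source)
    (Function.support_subset_iff'.2 hF), IntegrableOn, symplecticVolume_restrict, chartMeasure,
    integrable_map_measure (aestronglyMeasurable_chartMeasure hc) (aemeasurable_darboux_symm a)]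
  exact hi

end

end Volume

/-! ### Functions that are homogeneous in the momenta -/

section Homogeneous

variable {n : ℕ} {Q : Type*} [TopologicalSpace Q] [ChartedSpace (Base n) Q]
  [IsManifold (𝓡 n) ∞ Q]

theorem mem_darboux_target {a : Q} {q : Base n} (hq : q ∈ (extChartAt (𝓡 n) a).target)
    (p : Base n →L[ℝ] ℝ) : (q, p) ∈ (darboux (n := n) a).target := by
  rw [darboux_target]
  exact ⟨hq, mem_univ _⟩

theorem fst_mem_of_mem_darboux_target {a : Q} {y : Phase n}
    (hy : y ∈ (darboux (n := n) a).target) : y.1 ∈ (extChartAt (𝓡 n) a).target := by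
  rw [darboux_target] at hy
  exact hy.1

/-- The fibre coordinates of a covector in the Darboux chart over `a` depend linearly on it. -/
def fiberCoord (a x : Q) : (Base n →L[ℝ] ℝ) →L[ℝ] (Base n →L[ℝ] ℝ) :=
  (ContinuousLinearMap.compL ℝ (Base n) (Base n) ℝ).flip
    (tangentCoordChange (𝓡 n) a x x)

/-- The covector over `x` with given fibre coordinates in the Darboux chart over `a`. -/
def fiberCoordSymm (a x : Q) : (Base n →L[ℝ] ℝ) →L[ℝ] (Base n →L[ℝ] ℝ) :=
  (ContinuousLinearMap.compL ℝ (Base n) (Base n) ℝ).flip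
    (tangentCoordChange (𝓡 n) x a x)

theorem fiberCoord_fiberCoordSymm {a x : Q} (hx : x ∈ (chartAt (Base n) a).source)
    (p : Base n →L[ℝ] ℝ) : fiberCoord a x (fiberCoordSymm a x p) = p := by
  ext v
  change p (tangentCoordChange (𝓡 n) x a x (tangentCoordChange (𝓡 n) a x x v)) = p v
  rw [tangentCoordChange_comp, tangentCoordChange_self] <;> simp [hx]

theorem fiberCoordSymm_fiberCoord {a x : Q} (hx : x ∈ (chartAt (Base n) a).source)
    (p : Base n →L[ℝ] ℝ) : fiberCoordSymm a x (fiberCoord a x p) = p := by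
  ext v
  change p (tangentCoordChange (𝓡 n) a x x (tangentCoordChange (𝓡 n) x a x v)) = p v
  rw [tangentCoordChange_comp, tangentCoordChange_self] <;> simp [hx]

theorem fiberCoordSymm_self (a : Q) (p : Base n →L[ℝ] ℝ) : fiberCoordSymm a a p = p := by
  ext v
  change p (tangentCoordChange (𝓡 n) a a a v) = p v
  rw [tangentCoordChange_self]
  simp

theorem darboux_mk {a x : Q} (hx : x ∈ (chartAt (Base n) a).source) (p : Base n →L[ℝ] ℝ) :
    darboux (n := n) a ⟨x, p⟩ = (extChartAt (𝓡 n) a x, fiberCoord a x p) :=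
  Prod.ext (darboux_apply_fst a _) (ContinuousLinearMap.ext fun v => darboux_apply_snd hx v)

theorem extChartAt_symm_mem_source {Q : Type*} [TopologicalSpace Q] [ChartedSpace (Base n) Q]
    {a : Q} {q : Base n} (hq : q ∈ (extChartAt (𝓡 n) a).target) :
    (extChartAt (𝓡 n) a).symm q ∈ (chartAt (Base n) a).source := by
  have := (extChartAt (𝓡 n) a).map_target hq
  rwa [extChartAt_source] at this

theorem darboux_symm_mk {a : Q} {q : Base n} (hq : q ∈ (extChartAt (𝓡 n) a).target)
    (p : Base n →L[ℝ] ℝ) :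
    (darboux (n := n) a).symm (q, p)
      = ⟨(extChartAt (𝓡 n) a).symm q, fiberCoordSymm a ((extChartAt (𝓡 n) a).symm q) p⟩ := by
  have hx := extChartAt_symm_mem_source hq
  have h := darboux_mk hx (fiberCoordSymm a ((extChartAt (𝓡 n) a).symm q) p)
  rw [fiberCoord_fiberCoordSymm hx, (extChartAt (𝓡 n) a).right_inv hq] at h
  rw [← h]
  exact (darboux (n := n) a).left_inv (mem_darboux_source.2 hx)

theorem apply_mk_eq_localFun (F : Cotangent n Q → ℝ) (q : Q) (p : Base n →L[ℝ] ℝ) :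
    F ⟨q, p⟩ = localFun q F (extChartAt (𝓡 n) q q, p) := by
  rw [localFun, darboux_symm_mk (mem_extChartAt_target q), extChartAt_to_inv, fiberCoordSymm_self]

/-- `h` scales with the `k`-th power of the momentum. -/
def IsFiberHomogeneous (k : ℕ) (h : Cotangent n Q → ℝ) : Prop :=
  ∀ (q : Q) (c : ℝ) (p : Base n →L[ℝ] ℝ), h ⟨q, c • p⟩ = c ^ k * h ⟨q, p⟩

theorem isFiberHomogeneous_of_mem {k : ℕ} {h : Cotangent n Q → ℝ}
    (hh : h ∈ homogeneousFunctions n Q k) : IsFiberHomogeneous k h := by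
  intro q c p
  obtain ⟨T, hT⟩ := hh.2 q
  rw [hT, hT]
  have := T.map_smul_univ (fun _ => c) (fun _ => p)
  simpa using this

theorem IsFiberHomogeneous.localFun {k : ℕ} {h : Cotangent n Q → ℝ} (hh : IsFiberHomogeneous k h)
    {a : Q} {q : Base n} (hq : q ∈ (extChartAt (𝓡 n) a).target) (c : ℝ) (p : Base n →L[ℝ] ℝ) :
    localFun a h (q, c • p) = c ^ k * localFun a h (q, p) := by
  rw [_root_.localFun, _root_.localFun, darboux_symm_mk hq, darboux_symm_mk hq, map_smul]
  exact hh _ _ _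

/-- Smooth functions that are homogeneous of degree `k` in a vector are polynomials: Euler's
theorem identifies them with their `k`-th Taylor term at `0`. -/
theorem exists_multilinear_of_homogeneous {E : Type*} [NormedAddCommGroup E] [NormedSpace ℝ E]
    {g : E → ℝ} (hg : ContDiff ℝ ∞ g) {k : ℕ} (hk : ∀ (c : ℝ) (p : E), g (c • p) = c ^ k * g p) :
    ∃ T : MultilinearMap ℝ (fun _ : Fin k => E) ℝ, ∀ p : E, g p = T fun _ => p := by
  refine ⟨((k.factorial : ℝ)⁻¹ • iteratedFDeriv ℝ k g 0).toMultilinearMap, fun p => ?_⟩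
  have h1 : iteratedDeriv k (fun c : ℝ => g (c • p)) 0 = k.factorial * g p := by
    simp only [hk]
    have h2 : iteratedDeriv k (fun c : ℝ => c ^ k * g p) 0
        = iteratedDeriv k (fun c : ℝ => c ^ k) 0 * g p := by
      rw [show (fun c : ℝ => c ^ k * g p) = g p • fun c : ℝ => c ^ k by
        ext c; simp [mul_comm], iteratedDeriv_const_smul_field, smul_eq_mul, mul_comm]
    have h3 : ∏ i ∈ Finset.range k, ((k : ℝ) - i) = k.factorial := by
      rw [← Nat.descFactorial_self, Nat.descFactorial_eq_prod_range, Nat.cast_prod]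
      exact Finset.prod_congr rfl fun i hi =>
        (Nat.cast_sub (Finset.mem_range.1 hi).le).symm
    rw [h2, iteratedDeriv_eq_iterate, iter_deriv_pow, Nat.sub_self, pow_zero, mul_one, h3]
  have h3 : iteratedDeriv k (fun c : ℝ => g (c • p)) 0 = iteratedFDeriv ℝ k g 0 fun _ => p := by
    have hkm : ((k : ℕ∞) : WithTop ℕ∞) ≤ ∞ := by exact_mod_cast le_top
    have h4 := ((ContinuousLinearMap.id ℝ ℝ).smulRight p).iteratedFDeriv_comp_right
      (f := g) hg (0 : ℝ) (i := k) hkm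
    rw [iteratedDeriv_eq_iteratedFDeriv]
    change iteratedFDeriv ℝ k (g ∘ ((ContinuousLinearMap.id ℝ ℝ).smulRight p)) 0 _ = _
    rw [h4]
    simp [ContinuousMultilinearMap.compContinuousLinearMap_apply]
  have h5 : (k.factorial : ℝ) ≠ 0 := by positivity
  change g p = (k.factorial : ℝ)⁻¹ • iteratedFDeriv ℝ k g 0 fun _ => p
  rw [← h3, h1, smul_eq_mul, inv_mul_cancel_left₀ h5]

theorem mem_homogeneousFunctions_iff {k : ℕ} {h : Cotangent n Q → ℝ} :
    h ∈ homogeneousFunctions n Q k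
      ↔ ContMDiff (phaseModel n) 𝓘(ℝ, ℝ) ∞ h ∧ IsFiberHomogeneous k h := by
  refine ⟨fun hh => ⟨hh.1, isFiberHomogeneous_of_mem hh⟩, fun hh => ⟨hh.1, fun q => ?_⟩⟩
  refine exists_multilinear_of_homogeneous (g := fun p : Base n →L[ℝ] ℝ => h ⟨q, p⟩) ?_
    fun c p => hh.2 q c p
  have hq := mem_extChartAt_target (I := 𝓡 n) q
  have h1 : (fun p : Base n →L[ℝ] ℝ => h ⟨q, p⟩)
      = fun p => localFun q h (extChartAt (𝓡 n) q q, p) := funext (apply_mk_eq_localFun h q)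
  rw [h1, ← contDiffOn_univ]
  exact (contDiffOn_localFun hh.1 q).comp (by fun_prop) fun p _ => mem_darboux_target hq p

theorem zero_mem_homogeneousFunctions (k : ℕ) :
    (0 : Cotangent n Q → ℝ) ∈ homogeneousFunctions n Q k :=
  mem_homogeneousFunctions_iff.2 ⟨contMDiff_const, fun _ _ _ => by simp⟩

theorem comp_proj_mem_homogeneousFunctions {f : Q → ℝ} (hf : ContMDiff (𝓡 n) 𝓘(ℝ, ℝ) ∞ f) :
    (fun x : Cotangent n Q => f x.proj) ∈ homogeneousFunctions n Q 0 :=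
  mem_homogeneousFunctions_iff.2
    ⟨hf.comp (Bundle.contMDiff_proj _), fun q c p => by simp⟩

theorem fderiv_of_homogeneous {F : Phase n → ℝ} {V : Set (Base n)} (hV : IsOpen V)
    (hF : ContDiffOn ℝ ∞ F (V ×ˢ univ)) {k : ℕ}
    (hk : ∀ q ∈ V, ∀ (c : ℝ) (p : Base n →L[ℝ] ℝ), F (q, c • p) = c ^ k * F (q, p))
    {q : Base n} (hq : q ∈ V) (c : ℝ) (p : Base n →L[ℝ] ℝ) (u : Base n) (w : Base n →L[ℝ] ℝ) :
    fderiv ℝ F (q, c • p) (u, c • w) = c ^ k * fderiv ℝ F (q, p) (u, w) := by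
  have hs := isOpen_prod_univ (Y := Base n →L[ℝ] ℝ) hV
  have hd : ∀ r : Base n →L[ℝ] ℝ, DifferentiableAt ℝ F (q, r) := fun r =>
    (hF.contDiffAt (hs.mem_nhds (mem_prod_univ hq r))).differentiableAt (by simp)
  have h1 : HasFDerivAt (fun z => F (dilation _ _ c z))
      ((fderiv ℝ F (q, c • p)).comp (dilation (Base n) (Base n →L[ℝ] ℝ) c)) (q, p) :=
    HasFDerivAt.comp (q, p) (hd (c • p)).hasFDerivAt
      (dilation (Base n) (Base n →L[ℝ] ℝ) c).hasFDerivAt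
  have h2 : HasFDerivAt (fun z => F (dilation _ _ c z)) (c ^ k • fderiv ℝ F (q, p)) (q, p) := by
    refine ((hd p).hasFDerivAt.const_smul (c ^ k)).congr_of_eventuallyEq ?_
    filter_upwards [hs.mem_nhds (mem_prod_univ hq p)] with z hz
    exact hk _ hz.1 _ _
  have h3 := congrArg (fun L : Phase n →L[ℝ] ℝ => L (u, w)) (h1.unique h2)
  simpa [dilation_apply] using h3

/-- The Poisson bracket of functions of degrees `k` and `j` has degree `k + j - 1`; in this form
the statement includes that it vanishes for `k = j = 0`. -/
theorem smul_fieldDeriv {f g : Cotangent n Q → ℝ} {k j : ℕ} (hf : f ∈ homogeneousFunctions n Q k)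
    (hg : g ∈ homogeneousFunctions n Q j) {X : VField n Q} (hX : IsHamiltonianField f X)
    (q : Q) (c : ℝ) (p : Base n →L[ℝ] ℝ) :
    c * fieldDeriv X g ⟨q, c • p⟩ = c ^ (k + j) * fieldDeriv X g ⟨q, p⟩ := by
  have hq := mem_extChartAt_target (I := 𝓡 n) q
  have hV := isOpen_extChartAt_target (I := 𝓡 n) q
  have e := apply_mk_eq_localFun (fieldDeriv X g) q
  set q' := extChartAt (𝓡 n) q q
  have hF := contDiffOn_localFun hf.1 q
  have hG := contDiffOn_localFun hg.1 q
  rw [darboux_target] at hF hG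
  have sF := fderiv_of_homogeneous hV hF (fun r hr c p =>
    (isFiberHomogeneous_of_mem hf).localFun hr c p) hq
  have sG := fderiv_of_homogeneous hV hG (fun r hr c p =>
    (isFiberHomogeneous_of_mem hg).localFun hr c p) hq
  rw [e, e, localFun_fieldDeriv hf.1 hg.1 hX (mem_darboux_target hq _),
    localFun_fieldDeriv hf.1 hg.1 hX (mem_darboux_target hq _), apply_poissonMap, apply_poissonMap,
    Finset.mul_sum, Finset.mul_sum]
  refine Finset.sum_congr rfl fun l _ => ?_
  have s1 := sF c p 0 (dirP l)
  have s2 := sF c p (dirQ l) 0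
  have s3 := sG c p 0 (dirP l)
  have s4 := sG c p (dirQ l) 0
  have ec : ((0 : Base n), c • (dirP l : Base n →L[ℝ] ℝ)) = c • ((0 : Base n), dirP l) := by simp
  rw [ec, map_smul, smul_eq_mul] at s1 s3
  rw [smul_zero] at s2 s4
  rw [s2, s4, pow_add]
  linear_combination (c ^ j * fderiv ℝ (localFun q g) (q', p) (dirQ l, 0)) * s1
    - (c ^ k * fderiv ℝ (localFun q f) (q', p) (dirQ l, 0)) * s3

theorem continuous_fiber {g : Cotangent n Q → ℝ} (hg : ContMDiff (phaseModel n) 𝓘(ℝ, ℝ) ∞ g)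
    (q : Q) : Continuous fun p : Base n →L[ℝ] ℝ => g ⟨q, p⟩ := by
  have hq := mem_extChartAt_target (I := 𝓡 n) q
  have h1 : (fun p : Base n →L[ℝ] ℝ => g ⟨q, p⟩)
      = fun p => localFun q g (extChartAt (𝓡 n) q q, p) := funext (apply_mk_eq_localFun g q)
  rw [h1]
  exact (contDiffOn_localFun hg q).continuousOn.comp_continuous (by fun_prop)
    fun p => mem_darboux_target hq p

theorem fieldDeriv_mem {f g : Cotangent n Q → ℝ} {k j m : ℕ} (hf : f ∈ homogeneousFunctions n Q k)
    (hg : g ∈ homogeneousFunctions n Q j) {X : VField n Q} (hX : IsHamiltonianField f X)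
    (hm : k + j = m + 1) : fieldDeriv X g ∈ homogeneousFunctions n Q m := by
  have hs := contMDiff_fieldDeriv hf.1 hg.1 hX
  refine mem_homogeneousFunctions_iff.2 ⟨hs, fun q c p => ?_⟩
  -- cancel one factor `c ≠ 0`, and reach `c = 0` by continuity
  have h1 : Continuous fun c : ℝ => fieldDeriv X g ⟨q, c • p⟩ :=
    (continuous_fiber hs q).comp (by fun_prop : Continuous fun c : ℝ => c • p)
  have h2 : Continuous fun c : ℝ => c ^ m * fieldDeriv X g ⟨q, p⟩ := by fun_prop
  have h3 : EqOn (fun c : ℝ => fieldDeriv X g ⟨q, c • p⟩)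
      (fun c : ℝ => c ^ m * fieldDeriv X g ⟨q, p⟩) {0}ᶜ := by
    intro c hc
    have := smul_fieldDeriv hf hg hX q c p
    rw [hm, pow_succ', mul_assoc] at this
    exact mul_left_cancel₀ hc this
  exact congrFun (Continuous.ext_on (dense_compl_singleton 0) h1 h2 h3) c

theorem fieldDeriv_eq_zero {f g : Cotangent n Q → ℝ} (hf : f ∈ homogeneousFunctions n Q 0)
    (hg : g ∈ homogeneousFunctions n Q 0) {X : VField n Q} (hX : IsHamiltonianField f X) :
    fieldDeriv X g = 0 := by
  ext x
  have := smul_fieldDeriv hf hg hX x.proj 0 x.2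
  simpa using this.symm

theorem isHamiltonianField_unique {f : Cotangent n Q → ℝ} {X Y : VField n Q}
    (hX : IsHamiltonianField f X) (hY : IsHamiltonianField f Y) : X = Y := by
  funext x
  change vecAt X x = vecAt Y x
  refine omega_left_injective fun v => ?_
  rw [isHamiltonianField_iff.1 hX, isHamiltonianField_iff.1 hY]

theorem isHamiltonianField_zero : IsHamiltonianField (0 : Cotangent n Q → ℝ) (0 : VField n Q) := by
  refine isHamiltonianField_of_eq contMDiff_const fun x => ?_
  have h : fderiv ℝ (fun _ : Phase n => (0 : ℝ)) (darboux (n := n) x.proj x) = 0 :=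
    congrFun (fderiv_fun_const _) _
  exact ((congrArg (poissonMap n) h).trans (map_zero _)).symm

theorem zero_mem_homogeneousFields (k : ℕ) : (0 : VField n Q) ∈ homogeneousFields n Q k :=
  ⟨0, zero_mem_homogeneousFunctions k, isHamiltonianField_zero⟩

theorem isHamiltonianField_neg {f : Cotangent n Q → ℝ}
    (hf : ContMDiff (phaseModel n) 𝓘(ℝ, ℝ) ∞ f) {X : VField n Q} (hX : IsHamiltonianField f X) :
    IsHamiltonianField (-f) (-X) := by
  have hs : ContMDiff (phaseModel n) 𝓘(ℝ, ℝ) ∞ (-f) := hf.neg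
  refine isHamiltonianField_of_eq hs fun x => ?_
  have ht := (darboux (n := n) x.proj).map_source (mem_darboux_proj_source x)
  have h1 : vecAt (-X) x = -vecAt X x := rfl
  have h2 : localFun x.proj (-f) = -localFun x.proj f := rfl
  rw [h1, h2, fderiv_neg, map_neg, ← localField_self, localField_eq_poissonMap hf hX ht]

theorem neg_mem_homogeneousFields {k : ℕ} {X : VField n Q} (hX : X ∈ homogeneousFields n Q k) :
    -X ∈ homogeneousFields n Q k := by
  obtain ⟨f, hf, hX⟩ := hX
  have hf' := mem_homogeneousFunctions_iff.1 hf
  exact ⟨-f, mem_homogeneousFunctions_iff.2 ⟨hf'.1.neg, fun q c p => by simp [hf'.2 q c p]⟩,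
    isHamiltonianField_neg hf.1 hX⟩

theorem mlieBracket_neg_left {X Y : VField n Q} {k j : ℕ} (hX : X ∈ homogeneousFields n Q k)
    (hY : Y ∈ homogeneousFields n Q j) :
    VectorField.mlieBracket (phaseModel n) (-X) Y
      = -VectorField.mlieBracket (phaseModel n) X Y := by
  obtain ⟨f, hf, hX⟩ := hX
  obtain ⟨g, hg, hY⟩ := hY
  have hf' : ContMDiff (phaseModel n) 𝓘(ℝ, ℝ) ∞ (-f) := hf.1.neg
  have h1 := isHamiltonianField_mlieBracket hf' hg.1 (isHamiltonianField_neg hf.1 hX) hY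
  have h2 : fieldDeriv (-X) g = -fieldDeriv X g :=
    funext fun x => map_neg (diffAt g x) (vecAt X x)
  rw [h2] at h1
  exact isHamiltonianField_unique h1 (isHamiltonianField_neg (contMDiff_fieldDeriv hf.1 hg.1 hX)
    (isHamiltonianField_mlieBracket hf.1 hg.1 hX hY))

theorem add_mem_homogeneousFields {k : ℕ} {X Y : VField n Q} (hX : X ∈ homogeneousFields n Q k)
    (hY : Y ∈ homogeneousFields n Q k) : X + Y ∈ homogeneousFields n Q k := by
  obtain ⟨f, hf, hX⟩ := hX
  obtain ⟨g, hg, hY⟩ := hY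
  have hf' := mem_homogeneousFunctions_iff.1 hf
  have hg' := mem_homogeneousFunctions_iff.1 hg
  have hs : ContMDiff (phaseModel n) 𝓘(ℝ, ℝ) ∞ (f + g) := hf'.1.add hg'.1
  refine ⟨f + g, mem_homogeneousFunctions_iff.2 ⟨hs, fun q c p => ?_⟩,
    isHamiltonianField_of_eq hs fun x => ?_⟩
  · simp [hf'.2 q c p, hg'.2 q c p, mul_add]
  · have ht := (darboux (n := n) x.proj).map_source (mem_darboux_proj_source x)
    have h1 : vecAt (X + Y) x = vecAt X x + vecAt Y x := rfl
    have h2 : localFun x.proj (f + g) = localFun x.proj f + localFun x.proj g := rfl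
    rw [h1, h2, fderiv_add ((contDiffAt_localFun hf.1 ht).differentiableAt (by simp))
      ((contDiffAt_localFun hg.1 ht).differentiableAt (by simp)), map_add, ← localField_self,
      ← localField_self Y, localField_eq_poissonMap hf.1 hX ht, localField_eq_poissonMap hg.1 hY ht]

theorem mlieBracket_mem {X Y : VField n Q} {k j m : ℕ} (hX : X ∈ homogeneousFields n Q k)
    (hY : Y ∈ homogeneousFields n Q j) (hm : k + j = m + 1) :
    VectorField.mlieBracket (phaseModel n) X Y ∈ homogeneousFields n Q m := by
  obtain ⟨f, hf, hX⟩ := hX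
  obtain ⟨g, hg, hY⟩ := hY
  exact ⟨fieldDeriv X g, fieldDeriv_mem hf hg hX hm,
    isHamiltonianField_mlieBracket hf.1 hg.1 hX hY⟩

theorem mlieBracket_eq_zero {X Y : VField n Q} (hX : X ∈ homogeneousFields n Q 0)
    (hY : Y ∈ homogeneousFields n Q 0) :
    VectorField.mlieBracket (phaseModel n) X Y = 0 := by
  obtain ⟨f, hf, hX⟩ := hX
  obtain ⟨g, hg, hY⟩ := hY
  have h := isHamiltonianField_mlieBracket hf.1 hg.1 hX hY
  rw [fieldDeriv_eq_zero hf hg hX] at h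
  exact isHamiltonianField_unique h isHamiltonianField_zero

end Homogeneous

/-! ### Regular functions and forms on the cotangent bundle -/

section Chart

theorem TemperedOn.smul_rapid {E₁ E₂ F : Type*} [NormedAddCommGroup E₁] [NormedSpace ℝ E₁]
    [NormedAddCommGroup E₂] [NormedSpace ℝ E₂] [NormedAddCommGroup F] [NormedSpace ℝ F] {V : Set E₁}
    {f : E₁ × E₂ → ℝ} {g : E₁ × E₂ → F} (hV : IsOpen V)
    (hf : TemperedOn V f) (hg : RapidOn V g) : RapidOn V fun z => f z • g z :=
  hg.bilinear (ContinuousLinearMap.lsmul ℝ ℝ).flip hV hf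

variable {E₁ E₂ F : Type*} [NormedAddCommGroup E₁] [NormedSpace ℝ E₁] [NormedAddCommGroup E₂]
  [NormedSpace ℝ E₂] [NormedAddCommGroup F] [NormedSpace ℝ F]
  [FiniteDimensional ℝ E₁] [MeasurableSpace E₁] [BorelSpace E₁]
  [FiniteDimensional ℝ E₂] [MeasurableSpace E₂] [BorelSpace E₂] [FiniteDimensional ℝ F]
  {μ : Measure E₁} [μ.IsAddHaarMeasure] {ν : Measure E₂} [ν.IsAddHaarMeasure]
  {V K : Set E₁}

theorem RapidOn.integrableOn_of_support {f : E₁ × E₂ → F} (hV : IsOpen V) (hf : RapidOn V f)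
    (hK : IsCompact K) (hKV : K ⊆ V) (h0 : ∀ z : E₁ × E₂, z.1 ∈ V → z.1 ∉ K → f z = 0) :
    IntegrableOn f (V ×ˢ univ) (μ.prod ν) :=
  (hf.integrableOn hK hKV).of_forall_sdiff_eq_zero (hV.measurableSet.prod .univ)
    fun z hz => h0 z hz.1.1 fun h => hz.2 ⟨h, mem_univ _⟩

/-- The integral of a derivative vanishes. -/
theorem integral_fderiv_eq_zero_of_rapidOn {f : E₁ × E₂ → ℝ} (hV : IsOpen V) (hf : RapidOn V f)
    (hK : IsCompact K) (hKV : K ⊆ V) (h0 : ∀ z : E₁ × E₂, z.1 ∈ V → z.1 ∉ K → f z = 0)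
    (v : E₁ × E₂) : ∫ z in V ×ˢ univ, fderiv ℝ f z v ∂(μ.prod ν) = 0 := by
  have hs := isOpen_prod_univ (Y := E₂) hV
  -- extend `f` by zero to a smooth function on the whole space
  set g := (V ×ˢ (univ : Set E₂)).indicator f with hg
  have hin : ∀ z ∈ V ×ˢ (univ : Set E₂), g =ᶠ[𝓝 z] f := fun z hz => by
    filter_upwards [hs.mem_nhds hz] with w hw using indicator_of_mem hw f
  have hout : ∀ z : E₁ × E₂, z.1 ∉ K → g =ᶠ[𝓝 z] fun _ => 0 := fun z hz => by
    filter_upwards [(hK.isClosed.isOpen_compl.preimage continuous_fst).mem_nhds hz] with w hw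
    by_cases hwV : w.1 ∈ V
    · rw [hg, indicator_of_mem (show w ∈ V ×ˢ (univ : Set E₂) from ⟨hwV, mem_univ _⟩), h0 w hwV hw]
    · exact indicator_of_notMem (fun h => hwV h.1) f
  have hgd : Differentiable ℝ g := fun z => by
    by_cases hz : z.1 ∈ K
    · have hzV : z ∈ V ×ˢ (univ : Set E₂) := ⟨hKV hz, mem_univ _⟩
      exact ((hf.1.contDiffAt (hs.mem_nhds hzV)).differentiableAt (by simp)).congr_of_eventuallyEq
        (hin z hzV)
    · exact (differentiableAt_const (0 : ℝ)).congr_of_eventuallyEq (hout z hz)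
  have hgf : (fun z => fderiv ℝ g z v)
      = (V ×ˢ (univ : Set E₂)).indicator fun z => fderiv ℝ f z v := by
    ext z
    by_cases hz : z ∈ V ×ˢ (univ : Set E₂)
    · rw [indicator_of_mem hz, (hin z hz).fderiv_eq]
    · rw [indicator_of_notMem hz, (hout z fun h => hz ⟨hKV h, mem_univ _⟩).fderiv_eq]
      simp
  have hmeas : MeasurableSet (V ×ˢ (univ : Set E₂)) := hV.measurableSet.prod .univ
  have hf' : RapidOn V fun z => fderiv ℝ f z v :=
    (hf.fderiv hV).clm_comp (ContinuousLinearMap.apply ℝ ℝ v) hV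
  have h0' : ∀ z : E₁ × E₂, z.1 ∈ V → z.1 ∉ K → fderiv ℝ f z v = 0 := fun z hz hzK => by
    have h1 := (hin z ⟨hz, mem_univ _⟩).symm.trans (hout z hzK)
    rw [h1.fderiv_eq]
    simp
  have hgi : Integrable g (μ.prod ν) :=
    (integrable_indicator_iff hmeas).2 (hf.integrableOn_of_support hV hK hKV h0)
  have hgi' : Integrable (fun z => fderiv ℝ g z v) (μ.prod ν) := by
    rw [hgf]
    exact (integrable_indicator_iff hmeas).2 (hf'.integrableOn_of_support hV hK hKV h0')
  have h2 := integral_mul_fderiv_eq_neg_fderiv_mul_of_integrable (μ := μ.prod ν)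
    (f := fun _ : E₁ × E₂ => (1 : ℝ)) (g := g) (v := v) (by simp) (by simpa using hgi')
    (by simpa using hgi) (fun _ _ => differentiableAt_const _) fun z _ => hgd z
  simp only [one_mul, fderiv_fun_const, Pi.zero_apply, _root_.zero_apply, zero_mul,
    integral_zero, neg_zero] at h2
  rw [← integral_indicator hmeas, ← hgf, h2]

end Chart

section Regular

variable {n : ℕ} {Q : Type*} [TopologicalSpace Q] [ChartedSpace (Base n) Q]
  [IsManifold (𝓡 n) ∞ Q]

/-- The regularity of the functions that are integrated: smooth, supported over a compact subset
of `Q`, and rapidly decreasing in the momenta with all derivatives. -/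
def IsRegularFun (F : Cotangent n Q → ℝ) : Prop :=
  (∃ K : Set Q, IsCompact K ∧ ∀ x : Cotangent n Q, x.proj ∉ K → F x = 0) ∧
  ∀ a : Q, RapidOn (extChartAt (𝓡 n) a).target (localFun a F)

/-- Smooth functions with polynomial growth in the momenta. -/
def IsTemperedFun (h : Cotangent n Q → ℝ) : Prop :=
  ∀ a : Q, TemperedOn (extChartAt (𝓡 n) a).target (localFun a h)

theorem isRegular_iff_rapidOn {Pi : OneForm n Q} : IsRegular Pi ↔
    (∃ K : Set Q, IsCompact K ∧ ∀ x : Cotangent n Q, x.proj ∉ K → Pi x = 0) ∧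
      ∀ a : Q, RapidOn (extChartAt (𝓡 n) a).target (localForm a Pi) := by
  simp only [MomentumVlasov.IsRegular, RapidOn, darboux_target]

theorem isSmoothForm_of_isRegular {Pi : OneForm n Q} (h : IsRegular Pi) : IsSmoothForm Pi :=
  fun a => (h.2 a).1

theorem isTemperedFun_of_homogeneous {k : ℕ} {h : Cotangent n Q → ℝ}
    (hh : h ∈ homogeneousFunctions n Q k) : IsTemperedFun h := by
  intro a
  have h1 := contDiffOn_localFun hh.1 a
  rw [darboux_target] at h1
  exact temperedOn_of_homogeneous (isOpen_extChartAt_target a) h1 k fun q hq c p =>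
    (isFiberHomogeneous_of_mem hh).localFun hq c p

theorem IsRegularFun.tempered_mul {F h : Cotangent n Q → ℝ} (hF : IsRegularFun F)
    (hh : IsTemperedFun h) : IsRegularFun fun x => h x * F x := by
  obtain ⟨⟨K, hK, h0⟩, hF⟩ := hF
  exact ⟨⟨K, hK, fun x hx => by simp only [h0 x hx, mul_zero]⟩,
    fun a => (hh a).smul_rapid (isOpen_extChartAt_target a) (hF a)⟩

theorem isRegular_smulForm {Pi : OneForm n Q} {h : Cotangent n Q → ℝ} (hPi : IsRegular Pi)
    (hh : IsTemperedFun h) : IsRegular (smulForm h Pi) := by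
  obtain ⟨⟨K, hK, h0⟩, hPi⟩ := isRegular_iff_rapidOn.1 hPi
  refine isRegular_iff_rapidOn.2 ⟨⟨K, hK, fun x hx => ?_⟩,
    fun a => (hh a).smul_rapid (isOpen_extChartAt_target a) (hPi a)⟩
  have : covAt Pi x = 0 := h0 x hx
  change h x • covAt Pi x = 0
  rw [this, smul_zero]

theorem isRegular_smulForm_diffForm {k : ℕ} {F h : Cotangent n Q → ℝ} (hF : IsRegularFun F)
    (hh : h ∈ homogeneousFunctions n Q k) : IsRegular (smulForm F (diffForm h)) := by
  have ht := isTemperedFun_of_homogeneous hh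
  obtain ⟨⟨K, hK, h0⟩, hF⟩ := hF
  refine isRegular_iff_rapidOn.2 ⟨⟨K, hK, fun x hx => ?_⟩, fun a => ?_⟩
  · change F x • diffAt h x = 0
    rw [h0 x hx, zero_smul]
  · have hV := isOpen_extChartAt_target (I := 𝓡 n) a
    refine ((hF a).bilinear (ContinuousLinearMap.lsmul ℝ ℝ) hV ((ht a).fderiv hV)).congr hV
      fun z hz => ?_
    rw [localForm_smulForm, localForm_diffForm hh.1 (mem_darboux_target hz.1 z.2)]
    rfl

theorem isRegularFun_contraction {k : ℕ} {Pi : OneForm n Q} {X : VField n Q} (hPi : IsRegular Pi)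
    (hX : X ∈ homogeneousFields n Q k) : IsRegularFun (contraction Pi X) := by
  obtain ⟨h, hh, hX⟩ := hX
  have ht := isTemperedFun_of_homogeneous hh
  obtain ⟨⟨K, hK, h0⟩, hPi⟩ := isRegular_iff_rapidOn.1 hPi
  refine ⟨⟨K, hK, fun x hx => ?_⟩, fun a => ?_⟩
  · have : covAt Pi x = 0 := h0 x hx
    rw [contraction, this]
    rfl
  · have hV := isOpen_extChartAt_target (I := 𝓡 n) a
    refine ((hPi a).bilinear (ContinuousLinearMap.id ℝ _) hV
      (((ht a).fderiv hV).clm_comp (poissonMap n) hV)).congr hV fun z hz => ?_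
    have hz' := mem_darboux_target hz.1 z.2
    rw [localFun_contraction Pi X hz', localField_eq_poissonMap hh.1 hX hz']
    rfl

theorem rapidOn_sum {E₁ E₂ F ι : Type*} [NormedAddCommGroup E₁] [NormedSpace ℝ E₁]
    [NormedAddCommGroup E₂] [NormedSpace ℝ E₂] [NormedAddCommGroup F] [NormedSpace ℝ F]
    {V : Set E₁} (hV : IsOpen V) (s : Finset ι) {f : ι → E₁ × E₂ → F}
    (hf : ∀ i ∈ s, RapidOn V (f i)) : RapidOn V (fun z => ∑ i ∈ s, f i z) := by
  classical
  induction s using Finset.induction_on with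
  | empty =>
    refine ⟨contDiffOn_const, fun K _ _ m N => ⟨0, fun a _ p => ?_⟩⟩
    simp [iteratedFDeriv_fun_zero]
  | insert i s hi ih =>
    simp only [Finset.sum_insert hi]
    exact (hf i (Finset.mem_insert_self i s)).add hV
      (ih fun j hj => hf j (Finset.mem_insert_of_mem hj))

theorem rapidOn_divLocal {V : Set (Base n)} (hV : IsOpen V) {α : Phase n → Phase n →L[ℝ] ℝ}
    (hα : RapidOn V α) : RapidOn V (divLocal α) := by
  refine rapidOn_sum hV Finset.univ fun l _ => ?_
  exact (hα.fderiv hV).clm_comp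
    ((ContinuousLinearMap.apply ℝ ℝ ((0, dirP l) : Phase n)).comp
        (ContinuousLinearMap.apply ℝ (Phase n →L[ℝ] ℝ) ((dirQ l, 0) : Phase n))
      - (ContinuousLinearMap.apply ℝ ℝ ((dirQ l, 0) : Phase n)).comp
        (ContinuousLinearMap.apply ℝ (Phase n →L[ℝ] ℝ) ((0, dirP l) : Phase n))) hV

theorem localFun_divSharp {Pi : OneForm n Q} (hPi : IsSmoothForm Pi) {a : Q} {y : Phase n}
    (hy : y ∈ (darboux (n := n) a).target) :
    localFun a (divSharp Pi) y = divLocal (localForm a Pi) y := by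
  rw [localFun, divSharp_eq hPi ((darboux (n := n) a).map_target hy),
    (darboux (n := n) a).right_inv hy]

theorem localForm_eventuallyEq_zero [T2Space Q] {Pi : OneForm n Q} {K : Set Q} (hK : IsCompact K)
    (h0 : ∀ x : Cotangent n Q, x.proj ∉ K → Pi x = 0) {a : Q} {y : Phase n}
    (hy : y ∈ (darboux (n := n) a).target) (hyK : ((darboux (n := n) a).symm y).proj ∉ K) :
    localForm a Pi =ᶠ[𝓝 y] fun _ => 0 := by
  have hc : ContinuousAt (fun z => ((darboux (n := n) a).symm z).proj) y :=
    (FiberBundle.continuous_proj _ _).continuousAt.comp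
      ((contMDiffOn_darboux_symm a).continuousOn.continuousAt
        ((isOpen_darboux_target a).mem_nhds hy))
  filter_upwards [hc.preimage_mem_nhds (hK.isClosed.isOpen_compl.mem_nhds hyK)] with z hz
  have : covAt Pi ((darboux (n := n) a).symm z) = 0 := h0 _ hz
  refine ContinuousLinearMap.ext fun v => ?_
  rw [localForm_apply, this]
  rfl

theorem isRegularFun_divSharp [T2Space Q] {Pi : OneForm n Q} (hPi : IsRegular Pi) :
    IsRegularFun (divSharp Pi) := by
  have hs := isSmoothForm_of_isRegular hPi
  obtain ⟨⟨K, hK, h0⟩, hPi⟩ := isRegular_iff_rapidOn.1 hPi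
  refine ⟨⟨K, hK, fun x hx => ?_⟩, fun a => ?_⟩
  · have hxs := mem_darboux_proj_source x
    have ht := (darboux (n := n) x.proj).map_source hxs
    rw [divSharp_eq hs hxs, divLocal_congr (localForm_eventuallyEq_zero hK h0 ht
      (by rwa [(darboux (n := n) x.proj).left_inv hxs]))]
    simp [divLocal]
  · have hV := isOpen_extChartAt_target (I := 𝓡 n) a
    exact (rapidOn_divLocal hV (hPi a)).congr hV fun z hz =>
      localFun_divSharp hs (mem_darboux_target hz.1 z.2)

/-! ### Linearity of the divergence -/

theorem localForm_add (a : Q) (Pi Pi' : OneForm n Q) :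
    localForm a (Pi + Pi') = localForm a Pi + localForm a Pi' := rfl

theorem localForm_smul (a : Q) (c : ℝ) (Pi : OneForm n Q) :
    localForm a (c • Pi) = c • localForm a Pi := rfl

theorem isRegular_add {Pi Pi' : OneForm n Q} (h : IsRegular Pi) (h' : IsRegular Pi') :
    IsRegular (Pi + Pi') := by
  obtain ⟨⟨K, hK, h0⟩, h⟩ := isRegular_iff_rapidOn.1 h
  obtain ⟨⟨K', hK', h0'⟩, h'⟩ := isRegular_iff_rapidOn.1 h'
  refine isRegular_iff_rapidOn.2 ⟨⟨K ∪ K', hK.union hK', fun x hx => ?_⟩,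
    fun a => (h a).add (isOpen_extChartAt_target a) (h' a)⟩
  rw [mem_union, not_or] at hx
  change Pi x + Pi' x = 0
  rw [h0 x hx.1, h0' x hx.2, add_zero]

theorem isRegular_smul (c : ℝ) {Pi : OneForm n Q} (h : IsRegular Pi) : IsRegular (c • Pi) :=
  isRegular_smulForm h fun _ => temperedOn_const c

theorem isRegular_zero : IsRegular (0 : OneForm n Q) := by
  refine isRegular_iff_rapidOn.2 ⟨⟨∅, isCompact_empty, fun _ _ => rfl⟩, fun a => ?_⟩
  exact (rapidOn_sum (isOpen_extChartAt_target a) (∅ : Finset ℕ)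
    (f := fun _ => localForm a (0 : OneForm n Q)) (by simp)).congr (isOpen_extChartAt_target a)
      fun z _ => rfl

theorem isRegular_sum {ι : Type*} (s : Finset ι) {P : ι → OneForm n Q}
    (h : ∀ i ∈ s, IsRegular (P i)) : IsRegular (∑ i ∈ s, P i) :=
  Finset.sum_induction P IsRegular (fun _ _ => isRegular_add) isRegular_zero h

theorem divSharp_add {Pi Pi' : OneForm n Q} (h : IsRegular Pi) (h' : IsRegular Pi') :
    divSharp (Pi + Pi') = divSharp Pi + divSharp Pi' := by
  ext x
  have hxs := mem_darboux_proj_source x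
  have ht := (darboux (n := n) x.proj).map_source hxs
  have hs := isSmoothForm_of_isRegular h
  have hs' := isSmoothForm_of_isRegular h'
  change _ = divSharp Pi x + divSharp Pi' x
  rw [divSharp_eq hs hxs, divSharp_eq hs' hxs,
    divSharp_eq (isSmoothForm_of_isRegular (isRegular_add h h')) hxs, localForm_add]
  simp only [divLocal]
  rw [fderiv_add (hs.differentiableAt ht) (hs'.differentiableAt ht), ← Finset.sum_add_distrib]
  refine Finset.sum_congr rfl fun l _ => ?_
  simp only [_root_.add_apply]
  ring

theorem divSharp_smul (c : ℝ) {Pi : OneForm n Q} (h : IsRegular Pi) :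
    divSharp (c • Pi) = c • divSharp Pi := by
  ext x
  have hxs := mem_darboux_proj_source x
  have ht := (darboux (n := n) x.proj).map_source hxs
  have hs := isSmoothForm_of_isRegular h
  change _ = c • divSharp Pi x
  rw [divSharp_eq hs hxs,
    divSharp_eq (isSmoothForm_of_isRegular (isRegular_smul c h)) hxs, localForm_smul]
  simp only [divLocal]
  rw [fderiv_const_smul (hs.differentiableAt ht), smul_eq_mul, Finset.mul_sum]
  refine Finset.sum_congr rfl fun l _ => ?_
  simp only [_root_.smul_apply, smul_eq_mul]
  ring

theorem divSharp_zero : divSharp (0 : OneForm n Q) = 0 := by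
  have := divSharp_smul 0 (isRegular_zero (n := n) (Q := Q))
  rwa [zero_smul, zero_smul] at this

theorem divSharp_sum {ι : Type*} (s : Finset ι) {P : ι → OneForm n Q}
    (h : ∀ i ∈ s, IsRegular (P i)) : divSharp (∑ i ∈ s, P i) = ∑ i ∈ s, divSharp (P i) := by
  classical
  induction s using Finset.induction_on with
  | empty => exact divSharp_zero
  | insert i s hi ih =>
    have hs := fun j hj => h j (Finset.mem_insert_of_mem hj)
    rw [Finset.sum_insert hi, Finset.sum_insert hi, ← ih hs,
      divSharp_add (h i (Finset.mem_insert_self i s)) (isRegular_sum s hs)]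

end Regular

/-! ### Integrals of regular functions -/

section Partition

variable {n : ℕ} {Q : Type*} [TopologicalSpace Q] [T2Space Q] [SecondCountableTopology Q]
  [ChartedSpace (Base n) Q] [IsManifold (𝓡 n) ∞ Q]

/-- Finitely many smooth functions, supported in charts, that sum to `1` on a compact set. -/
theorem exists_partition {K : Set Q} (hK : IsCompact K) :
    ∃ (s : Finset Q) (ρ : Q → Q → ℝ), (∀ i, ContMDiff (𝓡 n) 𝓘(ℝ, ℝ) ∞ (ρ i)) ∧
      (∀ i, tsupport (ρ i) ⊆ (chartAt (Base n) i).source) ∧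
      ∀ x ∈ K, ∑ i ∈ s, ρ i x = 1 := by
  have : LocallyCompactSpace Q := ChartedSpace.locallyCompactSpace (Base n) Q
  obtain ⟨f, hf⟩ := SmoothPartitionOfUnity.exists_isSubordinate_chartAt_source (𝓡 n) Q
  have hfin := f.locallyFinite.finite_nonempty_inter_compact hK
  refine ⟨hfin.toFinset, fun i => f i, fun i => (f i).contMDiff, fun i => hf i, fun x hx => ?_⟩
  rw [← f.sum_eq_one (mem_univ x)]
  refine (finsum_eq_sum_of_support_subset _ fun i hi => ?_).symm
  simp only [Finite.coe_toFinset, mem_ofPred_eq]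
  exact ⟨x, hi, hx⟩

end Partition

section Integrals

variable {n : ℕ} {Q : Type*} [TopologicalSpace Q] [ChartedSpace (Base n) Q]
  [IsManifold (𝓡 n) ∞ Q]

/-- `F` is supported over a compact subset of the domain of the chart at `a`. -/
def IsSupportedInChart (a : Q) (F : Cotangent n Q → ℝ) : Prop :=
  ∃ K : Set Q, IsCompact K ∧ K ⊆ (chartAt (Base n) a).source ∧
    ∀ x : Cotangent n Q, x.proj ∉ K → F x = 0

theorem IsSupportedInChart.eq_zero {a : Q} {F : Cotangent n Q → ℝ} (h : IsSupportedInChart a F)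
    (x : Cotangent n Q) (hx : x ∉ (darboux (n := n) a).source) : F x = 0 := by
  obtain ⟨K, -, hKs, h0⟩ := h
  exact h0 x fun hxK => hx (mem_darboux_source.2 (hKs hxK))

theorem IsSupportedInChart.exists_compact {a : Q} {F : Cotangent n Q → ℝ}
    (h : IsSupportedInChart a F) :
    ∃ K : Set (Base n), IsCompact K ∧ K ⊆ (extChartAt (𝓡 n) a).target ∧
      ∀ y : Phase n, y.1 ∈ (extChartAt (𝓡 n) a).target → y.1 ∉ K → localFun a F y = 0 := by
  obtain ⟨K, hK, hKs, h0⟩ := h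
  rw [← extChartAt_source (I := 𝓡 n)] at hKs
  refine ⟨extChartAt (𝓡 n) a '' K, hK.image_of_continuousOn ((continuousOn_extChartAt a).mono hKs),
    ((extChartAt (𝓡 n) a).mapsTo.mono_left hKs).image_subset, fun y hy hyK => h0 _ fun hmem => ?_⟩
  rw [darboux_symm_proj (by rw [darboux_target]; exact ⟨hy, mem_univ _⟩)] at hmem
  exact hyK ⟨_, hmem, (extChartAt (𝓡 n) a).right_inv hy⟩

theorem IsRegularFun.continuousOn_localFun {F : Cotangent n Q → ℝ} (hF : IsRegularFun F) (a : Q) :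
    ContinuousOn (localFun a F) (darboux (n := n) a).target := by
  rw [darboux_target]
  exact (hF.2 a).1.continuousOn

theorem IsRegularFun.integrableOn_localFun {F : Cotangent n Q → ℝ} (hF : IsRegularFun F) {a : Q}
    (h : IsSupportedInChart a F) :
    IntegrableOn (localFun a F) ((extChartAt (𝓡 n) a).target ×ˢ univ) (phaseVolume n) := by
  obtain ⟨K, hK, hKt, h0⟩ := h.exists_compact
  exact (hF.2 a).integrableOn_of_support (isOpen_extChartAt_target a) hK hKt h0

theorem IsRegularFun.integrable_of_supported {F : Cotangent n Q → ℝ} (hF : IsRegularFun F) {a : Q}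
    (h : IsSupportedInChart a F) : Integrable F (symplecticVolume n Q) := by
  refine integrable_of_chart (hF.continuousOn_localFun a) h.eq_zero ?_
  rw [darboux_target]
  exact hF.integrableOn_localFun h

theorem IsRegularFun.integral_eq {F : Cotangent n Q → ℝ} (hF : IsRegularFun F) {a : Q}
    (h : IsSupportedInChart a F) : ∫ x, F x ∂symplecticVolume n Q
      = ∫ y in (extChartAt (𝓡 n) a).target ×ˢ univ, localFun a F y ∂phaseVolume n := by
  rw [integral_eq_chart_integral (hF.continuousOn_localFun a) h.eq_zero, darboux_target]

/-- A linear change of the fibre coordinates only rescales the fibre integrals. -/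
theorem integral_comp_fiberCoordSymm {a x : Q} (hx : x ∈ (chartAt (Base n) a).source)
    (g : (Base n →L[ℝ] ℝ) → ℝ) (hg : ∫ p, g p ∂momentumVolume n = 0) :
    ∫ p, g (fiberCoordSymm a x p) ∂momentumVolume n = 0 := by
  let T : (Base n →L[ℝ] ℝ) ≃L[ℝ] (Base n →L[ℝ] ℝ) :=
    ContinuousLinearEquiv.equivOfInverse (fiberCoordSymm a x) (fiberCoord a x)
      (fiberCoord_fiberCoordSymm hx) (fiberCoordSymm_fiberCoord hx)
  have h1 : ∫ p, g (fiberCoordSymm a x p) ∂momentumVolume n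
      = ∫ p, g p ∂(Measure.map T (momentumVolume n)) :=
    (T.toHomeomorph.measurableEmbedding.integral_map g).symm
  have h2 := Measure.map_linearMap_addHaar_eq_smul_addHaar (momentumVolume n)
    (f := (T : (Base n →L[ℝ] ℝ) →ₗ[ℝ] (Base n →L[ℝ] ℝ)))
    (LinearEquiv.isUnit_det' T.toLinearEquiv).ne_zero
  have h3 : Measure.map T (momentumVolume n) = _ := h2
  rw [h1, h3, integral_smul_measure, hg, smul_zero]

theorem isSupportedInChart_mul {F : Cotangent n Q → ℝ} (hF : IsRegularFun F) {a : Q} {ρ : Q → ℝ}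
    (hρ : tsupport ρ ⊆ (chartAt (Base n) a).source) :
    IsSupportedInChart a fun x => ρ x.proj * F x := by
  obtain ⟨K, hK, h0⟩ := hF.1
  refine ⟨K ∩ tsupport ρ, hK.inter_right (isClosed_tsupport ρ), inter_subset_right.trans hρ,
    fun x hx => ?_⟩
  by_cases hxK : x.proj ∈ K
  · have : x.proj ∉ tsupport ρ := fun h => hx ⟨hxK, h⟩
    simp only [image_eq_zero_of_notMem_tsupport this, zero_mul]
  · simp only [h0 x hxK, mul_zero]

variable [T2Space Q] [SecondCountableTopology Q]

/-- A regular function is a finite sum of regular functions supported in charts, each the product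
of the function with a smooth function on `Q`. -/
theorem IsRegularFun.exists_sum {F : Cotangent n Q → ℝ} (hF : IsRegularFun F) :
    ∃ (s : Finset Q) (ρ : Q → Q → ℝ),
      (∀ i, IsRegularFun fun x : Cotangent n Q => ρ i x.proj * F x) ∧
      (∀ i, IsSupportedInChart i fun x : Cotangent n Q => ρ i x.proj * F x) ∧
      ∀ x, F x = ∑ i ∈ s, ρ i x.proj * F x := by
  obtain ⟨K, hK, h0⟩ := hF.1
  obtain ⟨s, ρ, hs, hsupp, h1⟩ := exists_partition (n := n) hK
  refine ⟨s, ρ, fun i => hF.tempered_mul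
    (isTemperedFun_of_homogeneous (comp_proj_mem_homogeneousFunctions (hs i))),
    fun i => isSupportedInChart_mul hF (hsupp i), fun x => ?_⟩
  rw [← Finset.sum_mul]
  by_cases hx : x.proj ∈ K
  · rw [h1 _ hx, one_mul]
  · rw [h0 x hx, mul_zero]

theorem IsRegularFun.integrable {F : Cotangent n Q → ℝ} (hF : IsRegularFun F) :
    Integrable F (symplecticVolume n Q) := by
  obtain ⟨s, ρ, hr, hsupp, hsum⟩ := hF.exists_sum
  rw [funext hsum]
  exact integrable_finsetSum s fun i _ => (hr i).integrable_of_supported (hsupp i)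

/-- A regular function whose fibre integrals vanish has integral zero. -/
theorem IsRegularFun.integral_eq_zero_of_fiber {F : Cotangent n Q → ℝ} (hF : IsRegularFun F)
    (h : ∀ q : Q, ∫ p : Base n →L[ℝ] ℝ, F ⟨q, p⟩ ∂momentumVolume n = 0) :
    ∫ x, F x ∂symplecticVolume n Q = 0 := by
  obtain ⟨s, ρ, hr, hsupp, hsum⟩ := hF.exists_sum
  rw [integral_congr_ae (Eventually.of_forall hsum),
    integral_finsetSum s fun i _ => (hr i).integrable]
  refine Finset.sum_eq_zero fun a _ => ?_
  rw [(hr a).integral_eq (hsupp a), phaseVolume,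
    setIntegral_prod _ ((hr a).integrableOn_localFun (hsupp a))]
  refine setIntegral_eq_zero_of_forall_eq_zero fun q hq => ?_
  rw [setIntegral_univ]
  have h1 : ∀ p : Base n →L[ℝ] ℝ, localFun a (fun x : Cotangent n Q => ρ a x.proj * F x) (q, p)
      = ρ a ((extChartAt (𝓡 n) a).symm q) * F ⟨(extChartAt (𝓡 n) a).symm q,
          fiberCoordSymm a ((extChartAt (𝓡 n) a).symm q) p⟩ := fun p => by
    rw [localFun, darboux_symm_mk hq]
  simp only [h1]
  rw [integral_const_mul, integral_comp_fiberCoordSymm (extChartAt_symm_mem_source hq)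
    (fun p => F ⟨(extChartAt (𝓡 n) a).symm q, p⟩) (h _), mul_zero]

/-- The divergence theorem. -/
theorem integral_divSharp {Pi : OneForm n Q} (hPi : MomentumVlasov.IsRegular Pi) :
    ∫ x, divSharp Pi x ∂symplecticVolume n Q = 0 := by
  obtain ⟨⟨K, hK, h0⟩, -⟩ := isRegular_iff_rapidOn.1 hPi
  obtain ⟨s, ρ, hs, hsupp, h1⟩ := exists_partition (n := n) hK
  set P : Q → OneForm n Q := fun i => smulForm (fun x : Cotangent n Q => ρ i x.proj) Pi with hP
  have hPr : ∀ i, MomentumVlasov.IsRegular (P i) := fun i => isRegular_smulForm hPi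
    (isTemperedFun_of_homogeneous (comp_proj_mem_homogeneousFunctions (hs i)))
  have hsum : Pi = ∑ i ∈ s, P i := by
    funext x
    have e : (∑ i ∈ s, P i) x = ∑ i ∈ s, P i x := Finset.sum_apply x s P
    have e' : ∑ i ∈ s, P i x = ∑ i ∈ s, ρ i x.proj • covAt Pi x := rfl
    rw [e, e', ← Finset.sum_smul]
    by_cases hx : x.proj ∈ K
    · rw [h1 _ hx, one_smul]
      rfl
    · have : covAt Pi x = 0 := h0 x hx
      rw [this, smul_zero]
      exact this
  rw [hsum, divSharp_sum s fun i _ => hPr i]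
  have hd : ∀ i, IsRegularFun (divSharp (P i)) := fun i => isRegularFun_divSharp (hPr i)
  have e2 : ∀ x, (∑ i ∈ s, divSharp (P i)) x = ∑ i ∈ s, divSharp (P i) x := fun x =>
    Finset.sum_apply x s _
  simp only [e2]
  rw [integral_finsetSum s fun i _ => (hd i).integrable]
  refine Finset.sum_eq_zero fun a _ => ?_
  -- `P a` is supported over a compact subset of the chart domain
  have hKc : IsCompact (K ∩ tsupport (ρ a)) := hK.inter_right (isClosed_tsupport _)
  have hz : ∀ x : Cotangent n Q, x.proj ∉ K ∩ tsupport (ρ a) → P a x = 0 := fun x hx => by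
    change ρ a x.proj • covAt Pi x = 0
    by_cases hxK : x.proj ∈ K
    · rw [image_eq_zero_of_notMem_tsupport fun h => hx ⟨hxK, h⟩, zero_smul]
    · have : covAt Pi x = 0 := h0 x hxK
      rw [this, smul_zero]
  have hsm := isSmoothForm_of_isRegular (hPr a)
  have hV := isOpen_extChartAt_target (I := 𝓡 n) a
  have hsupp' : IsSupportedInChart a (divSharp (P a)) := by
    refine ⟨_, hKc, inter_subset_right.trans (hsupp a), fun x hx => ?_⟩
    have hxs := mem_darboux_proj_source x
    rw [divSharp_eq hsm hxs, divLocal_congr (localForm_eventuallyEq_zero hKc hz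
      ((darboux (n := n) x.proj).map_source hxs)
      (by rwa [(darboux (n := n) x.proj).left_inv hxs]))]
    simp [divLocal]
  rw [(hd a).integral_eq hsupp']
  have e3 : ∀ y ∈ (extChartAt (𝓡 n) a).target ×ˢ (univ : Set (Base n →L[ℝ] ℝ)),
      localFun a (divSharp (P a)) y = divLocal (localForm a (P a)) y := fun y hy =>
    localFun_divSharp hsm (mem_darboux_target hy.1 y.2)
  rw [setIntegral_congr_fun (hV.measurableSet.prod .univ) e3]
  have hr := (isRegular_iff_rapidOn.1 (hPr a)).2 a
  -- the components of `P a` in the chart, and their derivatives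
  set C := extChartAt (𝓡 n) a '' (K ∩ tsupport (ρ a))
  have hsub : K ∩ tsupport (ρ a) ⊆ (extChartAt (𝓡 n) a).source := by
    rw [extChartAt_source]
    exact inter_subset_right.trans (hsupp a)
  have hC : IsCompact C := hKc.image_of_continuousOn ((continuousOn_extChartAt a).mono hsub)
  have hCV : C ⊆ (extChartAt (𝓡 n) a).target :=
    ((extChartAt (𝓡 n) a).mapsTo.mono_left hsub).image_subset
  have hzero : ∀ z : Phase n, z.1 ∈ (extChartAt (𝓡 n) a).target → z.1 ∉ C →
      localForm a (P a) =ᶠ[𝓝 z] fun _ => 0 := fun z hz1 hz2 => by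
    have ht := mem_darboux_target hz1 z.2
    refine localForm_eventuallyEq_zero hKc hz ht fun hmem => ?_
    rw [darboux_symm_proj ht] at hmem
    exact hz2 ⟨_, hmem, (extChartAt (𝓡 n) a).right_inv hz1⟩
  have hcomp : ∀ u v : Phase n,
      ∫ y in (extChartAt (𝓡 n) a).target ×ˢ univ, fderiv ℝ (localForm a (P a)) y u v
        ∂phaseVolume n = 0 ∧
      IntegrableOn (fun y => fderiv ℝ (localForm a (P a)) y u v)
        ((extChartAt (𝓡 n) a).target ×ˢ univ) (phaseVolume n) := by
    intro u v
    have hrv : RapidOn (extChartAt (𝓡 n) a).target fun y => localForm a (P a) y v :=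
      hr.clm_comp (ContinuousLinearMap.apply ℝ ℝ v) hV
    have hru : RapidOn (extChartAt (𝓡 n) a).target
        fun y => fderiv ℝ (localForm a (P a)) y u v :=
      ((hr.fderiv hV).clm_comp (ContinuousLinearMap.apply ℝ (Phase n →L[ℝ] ℝ) u) hV).clm_comp
        (ContinuousLinearMap.apply ℝ ℝ v) hV
    constructor
    · have := integral_fderiv_eq_zero_of_rapidOn (μ := volume) (ν := momentumVolume n) hV hrv hC hCV
        (fun z h1 h2 => by rw [(hzero z h1 h2).self_of_nhds]; rfl) u
      rw [← this]
      refine setIntegral_congr_fun (hV.measurableSet.prod .univ) fun y hy => ?_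
      exact (fderiv_apply_const (hsm.differentiableAt (mem_darboux_target hy.1 y.2)) u v).symm
    · refine hru.integrableOn_of_support hV hC hCV fun z h1 h2 => ?_
      rw [(hzero z h1 h2).fderiv_eq]
      simp
  simp only [divLocal]
  refine (integral_finsetSum _ fun l _ => (hcomp (dirQ l, 0) (0, dirP l)).2.sub
    (hcomp (0, dirP l) (dirQ l, 0)).2).trans (Finset.sum_eq_zero fun l _ => ?_)
  refine (integral_sub (hcomp (dirQ l, 0) (0, dirP l)).2 (hcomp (0, dirP l) (dirQ l, 0)).2).trans ?_
  rw [(hcomp _ _).1, (hcomp _ _).1, sub_zero]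

end Integrals

/-! ### Moments and the pairing with homogeneous fields -/

section Moments

variable {n : ℕ} {Q : Type*} [TopologicalSpace Q] [ChartedSpace (Base n) Q]
  [IsManifold (𝓡 n) ∞ Q]

theorem IsRegularFun.integrable_fiber_moment {F : Cotangent n Q → ℝ} (hF : IsRegularFun F) (q : Q)
    {k : ℕ} (i : Fin k → Fin n) :
    Integrable (fun p : Base n →L[ℝ] ℝ => (∏ j, p (dirQ (i j))) * F ⟨q, p⟩)
      (momentumVolume n) := by
  simp only [apply_mk_eq_localFun F q]
  have hV := isOpen_extChartAt_target (I := 𝓡 n) q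
  have ht : TemperedOn (extChartAt (𝓡 n) q).target
      fun y : Phase n => ∏ j, y.2 (dirQ (i j)) := by
    refine temperedOn_of_homogeneous hV ?_ k fun a _ c p => ?_
    · refine ContDiff.contDiffOn (contDiff_prod fun j _ => ?_)
      exact ((ContinuousLinearMap.apply ℝ ℝ (dirQ (i j))).comp
        (ContinuousLinearMap.snd ℝ (Base n) (Base n →L[ℝ] ℝ))).contDiff
    · simp [Finset.prod_mul_distrib]
  exact (ht.smul_rapid hV (hF.2 q)).integrable_fiber (mem_extChartAt_target q)

/-- The component `∫ p_{i_1} ⋯ p_{i_k} div(Π^♯) dp` of the `k`-th moment of `Π`. -/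
def moment {k : ℕ} (q : Q) (i : Fin k → Fin n) (Pi : OneForm n Q) : ℝ :=
  ∫ p : Base n →L[ℝ] ℝ, (∏ j, p (dirQ (i j))) * divSharp Pi ⟨q, p⟩ ∂momentumVolume n

theorem moment_zero {k : ℕ} (q : Q) (i : Fin k → Fin n) : moment q i (0 : OneForm n Q) = 0 := by
  have e : ∀ x, divSharp (0 : OneForm n Q) x = 0 := fun x => congrFun divSharp_zero x
  simp only [moment, e, mul_zero, integral_zero]

theorem moment_smul {k : ℕ} (q : Q) (i : Fin k → Fin n) (c : ℝ) {Pi : OneForm n Q}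
    (h : MomentumVlasov.IsRegular Pi) : moment q i (c • Pi) = c * moment q i Pi := by
  have e : ∀ x, divSharp (c • Pi) x = c * divSharp Pi x := fun x => congrFun (divSharp_smul c h) x
  simp only [moment, e, mul_left_comm _ c]
  exact integral_const_mul _ _

/-- The pairing `∫ Π(X) dq dp` of a 1-form with a single vector field. -/
def fieldPairing (Pi : OneForm n Q) (X : VField n Q) : ℝ :=
  ∫ x, contraction Pi X x ∂symplecticVolume n Q

theorem pairing_eq_finsum (Pi : OneForm n Q) (X : FormalField n Q) :
    pairing Pi X = ∑ᶠ j, fieldPairing Pi (X j) := rfl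

theorem fieldPairing_zero (Pi : OneForm n Q) : fieldPairing Pi 0 = 0 := by
  have : ∀ x, contraction Pi (0 : VField n Q) x = 0 := fun x => map_zero (covAt Pi x)
  simp only [fieldPairing, this, integral_zero]

theorem zero_fieldPairing (X : VField n Q) : fieldPairing (0 : OneForm n Q) X = 0 := by
  have : ∀ x, contraction (0 : OneForm n Q) X x = 0 := fun x => rfl
  simp only [fieldPairing, this, integral_zero]

theorem fieldPairing_neg (Pi : OneForm n Q) (X : VField n Q) :
    fieldPairing Pi (-X) = -fieldPairing Pi X := by
  have : ∀ x, contraction Pi (-X) x = -contraction Pi X x := fun x =>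
    map_neg (covAt Pi x) (vecAt X x)
  simp only [fieldPairing, this, integral_neg]

theorem smul_fieldPairing (c : ℝ) (Pi : OneForm n Q) (X : VField n Q) :
    fieldPairing (c • Pi) X = c * fieldPairing Pi X := by
  have : ∀ x, contraction (c • Pi) X x = c * contraction Pi X x := fun x => rfl
  simp only [fieldPairing, this, integral_const_mul]

theorem mlieBracket_mem_sub_one {X Y : VField n Q} {k j : ℕ} (hX : X ∈ homogeneousFields n Q k)
    (hY : Y ∈ homogeneousFields n Q j) :
    VectorField.mlieBracket (phaseModel n) X Y ∈ homogeneousFields n Q (k + j - 1) := by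
  rcases Nat.eq_zero_or_pos (k + j) with h0 | h0
  · obtain ⟨rfl, rfl⟩ := Nat.add_eq_zero_iff.1 h0
    rw [mlieBracket_eq_zero hX hY]
    exact zero_mem_homogeneousFields _
  · exact mlieBracket_mem hX hY (by omega)

variable [T2Space Q]

theorem moment_add {k : ℕ} (q : Q) (i : Fin k → Fin n) {Pi Pi' : OneForm n Q}
    (h : MomentumVlasov.IsRegular Pi) (h' : MomentumVlasov.IsRegular Pi') :
    moment q i (Pi + Pi') = moment q i Pi + moment q i Pi' := by
  have e : ∀ x, divSharp (Pi + Pi') x = divSharp Pi x + divSharp Pi' x := fun x =>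
    congrFun (divSharp_add h h') x
  simp only [moment, e, mul_add]
  exact integral_add ((isRegularFun_divSharp h).integrable_fiber_moment q i)
    ((isRegularFun_divSharp h').integrable_fiber_moment q i)

theorem moment_sum {k : ℕ} (q : Q) (i : Fin k → Fin n) {ι : Type*} (s : Finset ι)
    {P : ι → OneForm n Q} (h : ∀ j ∈ s, MomentumVlasov.IsRegular (P j)) :
    moment q i (∑ j ∈ s, P j) = ∑ j ∈ s, moment q i (P j) := by
  classical
  induction s using Finset.induction_on with
  | empty => exact moment_zero q i
  | insert j s hj ih =>
    have hs := fun l hl => h l (Finset.mem_insert_of_mem hl)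
    rw [Finset.sum_insert hj, Finset.sum_insert hj, ← ih hs,
      moment_add q i (h j (Finset.mem_insert_self j s)) (isRegular_sum s hs)]

theorem momentVanishes_add {k : ℕ} {Pi Pi' : OneForm n Q} (h : MomentumVlasov.IsRegular Pi)
    (h' : MomentumVlasov.IsRegular Pi') (hk : MomentVanishes k Pi) (hk' : MomentVanishes k Pi') :
    MomentVanishes k (Pi + Pi') := fun q i => by
  have := moment_add q i h h'
  rwa [show moment q i Pi = 0 from hk q i, show moment q i Pi' = 0 from hk' q i, add_zero] at this

theorem momentVanishes_sum {k : ℕ} {ι : Type*} (s : Finset ι) {P : ι → OneForm n Q}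
    (h : ∀ i ∈ s, MomentumVlasov.IsRegular (P i)) (hk : ∀ i ∈ s, MomentVanishes k (P i)) :
    MomentVanishes k (∑ i ∈ s, P i) := fun q i =>
  (moment_sum q i s h).trans (Finset.sum_eq_zero fun j hj => hk j hj q i)

theorem add_mem_dualForms {Pi Pi' : OneForm n Q} (h : Pi ∈ dualForms n Q)
    (h' : Pi' ∈ dualForms n Q) : Pi + Pi' ∈ dualForms n Q := by
  obtain ⟨h, N, hN⟩ := h
  obtain ⟨h', N', hN'⟩ := h'
  exact ⟨isRegular_add h h', max N N', fun k hk => momentVanishes_add h h'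
    (hN k ((le_max_left _ _).trans hk)) (hN' k ((le_max_right _ _).trans hk))⟩

variable [SecondCountableTopology Q]

theorem integrable_contraction {k : ℕ} {Pi : OneForm n Q} {X : VField n Q}
    (hPi : MomentumVlasov.IsRegular Pi) (hX : X ∈ homogeneousFields n Q k) :
    Integrable (contraction Pi X) (symplecticVolume n Q) :=
  (isRegularFun_contraction hPi hX).integrable

theorem add_fieldPairing {k : ℕ} {Pi Pi' : OneForm n Q} {X : VField n Q}
    (h : MomentumVlasov.IsRegular Pi) (h' : MomentumVlasov.IsRegular Pi')
    (hX : X ∈ homogeneousFields n Q k) :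
    fieldPairing (Pi + Pi') X = fieldPairing Pi X + fieldPairing Pi' X :=
  integral_add (integrable_contraction h hX) (integrable_contraction h' hX)

theorem sum_fieldPairing {k : ℕ} {ι : Type*} (s : Finset ι) {P : ι → OneForm n Q} {X : VField n Q}
    (h : ∀ i ∈ s, MomentumVlasov.IsRegular (P i)) (hX : X ∈ homogeneousFields n Q k) :
    fieldPairing (∑ i ∈ s, P i) X = ∑ i ∈ s, fieldPairing (P i) X := by
  classical
  induction s using Finset.induction_on with
  | empty => exact zero_fieldPairing X
  | insert i s hi ih =>
    have hs := fun j hj => h j (Finset.mem_insert_of_mem hj)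
    rw [Finset.sum_insert hi, Finset.sum_insert hi, ← ih hs,
      add_fieldPairing (h i (Finset.mem_insert_self i s)) (isRegular_sum s hs) hX]

theorem fieldPairing_add {k j : ℕ} {Pi : OneForm n Q} {X Y : VField n Q}
    (h : MomentumVlasov.IsRegular Pi) (hX : X ∈ homogeneousFields n Q k)
    (hY : Y ∈ homogeneousFields n Q j) :
    fieldPairing Pi (X + Y) = fieldPairing Pi X + fieldPairing Pi Y := by
  have : ∀ x, contraction Pi (X + Y) x = contraction Pi X x + contraction Pi Y x := fun x =>
    map_add (covAt Pi x) (vecAt X x) (vecAt Y x)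
  simp only [fieldPairing, this]
  exact integral_add (integrable_contraction h hX) (integrable_contraction h hY)

theorem fieldPairing_sum {ι : Type*} {m : ℕ} {Pi : OneForm n Q} (h : MomentumVlasov.IsRegular Pi)
    (s : Finset ι) {X : ι → VField n Q} (hX : ∀ i ∈ s, X i ∈ homogeneousFields n Q m) :
    fieldPairing Pi (∑ i ∈ s, X i) = ∑ i ∈ s, fieldPairing Pi (X i) := by
  classical
  induction s using Finset.induction_on with
  | empty => exact fieldPairing_zero Pi
  | insert i s hi ih =>
    have hs := fun j hj => hX j (Finset.mem_insert_of_mem hj)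
    have hsum : ∑ i ∈ s, X i ∈ homogeneousFields n Q m :=
      Finset.sum_induction X (· ∈ homogeneousFields n Q m)
        (fun _ _ => add_mem_homogeneousFields) (zero_mem_homogeneousFields m) hs
    rw [Finset.sum_insert hi, Finset.sum_insert hi, ← ih hs,
      fieldPairing_add h (hX i (Finset.mem_insert_self i s)) hsum]

/-- A form whose `k`-th moment vanishes annihilates the Hamiltonian fields of degree `k`: up to a
divergence, `Π(X_h)` is `h div(Π^♯)`, the fibre integrals of which are combinations of `k`-th
moments. -/
theorem fieldPairing_eq_zero {k : ℕ} {Pi : OneForm n Q} {X : VField n Q}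
    (hPi : MomentumVlasov.IsRegular Pi) (hk : MomentVanishes k Pi)
    (hX : X ∈ homogeneousFields n Q k) : fieldPairing Pi X = 0 := by
  obtain ⟨h, hh, hX⟩ := hX
  have ht := isTemperedFun_of_homogeneous hh
  have hd := isRegularFun_divSharp hPi
  have hr := hd.tempered_mul ht
  have hr' := isRegular_smulForm hPi ht
  have e : ∀ x, contraction Pi X x = h x * divSharp Pi x - divSharp (smulForm h Pi) x := fun x => by
    rw [divSharp_smulForm hh.1 hX (isSmoothForm_of_isRegular hPi), contraction]
    ring
  simp only [fieldPairing, e]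
  rw [integral_sub hr.integrable (isRegularFun_divSharp hr').integrable, integral_divSharp hr',
    sub_zero]
  refine hr.integral_eq_zero_of_fiber fun q => ?_
  obtain ⟨T, hT⟩ := hh.2 q
  have e2 : ∀ p : Base n →L[ℝ] ℝ, h ⟨q, p⟩ * divSharp Pi ⟨q, p⟩
      = ∑ r : Fin k → Fin n, T (fun j => dirP (r j))
        * ((∏ j, p (dirQ (r j))) * divSharp Pi ⟨q, p⟩) := fun p => by
    have hTp : (T fun _ => p) = T fun _ => ∑ l : Fin n, p (dirQ l) • dirP l :=
      congrArg (fun p' => T fun _ => p') (covector_eq_sum p)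
    rw [hT, hTp, MultilinearMap.map_sum, Finset.sum_mul]
    refine Finset.sum_congr rfl fun r _ => ?_
    rw [MultilinearMap.map_smul_univ, smul_eq_mul]
    ring
  simp only [e2]
  rw [integral_finsetSum _ fun r _ => (hd.integrable_fiber_moment q r).const_mul _]
  refine Finset.sum_eq_zero fun r _ => ?_
  rw [integral_const_mul, hk q r, mul_zero]

/-- The pairing with `J_LP(Π)(X)` is the pairing of `Π` with the Jacobi-Lie bracket with `X`. -/
theorem fieldPairing_JLP {k j : ℕ} {Pi : OneForm n Q} {X Y : VField n Q}
    (hPi : MomentumVlasov.IsRegular Pi) (hX : X ∈ homogeneousFields n Q k)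
    (hY : Y ∈ homogeneousFields n Q j) :
    fieldPairing (JLP Pi X) Y = fieldPairing Pi (VectorField.mlieBracket (phaseModel n) X Y) := by
  have hXY := mlieBracket_mem_sub_one hX hY
  have hc := isRegularFun_contraction hPi hY
  obtain ⟨h, hh, hX⟩ := hX
  obtain ⟨g, hg, hY⟩ := hY
  have hr := isRegular_smulForm_diffForm hc hh
  simp only [fieldPairing, JLP_apply_field hh.1 hg.1 hX hY (isSmoothForm_of_isRegular hPi)]
  rw [integral_sub (integrable_contraction hPi hXY) (isRegularFun_divSharp hr).integrable,
    integral_divSharp hr, sub_zero]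

end Moments

/-! ### Fibre dilations and the moment decomposition -/

section Dilation

variable {n : ℕ} {Q : Type*} [TopologicalSpace Q] [ChartedSpace (Base n) Q]
  [IsManifold (𝓡 n) ∞ Q]

/-- The covector of a point of `T*Q`, in the frame of the preferred chart. -/
def momentumAt (x : Cotangent n Q) : Base n →L[ℝ] ℝ := x.2

/-- The fibre dilation `(q, p) ↦ (q, c p)` of `T*Q`. -/
def fiberDilation (c : ℝ) (x : Cotangent n Q) : Cotangent n Q := ⟨x.proj, c • momentumAt x⟩

theorem fiberDilation_proj {Q : Type*} [TopologicalSpace Q] [ChartedSpace (Base n) Q] (c : ℝ)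
    (x : Cotangent n Q) : (fiberDilation c x).proj = x.proj := rfl

theorem fiberDilation_mem_source (c : ℝ) {a : Q} {x : Cotangent n Q}
    (hx : x ∈ (darboux (n := n) a).source) : fiberDilation c x ∈ (darboux (n := n) a).source := by
  rw [mem_darboux_source, fiberDilation_proj]
  exact mem_darboux_source.1 hx

theorem darboux_apply {a : Q} {x : Cotangent n Q} (hx : x ∈ (darboux (n := n) a).source) :
    darboux (n := n) a x
      = (extChartAt (𝓡 n) a x.proj, fiberCoord a x.proj (momentumAt x)) :=
  darboux_mk (mem_darboux_source.1 hx) (momentumAt x)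

/-- The fibre dilation `(q, p) ↦ (q, c p)` in Darboux coordinates. -/
abbrev phaseDilation (n : ℕ) (c : ℝ) : Phase n →L[ℝ] Phase n :=
  dilation (Base n) (Base n →L[ℝ] ℝ) c

theorem phaseDilation_mem_target (c : ℝ) {a : Q} {y : Phase n}
    (hy : y ∈ (darboux (n := n) a).target) : phaseDilation n c y ∈ (darboux (n := n) a).target :=
  mem_darboux_target (fst_mem_of_mem_darboux_target hy) _

theorem darboux_fiberDilation (c : ℝ) {a : Q} {x : Cotangent n Q}
    (hx : x ∈ (darboux (n := n) a).source) :
    darboux (n := n) a (fiberDilation c x) = phaseDilation n c (darboux (n := n) a x) := by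
  have h1 := darboux_mk (mem_darboux_source.1 hx) (c • momentumAt x)
  rw [darboux_apply hx, dilation_apply, fiberDilation, h1, map_smul]

theorem darboux_symm_phaseDilation (c : ℝ) {a : Q} {y : Phase n}
    (hy : y ∈ (darboux (n := n) a).target) :
    (darboux (n := n) a).symm (phaseDilation n c y)
      = fiberDilation c ((darboux (n := n) a).symm y) := by
  have hx := (darboux (n := n) a).map_target hy
  have h := darboux_fiberDilation c hx
  rw [(darboux (n := n) a).right_inv hy] at h
  rw [← h, (darboux (n := n) a).left_inv (fiberDilation_mem_source c hx)]

/-- The pullback of a 1-form by a fibre dilation. -/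
def dilateForm (c : ℝ) (Pi : OneForm n Q) : OneForm n Q := fun x =>
  (covAt Pi (fiberDilation c x)).comp (phaseDilation n c)

/-- The fibre dilation has the same expression in all Darboux charts, so its derivative commutes
with their derivatives. -/
theorem chartDerivSymm_phaseDilation (c : ℝ) {a : Q} {y : Phase n}
    (hy : y ∈ (darboux (n := n) a).target) (v : Phase n) :
    chartDerivSymm a (phaseDilation n c y) (phaseDilation n c v)
      = phaseDilation n c (chartDerivSymm a y v) := by
  set x := (darboux (n := n) a).symm y with hx
  -- in the chart over the base point, the two maps are derivatives of the transition map
  have hself : ∀ z ∈ transitionDomain n a x.proj, ((darboux (n := n) a).symm z).proj = x.proj →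
      chartDerivSymm a z = fderiv ℝ (transition a x.proj) z := by
    intro z hz hzp
    rw [fderiv_transition hz]
    have := chartDeriv_self ((darboux (n := n) a).symm z)
    rw [hzp] at this
    rw [this]
    rfl
  have hy0 : y ∈ transitionDomain n a x.proj := ⟨hy, mem_darboux_proj_source x⟩
  have hsrc : ∀ z ∈ transitionDomain n a x.proj,
      phaseDilation n c z ∈ transitionDomain n a x.proj := by
    intro z hz
    refine ⟨phaseDilation_mem_target c hz.1, ?_⟩
    rw [mem_preimage, darboux_symm_phaseDilation c hz.1]
    exact fiberDilation_mem_source c hz.2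
  have hcomm : ∀ z ∈ transitionDomain n a x.proj,
      transition a x.proj (phaseDilation n c z) = phaseDilation n c (transition a x.proj z) := by
    intro z hz
    rw [transition, darboux_symm_phaseDilation c hz.1, darboux_fiberDilation c hz.2]
    rfl
  rw [hself _ hy0 rfl, hself _ (hsrc y hy0)
    (by rw [darboux_symm_phaseDilation c hy, fiberDilation_proj])]
  have h1 : HasFDerivAt (fun z => transition a x.proj (phaseDilation n c z))
      ((fderiv ℝ (transition a x.proj) (phaseDilation n c y)).comp (phaseDilation n c)) y :=
    ((contDiffAt_transition (hsrc y hy0)).differentiableAt (by simp)).hasFDerivAt.comp y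
      (phaseDilation n c).hasFDerivAt
  have h2 : HasFDerivAt (fun z => transition a x.proj (phaseDilation n c z))
      ((phaseDilation n c).comp (fderiv ℝ (transition a x.proj) y)) y := by
    refine ((phaseDilation n c).hasFDerivAt.comp y ((contDiffAt_transition hy0).differentiableAt
      (by simp)).hasFDerivAt).congr_of_eventuallyEq ?_
    filter_upwards [(isOpen_transitionDomain a x.proj).mem_nhds hy0] with z hz using hcomm z hz
  exact congrArg (fun L : Phase n →L[ℝ] Phase n => L v) (h1.unique h2)

theorem localForm_dilateForm (c : ℝ) (Pi : OneForm n Q) {a : Q} {y : Phase n}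
    (hy : y ∈ (darboux (n := n) a).target) :
    localForm a (dilateForm c Pi) y
      = (localForm a Pi (phaseDilation n c y)).comp (phaseDilation n c) := by
  refine ContinuousLinearMap.ext fun v => ?_
  change localForm a (dilateForm c Pi) y v
    = localForm a Pi (phaseDilation n c y) (phaseDilation n c v)
  rw [localForm_apply, localForm_apply, chartDerivSymm_phaseDilation c hy,
    darboux_symm_phaseDilation c hy]
  rfl

theorem isRegular_dilateForm {c : ℝ} (hc : c ≠ 0) {Pi : OneForm n Q}
    (h : MomentumVlasov.IsRegular Pi) : MomentumVlasov.IsRegular (dilateForm c Pi) := by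
  obtain ⟨⟨K, hK, h0⟩, h⟩ := isRegular_iff_rapidOn.1 h
  refine isRegular_iff_rapidOn.2 ⟨⟨K, hK, fun x hx => ?_⟩, fun a => ?_⟩
  · have : covAt Pi (fiberDilation c x) = 0 := h0 _ hx
    change (covAt Pi (fiberDilation c x)).comp (phaseDilation n c) = 0
    rw [this, ContinuousLinearMap.zero_comp]
  · have hV := isOpen_extChartAt_target (I := 𝓡 n) a
    refine (((h a).comp_dilation hV hc).clm_comp
      ((ContinuousLinearMap.compL ℝ (Phase n) (Phase n) ℝ).flip (phaseDilation n c)) hV).congr hV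
        fun z hz => ?_
    rw [localForm_dilateForm c Pi (mem_darboux_target hz.1 z.2)]
    rfl

theorem divLocal_dilation (c : ℝ) {α : Phase n → Phase n →L[ℝ] ℝ} {y : Phase n}
    (hα : DifferentiableAt ℝ α (phaseDilation n c y)) :
    divLocal (fun z => (α (phaseDilation n c z)).comp (phaseDilation n c)) y
      = c * divLocal α (phaseDilation n c y) := by
  have h1 : HasFDerivAt (fun z => (α (phaseDilation n c z)).comp (phaseDilation n c))
      (((ContinuousLinearMap.compL ℝ (Phase n) (Phase n) ℝ).flip (phaseDilation n c)).comp
        ((fderiv ℝ α (phaseDilation n c y)).comp (phaseDilation n c))) y :=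
    ((ContinuousLinearMap.compL ℝ (Phase n) (Phase n) ℝ).flip
      (phaseDilation n c)).hasFDerivAt.comp y
        (hα.hasFDerivAt.comp y (phaseDilation n c).hasFDerivAt)
  have h2 : ∀ u v, fderiv ℝ (fun z => (α (phaseDilation n c z)).comp (phaseDilation n c)) y u v
      = fderiv ℝ α (phaseDilation n c y) (phaseDilation n c u) (phaseDilation n c v) :=
    fun u v => by
    rw [h1.fderiv]
    rfl
  have hq : ∀ l : Fin n, phaseDilation n c (dirQ l, 0) = (dirQ l, 0) := fun l => by
    simp [dilation_apply]
  have hp : ∀ l : Fin n, phaseDilation n c (0, dirP l) = c • (0, dirP l) := fun l => by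
    simp [dilation_apply]
  simp only [divLocal, h2, hq, hp, map_smul, _root_.smul_apply, smul_eq_mul]
  rw [Finset.mul_sum]
  exact Finset.sum_congr rfl fun l _ => by ring

/-- The factor `c` is due to `dq ∧ dp`, which the dilation multiplies by `c`. -/
theorem divSharp_dilateForm {c : ℝ} (hc : c ≠ 0) {Pi : OneForm n Q}
    (h : MomentumVlasov.IsRegular Pi) (x : Cotangent n Q) :
    divSharp (dilateForm c Pi) x = c * divSharp Pi (fiberDilation c x) := by
  have hs := isSmoothForm_of_isRegular h
  have hx := mem_darboux_proj_source x
  have ht := (darboux (n := n) x.proj).map_source hx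
  have hx' : fiberDilation c x ∈ (darboux (n := n) x.proj).source :=
    mem_darboux_proj_source (fiberDilation c x)
  rw [divSharp_eq (isSmoothForm_of_isRegular (isRegular_dilateForm hc h)) hx, divSharp_eq hs hx',
    darboux_fiberDilation c hx,
    ← divLocal_dilation c (hs.differentiableAt (phaseDilation_mem_target c ht))]
  refine divLocal_congr ?_
  filter_upwards [(isOpen_darboux_target x.proj).mem_nhds ht] with z hz
    using localForm_dilateForm c Pi hz

/-- Moments of different order scale differently under fibre dilations. -/
theorem moment_dilateForm {c : ℝ} (hc : c ≠ 0) {Pi : OneForm n Q}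
    (h : MomentumVlasov.IsRegular Pi) {k : ℕ} (q : Q) (i : Fin k → Fin n) :
    moment q i (dilateForm c Pi)
      = c * |(c ^ Module.finrank ℝ (Base n →L[ℝ] ℝ))⁻¹| * (c⁻¹) ^ k * moment q i Pi := by
  have h1 := Measure.integral_comp_smul (momentumVolume n)
    (fun p : Base n →L[ℝ] ℝ => (∏ j, (c⁻¹ • p) (dirQ (i j))) * divSharp Pi ⟨q, p⟩) c
  have h2 : ∀ p : Base n →L[ℝ] ℝ, ∏ j, (c⁻¹ • p) (dirQ (i j))
      = (c⁻¹) ^ k * ∏ j, p (dirQ (i j)) := fun p => by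
    simp [Finset.prod_mul_distrib]
  have h3 : ∀ p : Base n →L[ℝ] ℝ, c⁻¹ • c • p = p := fun p => inv_smul_smul₀ hc p
  simp only [h3] at h1
  simp only [h2, mul_assoc, integral_const_mul, smul_eq_mul] at h1
  have h4 : ∀ p : Base n →L[ℝ] ℝ, divSharp (dilateForm c Pi) (⟨q, p⟩ : Cotangent n Q)
      = c * divSharp Pi ⟨q, c • p⟩ := fun p => divSharp_dilateForm hc h _
  simp only [moment, h4, mul_left_comm _ c, integral_const_mul]
  rw [h1]
  ring

end Dilation

section Decomposition

variable {n : ℕ} {Q : Type*} [TopologicalSpace Q] [ChartedSpace (Base n) Q]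
  [IsManifold (𝓡 n) ∞ Q] [T2Space Q]

/-- Finitely many dilations separate the moments of order less than `N`. -/
theorem exists_dilation_weights (d N : ℕ) :
    ∃ (c : Fin N → ℝ) (w : Fin N → Fin N → ℝ), (∀ j, c j ≠ 0) ∧
      ∀ k m : Fin N, ∑ j, w k j * (c j * |(c j ^ d)⁻¹| * (c j)⁻¹ ^ (m : ℕ))
        = if k = m then 1 else 0 := by
  -- for the ratios `c j = (j + 1)⁻¹` the weights invert a Vandermonde matrix with nodes `j + 1`
  set x : Fin N → ℝ := fun j => (j : ℝ) + 1 with hx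
  have hx0 : ∀ j, x j ≠ 0 := fun j => by positivity
  have hinj : Function.Injective x := fun i j hij => by
    simpa [hx, Fin.ext_iff] using hij
  have hdet := Matrix.det_vandermonde_ne_zero_iff.2 hinj
  set V := Matrix.vandermonde x with hV
  have hinv : V⁻¹ * V = 1 := Matrix.nonsing_inv_mul V (isUnit_iff_ne_zero.2 hdet)
  set b : Fin N → ℝ := fun j => (x j)⁻¹ * |((x j)⁻¹ ^ d)⁻¹| with hb
  have hb0 : ∀ j, b j ≠ 0 := fun j => by
    have := hx0 j
    simp only [hb]
    positivity
  refine ⟨fun j => (x j)⁻¹, fun k j => V⁻¹ k j / b j, fun j => inv_ne_zero (hx0 j), fun k m => ?_⟩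
  have h1 := congrFun (congrFun hinv k) m
  rw [Matrix.mul_apply, Matrix.one_apply] at h1
  rw [← h1]
  refine Finset.sum_congr rfl fun j _ => ?_
  rw [hV, Matrix.vandermonde_apply, inv_inv]
  change V⁻¹ k j / b j * (b j * x j ^ (m : ℕ)) = _
  rw [← mul_assoc, div_mul_cancel₀ _ (hb0 j)]

/-- The form with the `k`-th moment of `Π` and no other one is a linear combination of pullbacks of
`Π` by fibre dilations. -/
theorem exists_moment_components {Pi : OneForm n Q} (hPi : Pi ∈ dualForms n Q) :
    ∃ P : ℕ → OneForm n Q, (∀ k, P k ∈ degDual n Q k) ∧ ∃ N : ℕ, (∀ k, N ≤ k → P k = 0) ∧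
      ∀ m, MomentVanishes m (Pi + (-1 : ℝ) • ∑ k ∈ Finset.range N, P k) := by
  obtain ⟨hPi, N, hN⟩ := hPi
  obtain ⟨c, w, hc, hw⟩ := exists_dilation_weights (Module.finrank ℝ (Base n →L[ℝ] ℝ)) N
  have hd : ∀ j, MomentumVlasov.IsRegular (dilateForm (c j) Pi) := fun j =>
    isRegular_dilateForm (hc j) hPi
  set R : Fin N → OneForm n Q := fun k => ∑ j, w k j • dilateForm (c j) Pi with hR
  have hRr : ∀ k, MomentumVlasov.IsRegular (R k) := fun k =>
    isRegular_sum _ fun j _ => isRegular_smul _ (hd j)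
  have hmom : ∀ (k : Fin N) (m : ℕ) (q : Q) (i : Fin m → Fin n),
      moment q i (R k) = if m = k then moment q i Pi else 0 := by
    intro k m q i
    rw [hR, moment_sum q i _ fun j _ => isRegular_smul _ (hd j)]
    simp only [moment_smul q i _ (hd _), moment_dilateForm (hc _) hPi]
    rcases lt_or_ge m N with hm | hm
    · have h1 := hw k ⟨m, hm⟩
      simp only [← mul_assoc] at h1 ⊢
      rw [← Finset.sum_mul, h1, ite_mul, one_mul, zero_mul]
      exact if_congr (by rw [Fin.ext_iff, eq_comm]) rfl rfl
    · rw [show moment q i Pi = 0 from hN m hm q i]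
      simp
  set P : ℕ → OneForm n Q := fun k => if h : k < N then R ⟨k, h⟩ else 0 with hP
  have hPr : ∀ k, MomentumVlasov.IsRegular (P k) := fun k => by
    simp only [hP]
    split_ifs
    · exact hRr _
    · exact isRegular_zero
  have hPm : ∀ (k m : ℕ) (q : Q) (i : Fin m → Fin n),
      moment q i (P k) = if m = k then moment q i Pi else 0 := by
    intro k m q i
    simp only [hP]
    split_ifs with h1 h2 h2
    · rw [hmom, if_pos h2]
    · rw [hmom, if_neg h2]
    · rw [moment_zero, show moment q i Pi = 0 from hN m (by omega) q i]
    · exact moment_zero q i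
  refine ⟨P, fun k => ⟨⟨hPr k, max N (k + 1), fun m hm q i => ?_⟩, fun m hm q i => ?_⟩, N,
    fun k hk => ?_, fun m q i => ?_⟩
  · exact (hPm k m q i).trans (if_neg (by omega))
  · exact (hPm k m q i).trans (if_neg hm)
  · simp only [hP]
    exact dif_neg (by omega)
  · have hs := isRegular_sum (Finset.range N) fun k _ => hPr k
    refine (moment_add q i hPi (isRegular_smul _ hs)).trans ?_
    rw [moment_smul q i _ hs, moment_sum q i _ fun k _ => hPr k]
    simp only [hPm, Finset.sum_ite_eq, Finset.mem_range]
    split_ifs with h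
    · ring
    · rw [show moment q i Pi = 0 from hN m (by omega) q i]
      ring

end Decomposition

/-! ### Parts of forms and of formal series -/

section Parts

variable {n : ℕ} {Q : Type*} [TopologicalSpace Q] [ChartedSpace (Base n) Q]
  [IsManifold (𝓡 n) ∞ Q]

/-- The terms of a formal series whose degree satisfies `p`. -/
def restrictDegrees (p : ℕ → Prop) [DecidablePred p] (X : FormalField n Q) : FormalField n Q :=
  fun k => if p k then X k else 0

theorem restrictDegrees_mem (p : ℕ → Prop) [DecidablePred p] {X : FormalField n Q}
    (hX : X ∈ hamFields n Q) : restrictDegrees p X ∈ hamFields n Q := by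
  intro k
  rw [restrictDegrees]
  split_ifs
  · exact hX k
  · exact zero_mem_homogeneousFields k

theorem restrictDegrees_true (X : FormalField n Q) : restrictDegrees (fun _ => True) X = X :=
  funext fun _ => if_pos trivial

theorem sPart_eq (X : FormalField n Q) : sPart X = restrictDegrees (· ≤ 1) X := rfl

theorem nPart_eq (X : FormalField n Q) : nPart X = restrictDegrees (2 ≤ ·) X := rfl

theorem degPart_eq (k : ℕ) (X : FormalField n Q) : degPart k X = restrictDegrees (· = k) X := rfl

theorem sPart_mem {X : FormalField n Q} (hX : X ∈ hamFields n Q) : sPart X ∈ sFields n Q :=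
  ⟨restrictDegrees_mem _ hX, fun _ hk => if_neg (by omega)⟩

theorem nPart_mem {X : FormalField n Q} (hX : X ∈ hamFields n Q) : nPart X ∈ nFields n Q :=
  ⟨restrictDegrees_mem _ hX, fun _ hk => if_neg (by omega)⟩

theorem degPart_mem (k : ℕ) {X : FormalField n Q} (hX : X ∈ hamFields n Q) :
    degPart k X ∈ degFields n Q k :=
  ⟨restrictDegrees_mem _ hX, fun _ hj => if_neg hj⟩

theorem sPart_of_mem {X : FormalField n Q} (hX : X ∈ sFields n Q) : sPart X = X := by
  funext k
  rw [sPart]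
  split_ifs with h
  · rfl
  · exact (hX.2 k (by omega)).symm

theorem nPart_of_mem {X : FormalField n Q} (hX : X ∈ nFields n Q) : nPart X = X := by
  funext k
  rw [nPart]
  split_ifs with h
  · rfl
  · exact (hX.2 k (by omega)).symm

theorem ofDegree_mem {k : ℕ} {Z : VField n Q} (hZ : Z ∈ homogeneousFields n Q k) :
    ofDegree k Z ∈ hamFields n Q := by
  intro j
  rw [ofDegree]
  split_ifs with h
  · rw [h]
    exact hZ
  · exact zero_mem_homogeneousFields j

theorem bracket_apply (X Y : FormalField n Q) (m : ℕ) : bracket X Y m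
    = -∑ kj ∈ Finset.HasAntidiagonal.antidiagonal (m + 1),
        VectorField.mlieBracket (phaseModel n) (X kj.1) (Y kj.2) := by
  funext x
  rw [Pi.neg_apply, Finset.sum_apply]
  rfl

theorem sum_bracket_mem {X Y : FormalField n Q} (hX : X ∈ hamFields n Q) (hY : Y ∈ hamFields n Q)
    (m : ℕ) : ∀ kj ∈ Finset.HasAntidiagonal.antidiagonal (m + 1),
      VectorField.mlieBracket (phaseModel n) (X kj.1) (Y kj.2) ∈ homogeneousFields n Q m :=
  fun kj hkj => mlieBracket_mem (hX kj.1) (hY kj.2) (Finset.HasAntidiagonal.mem_antidiagonal.1 hkj)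

theorem bracket_mem {X Y : FormalField n Q} (hX : X ∈ hamFields n Q) (hY : Y ∈ hamFields n Q) :
    bracket X Y ∈ hamFields n Q := fun m => by
  rw [bracket_apply]
  exact neg_mem_homogeneousFields (Finset.sum_induction _ (· ∈ homogeneousFields n Q m)
    (fun _ _ => add_mem_homogeneousFields) (zero_mem_homogeneousFields m) (sum_bracket_mem hX hY m))

theorem fieldPairing_ite (A : OneForm n Q) (p : Prop) [Decidable p] (Z : VField n Q) :
    fieldPairing A (if p then Z else 0) = if p then fieldPairing A Z else 0 := by
  split_ifs
  · rfl
  · exact fieldPairing_zero A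

theorem pairing_ofDegree (A : OneForm n Q) (k : ℕ) (Z : VField n Q) :
    pairing A (ofDegree k Z) = fieldPairing A Z := by
  rw [pairing_eq_finsum, finsum_eq_single _ k]
  · simp [ofDegree]
  · intro j hj
    simp only [ofDegree, if_neg hj, fieldPairing_zero]

/-- `A` pairs with the fields of the degrees in `r` as `Π` does, and annihilates the fields of all
other degrees. -/
def IsMomentPart (r : ℕ → Prop) [DecidablePred r] (Pi A : OneForm n Q) : Prop :=
  A ∈ dualForms n Q ∧ ∀ m, ∀ Z ∈ homogeneousFields n Q m,
    fieldPairing A Z = if r m then fieldPairing Pi Z else 0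

theorem isMomentPart_self {Pi : OneForm n Q} (h : Pi ∈ dualForms n Q) :
    IsMomentPart (fun _ => True) Pi Pi := ⟨h, fun _ _ _ => (if_pos trivial).symm⟩

/-- All moments of order at least `M - 1` vanish. The bound `3 ≤ M` makes room for the moments of
orders `0`, `1` and `2`, which occur separately in the equations. -/
theorem exists_moment_bound {Pi : OneForm n Q} (hPi : Pi ∈ dualForms n Q) :
    ∃ M, 3 ≤ M ∧ ∀ k, M ≤ k + 1 → MomentVanishes k Pi := by
  obtain ⟨-, N, hN⟩ := hPi
  exact ⟨N + 3, by omega, fun k hk => hN k (by omega)⟩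

theorem sum_antidiagonal_eq (f : ℕ → ℕ → ℝ) {m M : ℕ} (hm : m < M) :
    ∑ kj ∈ Finset.HasAntidiagonal.antidiagonal m, f kj.1 kj.2
      = ∑ k ∈ Finset.range M, ∑ j ∈ Finset.range M, if k + j = m then f k j else 0 := by
  rw [← Finset.sum_product', ← Finset.sum_filter]
  refine Finset.sum_congr ?_ fun _ _ => rfl
  ext ⟨k, j⟩
  simp only [Finset.HasAntidiagonal.mem_antidiagonal, Finset.mem_filter,
    Finset.mem_product, Finset.mem_range]
  omega

theorem fieldPairing_eq_of_dualEq {A B : OneForm n Q} (h : DualEq A B) {m : ℕ} {Z : VField n Q}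
    (hZ : Z ∈ homogeneousFields n Q m) : fieldPairing A Z = fieldPairing B Z := by
  rw [← pairing_ofDegree A m, ← pairing_ofDegree B m]
  exact h _ (ofDegree_mem hZ)

theorem dualEq_of_fieldPairing {A B : OneForm n Q}
    (h : ∀ m, ∀ Z ∈ homogeneousFields n Q m, fieldPairing A Z = fieldPairing B Z) : DualEq A B :=
  fun Y hY => by
    rw [pairing_eq_finsum, pairing_eq_finsum]
    exact finsum_congr fun m => h m _ (hY m)

theorem nForm_eq_sum {Pi : OneForm n Q} {P : ℕ → OneForm n Q}
    (h : IsMomentDecomposition Pi P) : ∃ N, ∀ M, N ≤ M →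
    nForm P = ∑ k ∈ (Finset.range M).filter (2 ≤ ·), P k := by
  obtain ⟨-, ⟨N, hN⟩, -⟩ := h
  refine ⟨N, fun M hM => finsum_mem_eq_sum_of_inter_support_eq P ?_⟩
  ext k
  simp only [mem_inter_iff, Function.mem_support, Finset.coe_filter, mem_ofPred_eq,
    Finset.mem_range]
  refine ⟨fun hk => ⟨⟨?_, hk.1⟩, hk.2⟩, fun hk => ⟨hk.1.2, hk.2⟩⟩
  by_contra hkM
  exact hk.2 (hN k (by omega))

theorem pairing_smul_form (c : ℝ) (Pi : OneForm n Q) (Y : FormalField n Q) :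
    pairing (c • Pi) Y = c * pairing Pi Y := by
  simp only [pairing_eq_finsum, smul_fieldPairing]
  exact (mul_finsum (fun m => fieldPairing Pi (Y m)) c).symm

theorem dualEq_of_isMomentPart {r : ℕ → Prop} [DecidablePred r] {Pi A B : OneForm n Q}
    (hA : IsMomentPart r Pi A) (hB : IsMomentPart r Pi B) : DualEq A B :=
  dualEq_of_fieldPairing fun m Z hZ => (hA.2 m Z hZ).trans (hB.2 m Z hZ).symm

variable [T2Space Q]

theorem nForm_mem {Pi : OneForm n Q} {P : ℕ → OneForm n Q}
    (h : IsMomentDecomposition Pi P) : nForm P ∈ nDual n Q := by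
  obtain ⟨N, hN⟩ := nForm_eq_sum h
  rw [hN N le_rfl]
  have hr : ∀ k ∈ (Finset.range N).filter (2 ≤ ·), MomentumVlasov.IsRegular (P k) :=
    fun k _ => (h.1 k).1.1
  refine ⟨⟨isRegular_sum _ hr, N, fun m hm => momentVanishes_sum _ hr fun k hk => ?_⟩,
    fun m hm => momentVanishes_sum _ hr fun k hk => ?_⟩
  · rw [Finset.mem_filter, Finset.mem_range] at hk
    exact (h.1 k).2 m (by omega)
  · rw [Finset.mem_filter] at hk
    exact (h.1 k).2 m (by omega)

variable [SecondCountableTopology Q]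

theorem pairing_eq_sum {Pi A : OneForm n Q} (hPi : MomentumVlasov.IsRegular Pi) {N : ℕ}
    (hN : ∀ k, N ≤ k → MomentVanishes k Pi) {r : ℕ → Prop} [DecidablePred r]
    (hA : IsMomentPart r Pi A) {Y : FormalField n Q} (hY : Y ∈ hamFields n Q) :
    pairing A Y = ∑ m ∈ Finset.range N, if r m then fieldPairing Pi (Y m) else 0 := by
  rw [pairing_eq_finsum, finsum_congr fun m => hA.2 m _ (hY m)]
  refine finsum_eq_sum_of_support_subset _ fun m hm => ?_
  rw [Finset.mem_coe, Finset.mem_range]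
  by_contra h
  refine hm ?_
  simp only [fieldPairing_eq_zero hPi (hN m (not_lt.1 h)) (hY m), ite_self]

theorem pairing_add_form {Pi Pi' : OneForm n Q} (h : Pi ∈ dualForms n Q)
    (h' : Pi' ∈ dualForms n Q) {Y : FormalField n Q} (hY : Y ∈ hamFields n Q) :
    pairing (Pi + Pi') Y = pairing Pi Y + pairing Pi' Y := by
  simp only [pairing_eq_finsum]
  rw [finsum_congr fun m => add_fieldPairing h.1 h'.1 (hY m)]
  have hfin : ∀ A ∈ dualForms n Q, (Function.support fun m => fieldPairing A (Y m)).Finite := by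
    rintro A ⟨hA, N, hN⟩
    refine (finite_lt_nat N).subset fun m hm => ?_
    by_contra hmN
    exact hm (fieldPairing_eq_zero hA (hN m (not_lt.1 hmN)) (hY m))
  exact finsum_add_distrib (hfin Pi h) (hfin Pi' h')

/-- Parts of `Π` and parts of `Y` may be traded for one another in the pairing. -/
theorem pairing_restrictDegrees {Pi A A' : OneForm n Q} (hPi : Pi ∈ dualForms n Q)
    {r r' : ℕ → Prop} [DecidablePred r] [DecidablePred r'] (hA : IsMomentPart r Pi A)
    (hA' : IsMomentPart r' Pi A') {p p' : ℕ → Prop} [DecidablePred p] [DecidablePred p']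
    {Y : FormalField n Q} (hY : Y ∈ hamFields n Q) (h : ∀ m, (r m ∧ p m) ↔ (r' m ∧ p' m)) :
    pairing A (restrictDegrees p Y) = pairing A' (restrictDegrees p' Y) := by
  obtain ⟨hPi, N, hN⟩ := hPi
  rw [pairing_eq_sum hPi hN hA (restrictDegrees_mem p hY),
    pairing_eq_sum hPi hN hA' (restrictDegrees_mem p' hY)]
  refine Finset.sum_congr rfl fun m _ => ?_
  simp only [restrictDegrees, fieldPairing_ite, ← ite_and]
  exact if_congr (h m) rfl rfl

/-- The double sum that `J_LP` amounts to after integration: the bracket of fields of degrees `k`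
and `j` only sees the moments of order `k + j - 1`. -/
theorem JLPdual_eq_sum {Pi A : OneForm n Q} (hPi : MomentumVlasov.IsRegular Pi) {M : ℕ}
    (hM : ∀ k, M ≤ k + 1 → MomentVanishes k Pi) {r : ℕ → Prop} [DecidablePred r]
    (hA : IsMomentPart r Pi A) {p p' : ℕ → Prop} [DecidablePred p] [DecidablePred p']
    {X Y : FormalField n Q} (hX : X ∈ hamFields n Q) (hY : Y ∈ hamFields n Q) :
    JLPdual A (restrictDegrees p X) (restrictDegrees p' Y)
      = ∑ k ∈ Finset.range M, ∑ j ∈ Finset.range M, if r (k + j - 1) ∧ p k ∧ p' j then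
          fieldPairing Pi (VectorField.mlieBracket (phaseModel n) (X k) (Y j)) else 0 := by
  have h1 : ∀ kj : ℕ × ℕ,
      ∫ x, JLP A (restrictDegrees p X kj.1) x (restrictDegrees p' Y kj.2 x) ∂symplecticVolume n Q
        = if r (kj.1 + kj.2 - 1) ∧ p kj.1 ∧ p' kj.2 then
            fieldPairing Pi (VectorField.mlieBracket (phaseModel n) (X kj.1) (Y kj.2)) else 0 := by
    rintro ⟨k, j⟩
    change fieldPairing (JLP A (restrictDegrees p X k)) (restrictDegrees p' Y j) = _
    rw [fieldPairing_JLP hA.1.1 (restrictDegrees_mem p hX k) (restrictDegrees_mem p' hY j)]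
    by_cases hp : p k
    · by_cases hp' : p' j
      · simp only [restrictDegrees, hp, hp', if_true, and_true]
        exact hA.2 _ _ (mlieBracket_mem_sub_one (hX k) (hY j))
      · simp only [restrictDegrees, hp', if_false, VectorField.mlieBracket_zero_right,
          fieldPairing_zero, and_false]
    · simp only [restrictDegrees, hp, if_false, VectorField.mlieBracket_zero_left,
        fieldPairing_zero, and_false, false_and]
  rw [JLPdual, finsum_congr h1, ← Finset.sum_product']
  refine finsum_eq_sum_of_support_subset _ ?_
  rintro ⟨k, j⟩ hkj
  rw [Finset.mem_coe, Finset.mem_product, Finset.mem_range, Finset.mem_range]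
  by_contra h
  refine hkj ?_
  have h2 : fieldPairing Pi (VectorField.mlieBracket (phaseModel n) (X k) (Y j)) = 0 :=
    fieldPairing_eq_zero hPi (hM _ (by omega)) (mlieBracket_mem_sub_one (hX k) (hY j))
  simp only [h2, ite_self]

/-- The Lie-Poisson bracket in terms of `J_LP`. -/
theorem pairing_bracket {Pi : OneForm n Q} (hPi : Pi ∈ dualForms n Q) {X Y : FormalField n Q}
    (hX : X ∈ hamFields n Q) (hY : Y ∈ hamFields n Q) :
    pairing Pi (bracket X Y) = -JLPdual Pi X Y := by
  obtain ⟨M, -, hM⟩ := exists_moment_bound hPi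
  have h1 := JLPdual_eq_sum hPi.1 hM (isMomentPart_self hPi) (p := fun _ => True)
    (p' := fun _ => True) hX hY
  rw [restrictDegrees_true, restrictDegrees_true] at h1
  rw [h1, pairing_eq_sum hPi.1 (N := M - 1) (fun k hk => hM k (by omega)) (isMomentPart_self hPi)
    (bracket_mem hX hY)]
  simp only [and_self, if_true]
  set c : ℕ → ℕ → ℝ := fun k j =>
    fieldPairing Pi (VectorField.mlieBracket (phaseModel n) (X k) (Y j)) with hc
  have h2 : ∀ m ∈ Finset.range (M - 1), fieldPairing Pi (bracket X Y m)
      = -∑ k ∈ Finset.range M, ∑ j ∈ Finset.range M, if k + j = m + 1 then c k j else 0 := by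
    intro m hm
    have hm' := Finset.mem_range.1 hm
    rw [bracket_apply, fieldPairing_neg, fieldPairing_sum hPi.1 _ (sum_bracket_mem hX hY m),
      ← sum_antidiagonal_eq c (by omega : m + 1 < M)]
  rw [Finset.sum_congr rfl h2, Finset.sum_neg_distrib, Finset.sum_comm]
  congr 1
  refine Finset.sum_congr rfl fun k _ => ?_
  rw [Finset.sum_comm]
  refine Finset.sum_congr rfl fun j _ => ?_
  rcases Nat.eq_zero_or_pos (k + j) with h0 | h0
  · obtain ⟨rfl, rfl⟩ := Nat.add_eq_zero_iff.1 h0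
    rw [mlieBracket_eq_zero (hX 0) (hY 0), fieldPairing_zero]
    exact Finset.sum_eq_zero fun m _ => if_neg (by omega)
  · rcases lt_or_ge (k + j) M with h3 | h3
    · rw [Finset.sum_eq_single (k + j - 1)]
      · exact if_pos (by omega)
      · exact fun m _ hm => if_neg (by omega)
      · exact fun h => absurd (Finset.mem_range.2 (by omega)) h
    · have h4 : c k j = 0 := fieldPairing_eq_zero hPi.1 (hM (k + j - 1) (by omega))
        (mlieBracket_mem_sub_one (hX k) (hY j))
      exact (Finset.sum_eq_zero fun m _ => by rw [h4, ite_self]).trans h4.symm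

/-- The Lie-Poisson bracket is skew. -/
theorem JLPdual_swap {Pi : OneForm n Q} (hPi : Pi ∈ dualForms n Q) {X Y : FormalField n Q}
    (hX : X ∈ hamFields n Q) (hY : Y ∈ hamFields n Q) : JLPdual Pi Y X = -JLPdual Pi X Y := by
  obtain ⟨M, -, hM⟩ := exists_moment_bound hPi
  have h1 := JLPdual_eq_sum hPi.1 hM (isMomentPart_self hPi) (p := fun _ => True)
    (p' := fun _ => True) hX hY
  have h2 := JLPdual_eq_sum hPi.1 hM (isMomentPart_self hPi) (p := fun _ => True)
    (p' := fun _ => True) hY hX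
  rw [restrictDegrees_true, restrictDegrees_true] at h1 h2
  rw [h1, h2, Finset.sum_comm, ← Finset.sum_neg_distrib]
  refine Finset.sum_congr rfl fun k _ => ?_
  rw [← Finset.sum_neg_distrib]
  refine Finset.sum_congr rfl fun j _ => ?_
  simp only [and_self, if_true]
  rw [VectorField.mlieBracket_swap, fieldPairing_neg]

end Parts

section Decomposition

variable {n : ℕ} {Q : Type*} [TopologicalSpace Q] [ChartedSpace (Base n) Q]
  [IsManifold (𝓡 n) ∞ Q] [T2Space Q] [SecondCountableTopology Q]

theorem exists_isMomentDecomposition {Pi : OneForm n Q} (hPi : Pi ∈ dualForms n Q) :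
    ∃ P : ℕ → OneForm n Q, IsMomentDecomposition Pi P := by
  obtain ⟨P, hP, N, hN, hmom⟩ := exists_moment_components hPi
  refine ⟨P, hP, ⟨N, hN⟩, fun Y hY => ?_⟩
  have hsum : ∑ᶠ k, P k = ∑ k ∈ Finset.range N, P k :=
    finsum_eq_sum_of_support_subset _ fun k hk => by
      rw [Finset.mem_coe, Finset.mem_range]
      by_contra h
      exact hk (hN k (not_lt.1 h))
  rw [hsum, pairing_eq_finsum, pairing_eq_finsum]
  refine finsum_congr fun m => ?_
  have hr : MomentumVlasov.IsRegular (∑ k ∈ Finset.range N, P k) :=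
    isRegular_sum _ fun k _ => (hP k).1.1
  have h1 := fieldPairing_eq_zero (isRegular_add hPi.1 (isRegular_smul (-1) hr)) (hmom m) (hY m)
  rw [add_fieldPairing hPi.1 (isRegular_smul (-1) hr) (hY m), smul_fieldPairing] at h1
  linarith

variable {Pi : OneForm n Q} {P : ℕ → OneForm n Q}

theorem fieldPairing_degDual {A : OneForm n Q} {k m : ℕ} (hA : A ∈ degDual n Q k) (hm : m ≠ k)
    {Z : VField n Q} (hZ : Z ∈ homogeneousFields n Q m) : fieldPairing A Z = 0 :=
  fieldPairing_eq_zero hA.1.1 (hA.2 m hm) hZ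

theorem isMomentPart_apply (h : IsMomentDecomposition Pi P) (k : ℕ) :
    IsMomentPart (· = k) Pi (P k) := by
  obtain ⟨hP, ⟨N, hN⟩, hD⟩ := h
  refine ⟨(hP k).1, fun m Z hZ => ?_⟩
  split_ifs with hmk
  · subst hmk
    have hsum : ∑ᶠ k, P k = ∑ k ∈ Finset.range (max N (m + 1)), P k :=
      finsum_eq_sum_of_support_subset _ fun k hk => by
        rw [Finset.mem_coe, Finset.mem_range]
        by_contra h
        exact hk (hN k (by omega))
    rw [fieldPairing_eq_of_dualEq hD hZ, hsum, sum_fieldPairing _ (fun k _ => (hP k).1.1) hZ,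
      Finset.sum_eq_single m]
    · exact fun j _ hj => fieldPairing_degDual (hP j) hj.symm hZ
    · exact fun hm => absurd (Finset.mem_range.2 (by omega)) hm
  · exact fieldPairing_degDual (hP k) hmk hZ

theorem isMomentPart_sForm (h : IsMomentDecomposition Pi P) :
    IsMomentPart (· ≤ 1) Pi (sForm P) := by
  have h0 := isMomentPart_apply h 0
  have h1 := isMomentPart_apply h 1
  refine ⟨add_mem_dualForms h0.1 h1.1, fun m Z hZ => ?_⟩
  rw [sForm, add_fieldPairing h0.1.1 h1.1.1 hZ, h0.2 m Z hZ, h1.2 m Z hZ]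
  rcases m with _ | _ | m <;> simp

theorem sForm_mem (h : IsMomentDecomposition Pi P) : sForm P ∈ sDual n Q :=
  ⟨(isMomentPart_sForm h).1, fun m hm => momentVanishes_add (h.1 0).1.1 (h.1 1).1.1
    ((h.1 0).2 m (by omega)) ((h.1 1).2 m (by omega))⟩

theorem isMomentPart_nForm (h : IsMomentDecomposition Pi P) :
    IsMomentPart (2 ≤ ·) Pi (nForm P) := by
  refine ⟨(nForm_mem h).1, fun m Z hZ => ?_⟩
  obtain ⟨N, hN⟩ := nForm_eq_sum h
  rw [hN (max N (m + 1)) (le_max_left _ _), sum_fieldPairing _ (fun k _ => (h.1 k).1.1) hZ]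
  simp only [(isMomentPart_apply h _).2 m Z hZ]
  rw [Finset.sum_ite_eq]
  refine if_congr ?_ rfl rfl
  rw [Finset.mem_filter, Finset.mem_range]
  omega

theorem pairing_sForm (hPi : Pi ∈ dualForms n Q) (h : IsMomentDecomposition Pi P)
    {Y : FormalField n Q} (hY : Y ∈ hamFields n Q) :
    pairing (sForm P) Y = pairing Pi (sPart Y) := by
  have := pairing_restrictDegrees hPi (isMomentPart_sForm h) (isMomentPart_self hPi)
    (p := fun _ => True) (p' := (· ≤ 1)) hY (by simp)
  rwa [restrictDegrees_true] at this

theorem pairing_nForm (hPi : Pi ∈ dualForms n Q) (h : IsMomentDecomposition Pi P)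
    {Y : FormalField n Q} (hY : Y ∈ hamFields n Q) :
    pairing (nForm P) Y = pairing Pi (nPart Y) := by
  have := pairing_restrictDegrees hPi (isMomentPart_nForm h) (isMomentPart_self hPi)
    (p := fun _ => True) (p' := (2 ≤ ·)) hY (by simp)
  rwa [restrictDegrees_true] at this

theorem dualEq_sForm_add_nForm (h : IsMomentDecomposition Pi P) :
    DualEq Pi (sForm P + nForm P) := by
  have hs := isMomentPart_sForm h
  have hn := isMomentPart_nForm h
  refine dualEq_of_fieldPairing fun m Z hZ => ?_
  rw [add_fieldPairing hs.1.1 hn.1.1 hZ, hs.2 m Z hZ, hn.2 m Z hZ]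
  rcases m with _ | _ | m <;> simp

/-- The sum of `(𝔰ᶜ)*` and `(𝔫ᶜ)*` is direct. -/
theorem isMomentPart_of_dualEq_add {A B : OneForm n Q} (hA : A ∈ sDual n Q) (hB : B ∈ nDual n Q)
    (h : DualEq Pi (A + B)) : IsMomentPart (· ≤ 1) Pi A ∧ IsMomentPart (2 ≤ ·) Pi B := by
  have e : ∀ {m : ℕ} {Z : VField n Q}, Z ∈ homogeneousFields n Q m →
      fieldPairing Pi Z = fieldPairing A Z + fieldPairing B Z := fun hZ => by
    rw [fieldPairing_eq_of_dualEq h hZ, add_fieldPairing hA.1.1 hB.1.1 hZ]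
  refine ⟨⟨hA.1, fun m Z hZ => ?_⟩, ⟨hB.1, fun m Z hZ => ?_⟩⟩
  · rw [e hZ]
    split_ifs with hm
    · rw [fieldPairing_eq_zero hB.1.1 (hB.2 m hm) hZ, add_zero]
    · exact fieldPairing_eq_zero hA.1.1 (hA.2 m (by omega)) hZ
  · rw [e hZ]
    split_ifs with hm
    · rw [fieldPairing_eq_zero hA.1.1 (hA.2 m hm) hZ, zero_add]
    · exact fieldPairing_eq_zero hB.1.1 (hB.2 m (by omega)) hZ

end Decomposition

/-! ### Lie-Poisson equations in components -/

/-- A sum over `i` of double sums over index sets that are disjoint for different `i`: the pair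
`(k, j)` occurs only for `i = e k j`. -/
theorem finsum_mem_sum_ite {M : ℕ} (c : ℕ → ℕ → ℝ) (q : ℕ → Prop) (s : ℕ → ℕ → ℕ → Prop)
    (s' : ℕ → ℕ → Prop) (e : ℕ → ℕ → ℕ) [DecidablePred q] [∀ i k j, Decidable (s i k j)]
    [∀ k j, Decidable (s' k j)] (he : ∀ k j, k < M → j < M → e k j < M)
    (hs : ∀ k j, ∀ i, (q i ∧ s i k j) ↔ (i = e k j ∧ s' k j)) :
    (∑ᶠ (i : ℕ) (_ : q i), ∑ k ∈ Finset.range M, ∑ j ∈ Finset.range M,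
      if s i k j then c k j else 0)
      = ∑ k ∈ Finset.range M, ∑ j ∈ Finset.range M, if s' k j then c k j else 0 := by
  have h1 : ∀ i, (∑ᶠ (_ : q i), ∑ k ∈ Finset.range M, ∑ j ∈ Finset.range M,
      if s i k j then c k j else 0)
      = ∑ k ∈ Finset.range M, ∑ j ∈ Finset.range M, if i = e k j then
          (if s' k j then c k j else 0) else 0 := by
    intro i
    rw [finsum_eq_if]
    split_ifs with hq
    · refine Finset.sum_congr rfl fun k _ => Finset.sum_congr rfl fun j _ => ?_
      rw [← ite_and]
      exact if_congr (by rw [← hs]; simp [hq]) rfl rfl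
    · refine (Finset.sum_eq_zero fun k _ => Finset.sum_eq_zero fun j _ => ?_).symm
      rw [← ite_and]
      exact if_neg fun h => hq ((hs k j i).2 h).1
  rw [finsum_congr h1, finsum_eq_sum_of_support_subset (s := Finset.range M), Finset.sum_comm]
  · refine Finset.sum_congr rfl fun k hk => ?_
    rw [Finset.sum_comm]
    refine Finset.sum_congr rfl fun j hj => ?_
    rw [Finset.sum_ite_eq', if_pos]
    rw [Finset.mem_range] at hk hj ⊢
    exact he k j hk hj
  · intro i hi
    rw [Finset.mem_coe, Finset.mem_range]
    by_contra hiM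
    refine hi (Finset.sum_eq_zero fun k hk => Finset.sum_eq_zero fun j hj => if_neg ?_)
    rintro rfl
    exact hiM (he k j (Finset.mem_range.1 hk) (Finset.mem_range.1 hj))

section Components

variable {n : ℕ} {Q : Type*} [TopologicalSpace Q] [ChartedSpace (Base n) Q]
  [IsManifold (𝓡 n) ∞ Q] {Pi : OneForm n Q} {P : ℕ → OneForm n Q} {X Y : FormalField n Q}

theorem neg_mem_hamFields (hX : X ∈ hamFields n Q) : -X ∈ hamFields n Q :=
  fun k => neg_mem_homogeneousFields (hX k)

variable [T2Space Q] [SecondCountableTopology Q]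

/-- `JLPdual_eq_sum` for all of `Y`. -/
theorem JLPdual_eq_sum_left {A : OneForm n Q} (hPi : Pi ∈ dualForms n Q) {M : ℕ}
    (hM : ∀ k, M ≤ k + 1 → MomentVanishes k Pi) {r : ℕ → Prop} [DecidablePred r]
    (hA : IsMomentPart r Pi A) {p : ℕ → Prop} [DecidablePred p]
    (hX : X ∈ hamFields n Q) (hY : Y ∈ hamFields n Q) :
    JLPdual A (restrictDegrees p X) Y
      = ∑ k ∈ Finset.range M, ∑ j ∈ Finset.range M, if r (k + j - 1) ∧ p k then
          fieldPairing Pi (VectorField.mlieBracket (phaseModel n) (X k) (Y j)) else 0 := by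
  have h := JLPdual_eq_sum hPi.1 hM hA (p := p) (p' := fun _ => True) hX hY
  rw [restrictDegrees_true] at h
  simpa only [and_true] using h

/-- `JLPdual_eq_sum` for all of `Π` and `X`. -/
theorem JLPdual_eq_sum_right (hPi : Pi ∈ dualForms n Q) {M : ℕ}
    (hM : ∀ k, M ≤ k + 1 → MomentVanishes k Pi) {p : ℕ → Prop} [DecidablePred p]
    (hX : X ∈ hamFields n Q) (hY : Y ∈ hamFields n Q) :
    JLPdual Pi X (restrictDegrees p Y)
      = ∑ k ∈ Finset.range M, ∑ j ∈ Finset.range M, if p j then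
          fieldPairing Pi (VectorField.mlieBracket (phaseModel n) (X k) (Y j)) else 0 := by
  have h := JLPdual_eq_sum hPi.1 hM (isMomentPart_self hPi) (p := fun _ => True) (p' := p) hX hY
  rw [restrictDegrees_true] at h
  simpa only [true_and] using h

/-- `Y` is the sum of its `𝔰ᶜ`- and its `𝔫ᶜ`-part. -/
theorem JLPdual_add_parts (hPi : Pi ∈ dualForms n Q) (hX : X ∈ hamFields n Q)
    (hY : Y ∈ hamFields n Q) :
    JLPdual Pi X (sPart Y) + JLPdual Pi X (nPart Y) = JLPdual Pi X Y := by
  obtain ⟨M, hM3, hM⟩ := exists_moment_bound hPi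
  have e := JLPdual_eq_sum_left hPi hM (isMomentPart_self hPi) (p := fun _ => True) hX hY
  simp only [restrictDegrees_true, and_self, if_true] at e
  rw [sPart_eq, nPart_eq, e, JLPdual_eq_sum_right hPi hM hX hY, JLPdual_eq_sum_right hPi hM hX hY]
  simp only [← Finset.sum_add_distrib]
  refine Finset.sum_congr rfl fun k _ => Finset.sum_congr rfl fun j _ => ?_
  split_ifs <;> first | (exfalso; omega) | ring1

/-- The right-hand side of the first matched Lie-Poisson equation. -/
theorem matched_s_identity (hPi : Pi ∈ dualForms n Q) (h : IsMomentDecomposition Pi P)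
    (hX : X ∈ hamFields n Q) (hY : Y ∈ hamFields n Q) :
    -JLPdual (sForm P) (sPart X) (sPart Y) - JLPdual (sForm P) (nPart X) (sPart Y)
      - JLPdual (nForm P) (nPart X) (sPart Y) = -JLPdual Pi X (sPart Y) := by
  obtain ⟨M, hM3, hM⟩ := exists_moment_bound hPi
  have e0 := JLPdual_eq_sum_right hPi hM (p := (· ≤ 1)) hX hY
  rw [sPart_eq, nPart_eq, sPart_eq, e0,
    JLPdual_eq_sum hPi.1 hM (isMomentPart_sForm h) hX hY,
    JLPdual_eq_sum hPi.1 hM (isMomentPart_sForm h) hX hY,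
    JLPdual_eq_sum hPi.1 hM (isMomentPart_nForm h) hX hY]
  simp only [← Finset.sum_neg_distrib, ← Finset.sum_sub_distrib]
  refine Finset.sum_congr rfl fun k _ => Finset.sum_congr rfl fun j _ => ?_
  split_ifs <;> first | (exfalso; omega) | ring1

/-- The right-hand side of the second matched Lie-Poisson equation. -/
theorem matched_n_identity (hPi : Pi ∈ dualForms n Q) (h : IsMomentDecomposition Pi P)
    (hX : X ∈ hamFields n Q) (hY : Y ∈ hamFields n Q) :
    -JLPdual (nForm P) (nPart X) (nPart Y) - JLPdual (nForm P) (sPart X) (nPart Y)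
      - JLPdual (sForm P) (sPart X) (nPart Y) = -JLPdual Pi X (nPart Y) := by
  obtain ⟨M, hM3, hM⟩ := exists_moment_bound hPi
  have e0 := JLPdual_eq_sum_right hPi hM (p := (2 ≤ ·)) hX hY
  rw [sPart_eq, nPart_eq, nPart_eq, e0,
    JLPdual_eq_sum hPi.1 hM (isMomentPart_sForm h) hX hY,
    JLPdual_eq_sum hPi.1 hM (isMomentPart_nForm h) hX hY,
    JLPdual_eq_sum hPi.1 hM (isMomentPart_nForm h) hX hY]
  simp only [← Finset.sum_neg_distrib, ← Finset.sum_sub_distrib]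
  refine Finset.sum_congr rfl fun k _ => Finset.sum_congr rfl fun j _ => ?_
  split_ifs <;> first | (exfalso; omega) | ring1

/-- The right-hand side of the first equation in terms of `J_LP`: a pair of degrees `(k, j)` with
`j ≤ 1` occurs in exactly one of the five terms, according to the order `k + j - 1` of the moment.
The truncated `k + j - 1` counts the pair `(0, 0)` as order `0`, which is harmless as its bracket
vanishes. -/
theorem jlp_s_identity (hPi : Pi ∈ dualForms n Q) (h : IsMomentDecomposition Pi P)
    (hX : X ∈ hamFields n Q) (hY : Y ∈ hamFields n Q) :
    -JLPdual (P 0) (sPart X) Y - JLPdual (P 1) (degPart 1 X) Y - JLPdual (sForm P) (nPart X) Y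
      - (∑ᶠ (k : ℕ) (_ : 2 ≤ k), JLPdual (P k) (degPart k X) Y)
      - (∑ᶠ (k : ℕ) (_ : 2 ≤ k), JLPdual (P k) (degPart (k + 1) X) Y)
      = -JLPdual Pi X (sPart Y) := by
  obtain ⟨M, hM3, hM⟩ := exists_moment_bound hPi
  have e0 := JLPdual_eq_sum_right hPi hM (p := (· ≤ 1)) hX hY
  rw [sPart_eq Y, e0]
  simp only [sPart_eq, nPart_eq, degPart_eq,
    JLPdual_eq_sum_left hPi hM (isMomentPart_sForm h) hX hY,
    JLPdual_eq_sum_left hPi hM (isMomentPart_apply h _) hX hY]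
  let c : ℕ → ℕ → ℝ := fun k j =>
    fieldPairing Pi (VectorField.mlieBracket (phaseModel n) (X k) (Y j))
  rw [finsum_mem_sum_ite c (2 ≤ ·) (fun i k j => k + j - 1 = i ∧ k = i)
      (fun k j => 2 ≤ k ∧ j = 1) (fun k _ => k) (fun _ _ hk _ => hk) (by omega),
    finsum_mem_sum_ite c (2 ≤ ·) (fun i k j => k + j - 1 = i ∧ k = i + 1)
      (fun k j => 3 ≤ k ∧ j = 0) (fun k _ => k - 1) (by omega) (by omega)]
  simp only [← Finset.sum_neg_distrib, ← Finset.sum_sub_distrib]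
  refine Finset.sum_congr rfl fun k _ => Finset.sum_congr rfl fun j _ => ?_
  split_ifs <;> first | (exfalso; omega) | ring1

/-- The right-hand side of the second equation in terms of `J_LP`. The summation index `m` is the
degree `j` of the test field. -/
theorem jlp_n_identity (hPi : Pi ∈ dualForms n Q) (h : IsMomentDecomposition Pi P)
    (hX : X ∈ hamFields n Q) (hY : Y ∈ hamFields n Q) :
    -(∑ᶠ (m : ℕ) (_ : 2 ≤ m) (k : ℕ) (_ : 2 ≤ k), JLPdual (P (m + k - 1)) (degPart k X) Y)
      - JLPdual (nForm P) (sPart X) Y - JLPdual (P 1) (degPart 0 X) Y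
      = -JLPdual Pi X (nPart Y) := by
  obtain ⟨M, hM3, hM⟩ := exists_moment_bound hPi
  have e0 := JLPdual_eq_sum_right hPi hM (p := (2 ≤ ·)) hX hY
  rw [nPart_eq Y, e0]
  simp only [sPart_eq, degPart_eq,
    JLPdual_eq_sum_left hPi hM (isMomentPart_nForm h) hX hY,
    JLPdual_eq_sum_left hPi hM (isMomentPart_apply h _) hX hY]
  obtain ⟨c, hc⟩ : ∃ c : ℕ → ℕ → ℝ, ∀ k j,
      fieldPairing Pi (VectorField.mlieBracket (phaseModel n) (X k) (Y j)) = c k j :=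
    ⟨_, fun _ _ => rfl⟩
  simp only [hc]
  have e1 : ∀ m : ℕ, (∑ᶠ (i : ℕ) (_ : 2 ≤ i), ∑ k ∈ Finset.range M, ∑ j ∈ Finset.range M,
      if k + j - 1 = m + i - 1 ∧ k = i then c k j else 0)
      = ∑ k ∈ Finset.range M, ∑ j ∈ Finset.range M, if 2 ≤ k ∧ j = m then c k j else 0 := fun m =>
    finsum_mem_sum_ite c (2 ≤ ·) (fun i k j => k + j - 1 = m + i - 1 ∧ k = i)
      (fun k j => 2 ≤ k ∧ j = m) (fun k _ => k) (fun _ _ hk _ => hk) (by omega)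
  rw [finsum_congr fun m => finsum_congr fun _ => e1 m]
  rw [finsum_mem_sum_ite c (2 ≤ ·) (fun i k j => 2 ≤ k ∧ j = i)
      (fun k j => 2 ≤ k ∧ 2 ≤ j) (fun _ j => j) (fun _ _ _ hj => hj) (by omega)]
  simp only [← Finset.sum_neg_distrib, ← Finset.sum_sub_distrib]
  refine Finset.sum_congr rfl fun k _ => Finset.sum_congr rfl fun j _ => ?_
  split_ifs <;> first | (exfalso; omega) | ring1

/-- The right-hand side of the first momentum-Vlasov equation: the field has terms of degrees `0`
and `2` only. -/
theorem vlasov_s_identity (hPi : Pi ∈ dualForms n Q) (h : IsMomentDecomposition Pi P)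
    (hX : X ∈ hamFields n Q) (hX02 : ∀ k, k ≠ 0 → k ≠ 2 → X k = 0) (hY : Y ∈ hamFields n Q) :
    JLPdual (P 0) (degPart 0 X) Y + JLPdual (sForm P) (degPart 2 X) Y
      + JLPdual (P 2) (degPart 2 X) Y = JLPdual Pi X (sPart Y) := by
  obtain ⟨M, hM3, hM⟩ := exists_moment_bound hPi
  have e0 := JLPdual_eq_sum_right hPi hM (p := (· ≤ 1)) hX hY
  rw [sPart_eq Y, e0]
  simp only [degPart_eq, JLPdual_eq_sum_left hPi hM (isMomentPart_sForm h) hX hY,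
    JLPdual_eq_sum_left hPi hM (isMomentPart_apply h _) hX hY]
  simp only [← Finset.sum_add_distrib]
  refine Finset.sum_congr rfl fun k _ => Finset.sum_congr rfl fun j _ => ?_
  by_cases hk : k ≠ 0 ∧ k ≠ 2
  · simp only [hX02 k hk.1 hk.2, VectorField.mlieBracket_zero_left, fieldPairing_zero, ite_self,
      add_zero]
  · split_ifs <;> first | (exfalso; omega) | ring1

/-- As `vlasov_s_identity`, for the test fields of degree at least `2`. -/
theorem vlasov_n_identity (hPi : Pi ∈ dualForms n Q) (h : IsMomentDecomposition Pi P)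
    (hX : X ∈ hamFields n Q) (hX02 : ∀ k, k ≠ 0 → k ≠ 2 → X k = 0) (hY : Y ∈ hamFields n Q) :
    (∑ᶠ (k : ℕ) (_ : 2 ≤ k), JLPdual (P (k + 1)) (degPart 2 X) Y)
      + JLPdual (nForm P) (degPart 0 X) Y + JLPdual (P 1) (degPart 0 X) Y
      = JLPdual Pi X (nPart Y) := by
  obtain ⟨M, hM3, hM⟩ := exists_moment_bound hPi
  have e0 := JLPdual_eq_sum_right hPi hM (p := (2 ≤ ·)) hX hY
  rw [nPart_eq Y, e0]
  simp only [degPart_eq, JLPdual_eq_sum_left hPi hM (isMomentPart_nForm h) hX hY,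
    JLPdual_eq_sum_left hPi hM (isMomentPart_apply h _) hX hY]
  let c : ℕ → ℕ → ℝ := fun k j =>
    fieldPairing Pi (VectorField.mlieBracket (phaseModel n) (X k) (Y j))
  rw [finsum_mem_sum_ite c (2 ≤ ·) (fun i k j => k + j - 1 = i + 1 ∧ k = 2)
      (fun k j => k = 2 ∧ 2 ≤ j) (fun _ j => j) (fun _ _ _ hj => hj) (by omega)]
  simp only [← Finset.sum_add_distrib]
  refine Finset.sum_congr rfl fun k _ => Finset.sum_congr rfl fun j _ => ?_
  by_cases hk : k ≠ 0 ∧ k ≠ 2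
  · simp only [c, hX02 k hk.1 hk.2, VectorField.mlieBracket_zero_left, fieldPairing_zero, ite_self,
      add_zero]
  · split_ifs <;> first | (exfalso; omega) | ring1

theorem JLPdual_neg (hPi : Pi ∈ dualForms n Q) (hX : X ∈ hamFields n Q)
    (hY : Y ∈ hamFields n Q) : JLPdual Pi (-X) Y = -JLPdual Pi X Y := by
  obtain ⟨M, hM3, hM⟩ := exists_moment_bound hPi
  have e1 := JLPdual_eq_sum hPi.1 hM (isMomentPart_self hPi) (p := fun _ => True)
    (p' := fun _ => True) hX hY
  have e2 := JLPdual_eq_sum hPi.1 hM (isMomentPart_self hPi) (p := fun _ => True)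
    (p' := fun _ => True) (neg_mem_hamFields hX) hY
  simp only [restrictDegrees_true] at e1 e2
  rw [e1, e2, ← Finset.sum_neg_distrib]
  refine Finset.sum_congr rfl fun k _ => ?_
  rw [← Finset.sum_neg_distrib]
  refine Finset.sum_congr rfl fun j _ => ?_
  rw [if_pos (by simp), if_pos (by simp), show (-X) k = -(X k) from rfl,
    mlieBracket_neg_left (hX k) (hY j),
    fieldPairing_neg]

end Components

/-! ### Equivalence of the equations of motion -/

section Equations

variable {n : ℕ} {Q : Type*} [TopologicalSpace Q] [ChartedSpace (Base n) Q]
  [IsManifold (𝓡 n) ∞ Q]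

theorem evolvesBy_congr {I : Set ℝ} {V : Set (FormalField n Q)} {A : ℝ → OneForm n Q}
    {F G : ℝ → FormalField n Q → ℝ} (h : ∀ t ∈ I, ∀ Y ∈ V, F t Y = G t Y) :
    EvolvesBy I V A F ↔ EvolvesBy I V A G :=
  forall₂_congr fun t ht => forall₂_congr fun Y hY => by rw [h t ht Y hY]

theorem smul_mem_dualForms (c : ℝ) {A : OneForm n Q} (hA : A ∈ dualForms n Q) :
    c • A ∈ dualForms n Q := by
  obtain ⟨hA, N, hN⟩ := hA
  exact ⟨isRegular_smul c hA, N, fun k hk => fun q i => (moment_smul q i c hA).trans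
    (by rw [show moment q i A = 0 from hN k hk q i, mul_zero])⟩

variable [T2Space Q] [SecondCountableTopology Q]

theorem pairing_sPart {A : OneForm n Q} (hA : A ∈ sDual n Q) {Y : FormalField n Q}
    (hY : Y ∈ hamFields n Q) : pairing A (sPart Y) = pairing A Y := by
  rw [pairing_eq_finsum, pairing_eq_finsum]
  refine finsum_congr fun m => ?_
  rw [sPart_eq, restrictDegrees, fieldPairing_ite]
  split_ifs with hm
  · rfl
  · exact (fieldPairing_eq_zero hA.1.1 (hA.2 m (by omega)) (hY m)).symm

theorem pairing_nPart {A : OneForm n Q} (hA : A ∈ nDual n Q) {Y : FormalField n Q}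
    (hY : Y ∈ hamFields n Q) : pairing A (nPart Y) = pairing A Y := by
  rw [pairing_eq_finsum, pairing_eq_finsum]
  refine finsum_congr fun m => ?_
  rw [nPart_eq, restrictDegrees, fieldPairing_ite]
  split_ifs with hm
  · rfl
  · exact (fieldPairing_eq_zero hA.1.1 (hA.2 m (by omega)) (hY m)).symm

theorem pairing_degPart {A : OneForm n Q} {k : ℕ} (hA : A ∈ degDual n Q k) {Y : FormalField n Q}
    (hY : Y ∈ hamFields n Q) : pairing A (degPart k Y) = pairing A Y := by
  rw [pairing_eq_finsum, pairing_eq_finsum]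
  refine finsum_congr fun m => ?_
  rw [degPart_eq, restrictDegrees, fieldPairing_ite]
  split_ifs with hm
  · rfl
  · exact (fieldPairing_eq_zero hA.1.1 (hA.2 m hm) (hY m)).symm

/-- Linear functionals are their own functional derivatives. -/
theorem isFunctionalDeriv_pairing {X : FormalField n Q} (hX : X ∈ hamFields n Q)
    {A : OneForm n Q} (hA : A ∈ dualForms n Q) :
    IsFunctionalDeriv (fun B => pairing B X) (dualForms n Q) (hamFields n Q) A X := by
  refine ⟨hX, fun D hD => ?_⟩
  have h : (fun ε : ℝ => pairing (A + ε • D) X) = fun ε => pairing A X + ε * pairing D X := by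
    funext ε
    rw [pairing_add_form hA (smul_mem_dualForms ε hD) hX, pairing_smul_form]
  rw [h]
  simpa using ((hasDerivAt_id (0 : ℝ)).mul_const (pairing D X)).const_add (pairing A X)

variable {I : Set ℝ} {Pi : ℝ → OneForm n Q} {P : ℝ → ℕ → OneForm n Q} {X : ℝ → FormalField n Q}

/-- The Lie-Poisson equation, tested separately on the `𝔰ᶜ`- and on the `𝔫ᶜ`-part of each field. -/
theorem liePoisson_iff (hI : IsOpen I) (hPi : ∀ t ∈ I, Pi t ∈ dualForms n Q)
    (hP : ∀ t ∈ I, IsMomentDecomposition (Pi t) (P t)) (hX : ∀ t ∈ I, X t ∈ hamFields n Q) :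
    LiePoisson I Pi X ↔
      EvolvesBy I (hamFields n Q) (fun t => sForm (P t))
        (fun t Y => -JLPdual (Pi t) (X t) (sPart Y)) ∧
      EvolvesBy I (hamFields n Q) (fun t => nForm (P t))
        (fun t Y => -JLPdual (Pi t) (X t) (nPart Y)) := by
  have hcoad : ∀ t ∈ I, ∀ Y ∈ hamFields n Q, -coad (X t) (Pi t) Y = -JLPdual (Pi t) (X t) Y := by
    intro t ht Y hY
    rw [coad, neg_neg, pairing_bracket (hPi t ht) (hX t ht) hY]
  constructor
  · intro h
    refine ⟨fun t ht Y hY => ?_, fun t ht Y hY => ?_⟩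
    · have h1 := h t ht (sPart Y) (sPart_mem hY).1
      dsimp only at h1
      rw [hcoad t ht _ (sPart_mem hY).1] at h1
      refine h1.congr_of_eventuallyEq ?_
      filter_upwards [hI.mem_nhds ht] with s hs
      exact pairing_sForm (hPi s hs) (hP s hs) hY
    · have h1 := h t ht (nPart Y) (nPart_mem hY).1
      dsimp only at h1
      rw [hcoad t ht _ (nPart_mem hY).1] at h1
      refine h1.congr_of_eventuallyEq ?_
      filter_upwards [hI.mem_nhds ht] with s hs
      exact pairing_nForm (hPi s hs) (hP s hs) hY
  · rintro ⟨hs, hn⟩ t ht Y hY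
    have h1 := (hs t ht Y hY).add (hn t ht Y hY)
    rw [← neg_add, JLPdual_add_parts (hPi t ht) (hX t ht) hY, ← hcoad t ht Y hY] at h1
    refine h1.congr_of_eventuallyEq ?_
    filter_upwards [hI.mem_nhds ht] with s hs
    rw [dualEq_sForm_add_nForm (hP s hs) Y hY]
    exact pairing_add_form (sForm_mem (hP s hs)).1 (nForm_mem (hP s hs)).1 hY

/-- An equation in `(𝔰ᶜ)*` may be tested on `𝔰ᶜ` or on all fields. -/
theorem evolvesBy_sFields_iff {A : ℝ → OneForm n Q} (hI : IsOpen I) (hA : ∀ t ∈ I, A t ∈ sDual n Q)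
    {F G : ℝ → FormalField n Q → ℝ}
    (hFG : ∀ t ∈ I, ∀ Y ∈ hamFields n Q, F t (sPart Y) = G t Y) :
    EvolvesBy I (sFields n Q) A F ↔ EvolvesBy I (hamFields n Q) A G := by
  constructor
  · intro h t ht Y hY
    have h1 := h t ht (sPart Y) (sPart_mem hY)
    rw [hFG t ht Y hY] at h1
    refine h1.congr_of_eventuallyEq ?_
    filter_upwards [hI.mem_nhds ht] with s hs
    exact (pairing_sPart (hA s hs) hY).symm
  · intro h t ht Y hY
    have h1 := h t ht Y hY.1
    rwa [← hFG t ht Y hY.1, sPart_of_mem hY] at h1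

/-- An equation in `(𝔫ᶜ)*` may be tested on `𝔫ᶜ` or on all fields. -/
theorem evolvesBy_nFields_iff {A : ℝ → OneForm n Q} (hI : IsOpen I) (hA : ∀ t ∈ I, A t ∈ nDual n Q)
    {F G : ℝ → FormalField n Q → ℝ}
    (hFG : ∀ t ∈ I, ∀ Y ∈ hamFields n Q, F t (nPart Y) = G t Y) :
    EvolvesBy I (nFields n Q) A F ↔ EvolvesBy I (hamFields n Q) A G := by
  constructor
  · intro h t ht Y hY
    have h1 := h t ht (nPart Y) (nPart_mem hY)
    rw [hFG t ht Y hY] at h1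
    refine h1.congr_of_eventuallyEq ?_
    filter_upwards [hI.mem_nhds ht] with s hs
    exact (pairing_nPart (hA s hs) hY).symm
  · intro h t ht Y hY
    have h1 := h t ht Y hY.1
    rwa [← hFG t ht Y hY.1, nPart_of_mem hY] at h1

theorem liePoisson_iff_matchedLiePoisson (hI : IsOpen I) (hPi : ∀ t ∈ I, Pi t ∈ dualForms n Q)
    (hP : ∀ t ∈ I, IsMomentDecomposition (Pi t) (P t)) (hX : ∀ t ∈ I, X t ∈ hamFields n Q) :
    LiePoisson I Pi X ↔ MatchedLiePoisson I P X := by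
  rw [liePoisson_iff hI hPi hP hX, MatchedLiePoisson,
    evolvesBy_sFields_iff hI (fun t ht => sForm_mem (hP t ht)),
    evolvesBy_nFields_iff hI (fun t ht => nForm_mem (hP t ht))]
  · intro t ht Y hY
    have hs := sForm_mem (hP t ht)
    have hn := nForm_mem (hP t ht)
    have hXs := (sPart_mem (hX t ht)).1
    have hXn := (nPart_mem (hX t ht)).1
    have hYn := (nPart_mem hY).1
    rw [← matched_n_identity (hPi t ht) (hP t ht) (hX t ht) hY, coad, dualLeftAction, crossB,
      pairing_nPart hn (bracket_mem hYn hXs), pairing_sPart hs (bracket_mem hYn hXs),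
      pairing_bracket hn.1 hXn hYn, pairing_bracket hn.1 hYn hXs, pairing_bracket hs.1 hYn hXs,
      JLPdual_swap hn.1 hXs hYn, JLPdual_swap hs.1 hXs hYn]
    ring
  · intro t ht Y hY
    have hs := sForm_mem (hP t ht)
    have hn := nForm_mem (hP t ht)
    have hXs := (sPart_mem (hX t ht)).1
    have hXn := (nPart_mem (hX t ht)).1
    have hYs := (sPart_mem hY).1
    rw [← matched_s_identity (hPi t ht) (hP t ht) (hX t ht) hY, coad, dualRightAction, crossA,
      pairing_nPart hn (bracket_mem hXn hYs), pairing_sPart hs (bracket_mem hXn hYs),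
      pairing_bracket hs.1 hXs hYs, pairing_bracket hs.1 hXn hYs, pairing_bracket hn.1 hXn hYs]
    ring

theorem liePoisson_iff_matchedJLP (hI : IsOpen I) (hPi : ∀ t ∈ I, Pi t ∈ dualForms n Q)
    (hP : ∀ t ∈ I, IsMomentDecomposition (Pi t) (P t)) (hX : ∀ t ∈ I, X t ∈ hamFields n Q) :
    LiePoisson I Pi X ↔ MatchedJLP I P X := by
  rw [liePoisson_iff hI hPi hP hX, MatchedJLP]
  exact and_congr
    (evolvesBy_congr fun t ht Y hY => (jlp_s_identity (hPi t ht) (hP t ht) (hX t ht) hY).symm)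
    (evolvesBy_congr fun t ht Y hY => (jlp_n_identity (hPi t ht) (hP t ht) (hX t ht) hY).symm)

/-- The momentum-Vlasov equations, for minus a Hamiltonian field with terms of degrees `0` and `2`
only. -/
theorem liePoisson_neg_iff {Z : FormalField n Q} (hI : IsOpen I)
    (hPi : ∀ t ∈ I, Pi t ∈ dualForms n Q) (hP : ∀ t ∈ I, IsMomentDecomposition (Pi t) (P t))
    (hZ : Z ∈ hamFields n Q) (hZ02 : ∀ k, k ≠ 0 → k ≠ 2 → Z k = 0) :
    LiePoisson I Pi (fun _ => -Z) ↔
      EvolvesBy I (hamFields n Q) (fun t => sForm (P t)) (fun t Y =>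
        JLPdual (P t 0) (degPart 0 Z) Y + JLPdual (sForm (P t)) (degPart 2 Z) Y
          + JLPdual (P t 2) (degPart 2 Z) Y) ∧
      EvolvesBy I (hamFields n Q) (fun t => nForm (P t)) (fun t Y =>
        (∑ᶠ (k : ℕ) (_ : 2 ≤ k), JLPdual (P t (k + 1)) (degPart 2 Z) Y)
          + JLPdual (nForm (P t)) (degPart 0 Z) Y + JLPdual (P t 1) (degPart 0 Z) Y) := by
  rw [liePoisson_iff hI hPi hP fun _ _ => neg_mem_hamFields hZ]
  refine and_congr (evolvesBy_congr fun t ht Y hY => ?_) (evolvesBy_congr fun t ht Y hY => ?_)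
  · rw [vlasov_s_identity (hPi t ht) (hP t ht) hZ hZ02 hY,
      JLPdual_neg (hPi t ht) hZ (sPart_mem hY).1, neg_neg]
  · rw [vlasov_n_identity (hPi t ht) (hP t ht) hZ hZ02 hY,
      JLPdual_neg (hPi t ht) hZ (nPart_mem hY).1, neg_neg]

end Equations

end

theorem corollary5p6 (n : ℕ) (Q : Type*) [TopologicalSpace Q] [T2Space Q]
    [SecondCountableTopology Q] [ChartedSpace (Base n) Q] [IsManifold (𝓡 n) ∞ Q] :
    -- the decomposition of the dual space into its moments
    (∀ Pi ∈ dualForms n Q, ∃ P : ℕ → OneForm n Q, IsMomentDecomposition Pi P) ∧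
    (∀ Pi ∈ dualForms n Q, ∀ P : ℕ → OneForm n Q, IsMomentDecomposition Pi P →
      sForm P ∈ sDual n Q ∧ nForm P ∈ nDual n Q ∧ DualEq Pi (sForm P + nForm P) ∧
      (∀ A ∈ sDual n Q, ∀ B ∈ nDual n Q, DualEq Pi (A + B) →
        DualEq (sForm P) A ∧ DualEq (nForm P) B) ∧
      ∀ P' : ℕ → OneForm n Q, IsMomentDecomposition Pi P' → ∀ k, DualEq (P k) (P' k)) ∧
    -- the Lie-Poisson equations generated by a Hamiltonian functional
    (∀ (H : OneForm n Q → ℝ) (I : Set ℝ), IsOpen I →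
      ∀ (Pi : ℝ → OneForm n Q) (P : ℝ → ℕ → OneForm n Q) (X : ℝ → FormalField n Q),
      (∀ t ∈ I, Pi t ∈ dualForms n Q) →
      (∀ t ∈ I, IsMomentDecomposition (Pi t) (P t)) →
      (∀ t ∈ I, IsFunctionalDeriv H (dualForms n Q) (hamFields n Q) (Pi t) (X t)) →
      (∀ t ∈ I,
        IsFunctionalDeriv H (sDual n Q) (sFields n Q) (Pi t) (sPart (X t)) ∧
        IsFunctionalDeriv H (nDual n Q) (nFields n Q) (Pi t) (nPart (X t)) ∧
        ∀ k, IsFunctionalDeriv H (degDual n Q k) (degFields n Q k) (Pi t) (degPart k (X t))) ∧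
      (LiePoisson I Pi X ↔ MatchedLiePoisson I P X) ∧
      (LiePoisson I Pi X ↔ MatchedJLP I P X)) ∧
    -- the momentum-Vlasov equations: `H(Π) = ⟨Π, -X_h⟩`, `h = φ(q) + K(q, p)`, `K` quadratic in `p`
    (∀ φ ∈ homogeneousFunctions n Q 0, ∀ K ∈ homogeneousFunctions n Q 2,
      ∀ Xφ XK : VField n Q, IsHamiltonianField φ Xφ → IsHamiltonianField K XK →
      (∀ Pi ∈ dualForms n Q,
        IsFunctionalDeriv (fun A => pairing A (-(ofDegree 0 Xφ + ofDegree 2 XK)))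
          (dualForms n Q) (hamFields n Q) Pi (-(ofDegree 0 Xφ + ofDegree 2 XK))) ∧
      ∀ I : Set ℝ, IsOpen I → ∀ (Pi : ℝ → OneForm n Q) (P : ℝ → ℕ → OneForm n Q),
      (∀ t ∈ I, Pi t ∈ dualForms n Q) →
      (∀ t ∈ I, IsMomentDecomposition (Pi t) (P t)) →
      (LiePoisson I Pi (fun _ => -(ofDegree 0 Xφ + ofDegree 2 XK)) ↔
        EvolvesBy I (hamFields n Q) (fun t => sForm (P t)) (fun t Y =>
          JLPdual (P t 0) (ofDegree 0 Xφ) Y + JLPdual (sForm (P t)) (ofDegree 2 XK) Y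
            + JLPdual (P t 2) (ofDegree 2 XK) Y) ∧
        EvolvesBy I (hamFields n Q) (fun t => nForm (P t)) (fun t Y =>
          (∑ᶠ (k : ℕ) (_ : 2 ≤ k), JLPdual (P t (k + 1)) (ofDegree 2 XK) Y)
            + JLPdual (nForm (P t)) (ofDegree 0 Xφ) Y
            + JLPdual (P t 1) (ofDegree 0 Xφ) Y))) := by
  refine ⟨fun Pi hPi => exists_isMomentDecomposition hPi, fun Pi hPi P hP => ?_,
    fun H I hI Pi P X hPi hP hX => ?_, fun φ hφ K hK Xφ XK hXφ hXK => ?_⟩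
  · refine ⟨sForm_mem hP, nForm_mem hP, dualEq_sForm_add_nForm hP, fun A hA B hB hAB => ?_,
      fun P' hP' k => dualEq_of_isMomentPart (isMomentPart_apply hP k) (isMomentPart_apply hP' k)⟩
    obtain ⟨hA', hB'⟩ := isMomentPart_of_dualEq_add hA hB hAB
    exact ⟨dualEq_of_isMomentPart (isMomentPart_sForm hP) hA',
      dualEq_of_isMomentPart (isMomentPart_nForm hP) hB'⟩
  · refine ⟨fun t ht => ?_, liePoisson_iff_matchedLiePoisson hI hPi hP fun t ht => (hX t ht).1,
      liePoisson_iff_matchedJLP hI hPi hP fun t ht => (hX t ht).1⟩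
    obtain ⟨hXt, hH⟩ := hX t ht
    refine ⟨⟨sPart_mem hXt, fun D hD => ?_⟩, ⟨nPart_mem hXt, fun D hD => ?_⟩,
      fun k => ⟨degPart_mem k hXt, fun D hD => ?_⟩⟩
    · rw [pairing_sPart hD hXt]
      exact hH D hD.1
    · rw [pairing_nPart hD hXt]
      exact hH D hD.1
    · rw [pairing_degPart hD hXt]
      exact hH D hD.1
  · have h0 : ofDegree 0 Xφ ∈ hamFields n Q := ofDegree_mem ⟨φ, hφ, hXφ⟩
    have h2 : ofDegree 2 XK ∈ hamFields n Q := ofDegree_mem ⟨K, hK, hXK⟩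
    have hZ : ofDegree 0 Xφ + ofDegree 2 XK ∈ hamFields n Q :=
      fun k => add_mem_homogeneousFields (h0 k) (h2 k)
    refine ⟨fun Pi hPi => isFunctionalDeriv_pairing (neg_mem_hamFields hZ) hPi,
      fun I hI Pi P hPi hP => ?_⟩
    have e : ∀ k, (ofDegree 0 Xφ + ofDegree 2 XK : FormalField n Q) k
        = (if k = 0 then Xφ else 0) + (if k = 2 then XK else 0) := fun _ => rfl
    have e0 : degPart 0 (ofDegree 0 Xφ + ofDegree 2 XK) = ofDegree 0 Xφ := by
      funext k
      simp only [degPart, e, ofDegree]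
      split_ifs with hk hk2
      · omega
      · exact add_zero _
      · rfl
    have e2 : degPart 2 (ofDegree 0 Xφ + ofDegree 2 XK) = ofDegree 2 XK := by
      funext k
      simp only [degPart, e, ofDegree]
      split_ifs with hk hk2
      · omega
      · exact zero_add _
      · rfl
    have hmain := liePoisson_neg_iff hI hPi hP hZ fun k hk0 hk2 => by
      rw [e, if_neg hk0, if_neg hk2]
      exact add_zero _
    rwa [e0, e2] at hmain
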